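/- Let $k\ge 1$. A $b^k$-manifold $(M,Z,j_Z)$ consists of a smooth manifold $M$ (without boundary, Hausdorff, second countable, of dimension $\ge 1$), a closed embedded hypersurface $i: Z\hookrightarrow M$, and a $(k-1)$-jet $j_Z$ along $Z$, that is, a class of smooth functions defined near $Z$ modulo $I^k$, where $I$ is the ideal of functions near $Z$ that vanish on $Z$; it is required that some local defining function of $Z$ represents $j_Z$. (A local defining function is a smooth function $y$ on a neighbourhood $U$ of $Z$ with $Z=\{y=0\}$ and $dy\ne 0$ at all points of $Z$; $y\in j_Z$ means that $y$ represents $j_Z$. No orientations are needed.) A $b^k$-vector field is a smooth vector field $v$ on $M$ that is tangent to $Z$ along $Z$ and satisfies $\mathcal L_v f\in I^k$ for all $f\in j_Z$. These are the sections of a vector bundle ${}^{b^k}TM$; write ${}^{b^k}\Omega^p(M)$ for the smooth sections of $\wedge^p({}^{b^k}TM)^*$. Equivalently, a $b^k$-form of degree $p$ is a smooth $p$-form on $M\setminus Z$ whose value on any $p$ $b^k$-vector fields of $M$ extends to a smooth function on $M$. The differential $d$ of a $b^k$-form is the extension over $Z$ of its exterior derivative on $M\setminus Z$, and ${}^{b^k}H^p(M)$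 is the $p$-th cohomology of the complex $({}^{b^k}\Omega^*(M),d)$. Let $p\ge 1$. A Laurent series of a closed form $\omega\in{}^{b^k}\Omega^p(M)$ is an expression $$\omega=\sum_{i=1}^k\frac{dy}{y^i}\wedge\alpha_{-i}+\beta$$ on $U\setminus Z$, for a neighbourhood $U$ of $Z$, where $y\in j_Z$ is a local defining function of $Z$ on $U$, each $\alpha_{-i}\in\Omega^{p-1}(U)$ is smooth and closed, and $\beta\in\Omega^p(U)$ is smooth. Then: 1. For every local defining function $y\in j_Z$, every closed $b^k$-form of degree $p$ has a Laurent series in $y$. 2. The pullbacks $i^*\alpha_{-i}$ are closed, and their classes $[i^*\alpha_{-i}]\in H^{p-1}(Z)$ depend only on $[\omega]\in{}^{b^k}H^p(M)$: if closed $b^k$-forms $\omega,\omega'$ have the same class in ${}^{b^k}H^p(M)$, and have Laurent series (possibly in different $y,y'\in j_Z$) with coefficients $\alpha_{-i}$ and $\alpha'_{-i}$, then $[i^*\alpha_{-i}]=[i^*\alpha'_{-i}]$ for $1\le i\le k$. 3. Consequently there is a unique map $${}^{b^k}H^p(M)\to (H^{p-1}(Z))^k,\qquad [\omega]\mapsto([i^*\alpha_{-1}],\dots,[i^*\alpha_{-k}]),$$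 whose value at $[\omega]$ is given by every Laurent series of every representative $\omega$; it is linear. -/

import Mathlib

open scoped Manifold ContDiff Topology

noncomputable section

namespace BkGeometry

section Forms

variable {E : Type*} [NormedAddCommGroup E] [NormedSpace ℝ E]
variable {M : Type*} [TopologicalSpace M] [ChartedSpace E M]

/-- A (not necessarily smooth) differential `p`-form: an alternating `p`-linear form on every
tangent space of the manifold `M`, which is modelled on `E`. (The space `TangentSpace 𝓘(ℝ, E) x` is
by definition `E`, identified with the tangent space through the preferred chart at `x`; it is
written as `E` here for the sake of its norm.) -/
def Form (E : Type*) [NormedAddCommGroup E] [NormedSpace ℝ E]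
    (M : Type*) [TopologicalSpace M] [ChartedSpace E M] (p : ℕ) : Type _ :=
  M → E [⋀^Fin p]→L[ℝ] ℝ

instance (p : ℕ) : AddCommGroup (Form E M p) :=
  inferInstanceAs (AddCommGroup (M → E [⋀^Fin p]→L[ℝ] ℝ))

instance (p : ℕ) : Module ℝ (Form E M p) :=
  inferInstanceAs (Module ℝ (M → E [⋀^Fin p]→L[ℝ] ℝ))

theorem add_apply {p : ℕ} (w η : Form E M p) (x : M) : (w + η) x = w x + η x := rfl

theorem smul_apply {p : ℕ} (c : ℝ) (w : Form E M p) (x : M) : (c • w) x = c • w x := rfl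

/-- The expression of `w` in the preferred chart `c` at `x`, that is, the pullback of `w` under
`c⁻¹`, a form on an open set of the model space. -/
def inChart {p : ℕ} (w : Form E M p) (x : M) (e : E) : E [⋀^Fin p]→L[ℝ] ℝ :=
  (w ((chartAt E x).symm e)).compContinuousLinearMap
    (mfderiv 𝓘(ℝ, E) 𝓘(ℝ, E) (chartAt E x).symm e)

/-- `w` is smooth on the open set `U`: its coordinate expressions are. -/
def SmoothFormOn {p : ℕ} (w : Form E M p) (U : Set M) : Prop :=
  ∀ x : M, ContDiffOn ℝ ∞ (inChart w x) ((chartAt E x).target ∩ (chartAt E x).symm ⁻¹' U)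

/-- The exterior derivative, computed at `x` in the preferred chart at `x` and pulled back to
the tangent space at `x`. -/
def extD {p : ℕ} (w : Form E M p) : Form E M (p + 1) := fun x =>
  ContinuousAlternatingMap.compContinuousLinearMap
    (extDeriv (inChart w x) (chartAt E x x))
    (mfderiv 𝓘(ℝ, E) 𝓘(ℝ, E) (chartAt E x) x)

/-- The form `df ∧ α`, so
`(df ∧ α)(v₀, …, v_q) = ∑ i, (-1) ^ i * df(v_i) * α(v₀, …, v_{i-1}, v_{i+1}, …, v_q)`. -/
def dWedge {q : ℕ} (f : M → ℝ) (α : Form E M q) : Form E M (q + 1) := fun x =>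
  let df : E →L[ℝ] ℝ := mfderiv 𝓘(ℝ, E) 𝓘(ℝ, ℝ) f x
  ContinuousAlternatingMap.alternatizeUncurryFin (df.smulRight (α x))

/-- The pullback of a form under a map of manifolds. -/
def pullback {E' : Type*} [NormedAddCommGroup E'] [NormedSpace ℝ E']
    {Z : Type*} [TopologicalSpace Z] [ChartedSpace E' Z] {p : ℕ}
    (i : Z → M) (w : Form E M p) : Form E' Z p := fun z =>
  (w (i z)).compContinuousLinearMap (mfderiv 𝓘(ℝ, E') 𝓘(ℝ, E) i z)

theorem inChart_add {p : ℕ} (w η : Form E M p) (x : M) :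
    inChart (w + η) x = inChart w x + inChart η x := rfl

theorem inChart_smul {p : ℕ} (c : ℝ) (w : Form E M p) (x : M) :
    inChart (c • w) x = c • inChart w x := rfl

theorem inChart_zero {p : ℕ} (x : M) : inChart (0 : Form E M p) x = 0 := rfl

theorem smoothFormOn_zero {p : ℕ} (U : Set M) : SmoothFormOn (0 : Form E M p) U := by
  intro x
  rw [inChart_zero]
  exact contDiffOn_const

theorem SmoothFormOn.add {p : ℕ} {w η : Form E M p} {U : Set M}
    (hw : SmoothFormOn w U) (hη : SmoothFormOn η U) : SmoothFormOn (w + η) U := by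
  intro x
  rw [inChart_add]
  exact (hw x).add (hη x)

theorem SmoothFormOn.smul {p : ℕ} {w : Form E M p} {U : Set M} (c : ℝ)
    (hw : SmoothFormOn w U) : SmoothFormOn (c • w) U := by
  intro x
  rw [inChart_smul]
  exact (hw x).const_smul c

theorem SmoothFormOn.differentiableAt {p : ℕ} {w : Form E M p} {U : Set M} (hU : IsOpen U)
    (hw : SmoothFormOn w U) {x : M} (hx : x ∈ U) :
    DifferentiableAt ℝ (inChart w x) (chartAt E x x) := by
  have hopen : IsOpen ((chartAt E x).target ∩ (chartAt E x).symm ⁻¹' U) :=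
    (chartAt E x).isOpen_inter_preimage_symm hU
  have hmem : chartAt E x x ∈ (chartAt E x).target ∩ (chartAt E x).symm ⁻¹' U := by
    refine ⟨mem_chart_target E x, ?_⟩
    simpa [(chartAt E x).left_inv (mem_chart_source E x)] using hx
  exact ((hw x).differentiableOn (by simp)).differentiableAt (hopen.mem_nhds hmem)

theorem extD_zero {p : ℕ} (x : M) : extD (0 : Form E M p) x = 0 := by
  have h : extDeriv (0 : E → E [⋀^Fin p]→L[ℝ] ℝ) (chartAt E x x) = 0 := by
    have := extDeriv_smul (𝕜 := ℝ) (0 : ℝ) (0 : E → E [⋀^Fin p]→L[ℝ] ℝ) (x := chartAt E x x)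
    simpa using this
  unfold extD
  rw [inChart_zero, h]
  rfl

theorem extD_add {p : ℕ} {w η : Form E M p} {U : Set M} (hU : IsOpen U)
    (hw : SmoothFormOn w U) (hη : SmoothFormOn η U) {x : M} (hx : x ∈ U) :
    extD (w + η) x = extD w x + extD η x := by
  unfold extD
  rw [inChart_add, extDeriv_add (hw.differentiableAt hU hx) (hη.differentiableAt hU hx)]
  rfl

theorem extD_smul {p : ℕ} (c : ℝ) (w : Form E M p) (x : M) :
    extD (c • w) x = c • extD w x := by
  unfold extD
  rw [inChart_smul, extDeriv_smul]
  rfl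

end Forms

section DeRham

variable (E : Type*) [NormedAddCommGroup E] [NormedSpace ℝ E]
variable (M : Type*) [TopologicalSpace M] [ChartedSpace E M]

/-- The smooth closed `p`-forms on `M`. -/
def closedForms (p : ℕ) : Submodule ℝ (Form E M p) where
  carrier := {w | SmoothFormOn w Set.univ ∧ ∀ x, extD w x = 0}
  zero_mem' := ⟨smoothFormOn_zero _, extD_zero⟩
  add_mem' := fun {a b} ha hb => ⟨ha.1.add hb.1, fun x => by
    rw [extD_add isOpen_univ ha.1 hb.1 (Set.mem_univ x), ha.2 x, hb.2 x, add_zero]⟩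
  smul_mem' := fun c a ha => ⟨ha.1.smul c, fun x => by rw [extD_smul, ha.2 x, smul_zero]⟩

/-- The exact `p`-forms on `M`: only `0` in degree `0`, and the differentials of smooth forms
in positive degree. -/
def exactForms : (p : ℕ) → Submodule ℝ (Form E M p)
  | 0 => ⊥
  | p + 1 =>
    { carrier := {w | ∃ η : Form E M p, SmoothFormOn η Set.univ ∧ ∀ x, extD η x = w x}
      zero_mem' := ⟨0, smoothFormOn_zero _, extD_zero⟩
      add_mem' := by
        rintro a b ⟨η, hη, h⟩ ⟨θ, hθ, h'⟩
        exact ⟨η + θ, hη.add hθ, fun x => by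
          rw [extD_add isOpen_univ hη hθ (Set.mem_univ x), h x, h' x]; rfl⟩
      smul_mem' := by
        rintro c a ⟨η, hη, h⟩
        exact ⟨c • η, hη.smul c, fun x => by rw [extD_smul, h x]; rfl⟩ }

/-- The de Rham cohomology `H^p(M)`: closed forms modulo those that are exact. -/
abbrev DeRham (p : ℕ) : Type _ :=
  closedForms E M p ⧸ (exactForms E M p).submoduleOf (closedForms E M p)

/-- The form `w` is smooth and closed, and `c` is its class in `H^p(M)`. -/
def IsClassOf {E : Type*} [NormedAddCommGroup E] [NormedSpace ℝ E]
    {M : Type*} [TopologicalSpace M] [ChartedSpace E M] {p : ℕ}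
    (c : DeRham E M p) (w : Form E M p) : Prop :=
  ∃ h : w ∈ closedForms E M p, c = Submodule.Quotient.mk ⟨w, h⟩

end DeRham

section Jets

variable (E : Type*) [NormedAddCommGroup E] [NormedSpace ℝ E]
variable {M : Type*} [TopologicalSpace M] [ChartedSpace E M]

/-- The ring of functions that are smooth on some neighbourhood of `S`. (Their values away from
`S` are irrelevant, and disappear in the quotients `Jet` below: a function that vanishes near `S`
lies in every power of `vanishingIdeal`.) -/
def smoothNear (S : Set M) : Subalgebra ℝ (M → ℝ) where
  carrier := {f | ∃ U : Set M, IsOpen U ∧ S ⊆ U ∧ ContMDiffOn 𝓘(ℝ, E) 𝓘(ℝ, ℝ) ∞ f U}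
  add_mem' := by
    rintro f g ⟨U, hU, hSU, hf⟩ ⟨V, hV, hSV, hg⟩
    exact ⟨U ∩ V, hU.inter hV, Set.subset_inter hSU hSV,
      (hf.mono Set.inter_subset_left).add (hg.mono Set.inter_subset_right)⟩
  mul_mem' := by
    rintro f g ⟨U, hU, hSU, hf⟩ ⟨V, hV, hSV, hg⟩
    exact ⟨U ∩ V, hU.inter hV, Set.subset_inter hSU hSV,
      (hf.mono Set.inter_subset_left).mul (hg.mono Set.inter_subset_right)⟩
  algebraMap_mem' := fun r => ⟨Set.univ, isOpen_univ, Set.subset_univ _, contMDiffOn_const⟩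

/-- The ideal `I` of the functions near `S` that vanish on `S`. -/
def vanishingIdeal (S : Set M) : Ideal (smoothNear E S) where
  carrier := {f | ∀ x ∈ S, f.1 x = 0}
  zero_mem' := fun _ _ => rfl
  add_mem' := fun {f g} hf hg x hx => by
    change f.1 x + g.1 x = 0
    rw [hf x hx, hg x hx, add_zero]
  smul_mem' := fun c f hf x hx => by
    change c.1 x * f.1 x = 0
    rw [hf x hx, mul_zero]

/-- The `r`-jets along `S` of smooth functions, that is, functions near `S` modulo `I ^ (r+1)`. -/
abbrev Jet (S : Set M) (r : ℕ) : Type _ :=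
  smoothNear E S ⧸ (vanishingIdeal E S) ^ (r + 1)

variable {E}

/-- `f` is smooth near `S` and represents the jet `j`. -/
def Represents {S : Set M} {r : ℕ} (f : M → ℝ) (j : Jet E S r) : Prop :=
  ∃ h : f ∈ smoothNear E S, Ideal.Quotient.mk ((vanishingIdeal E S) ^ (r + 1)) ⟨f, h⟩ = j

/-- `f` is smooth near `S` and lies in `I ^ k`. -/
def VanishesToOrder (E : Type*) [NormedAddCommGroup E] [NormedSpace ℝ E]
    {M : Type*} [TopologicalSpace M] [ChartedSpace E M] (S : Set M) (k : ℕ) (f : M → ℝ) : Prop :=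
  ∃ h : f ∈ smoothNear E S, (⟨f, h⟩ : smoothNear E S) ∈ (vanishingIdeal E S) ^ k

/-- On the open set `U`, which contains `S`, the function `y` is a defining function of `S`:
it is smooth, its zero set in `U` is `S`, and `dy` does not vanish at any point of `S`. -/
structure IsDefiningFunctionOn (E : Type*) [NormedAddCommGroup E] [NormedSpace ℝ E]
    {M : Type*} [TopologicalSpace M] [ChartedSpace E M] (S : Set M) (y : M → ℝ) (U : Set M) :
    Prop where
  isOpen : IsOpen U
  subset : S ⊆ U
  smooth : ContMDiffOn 𝓘(ℝ, E) 𝓘(ℝ, ℝ) ∞ y U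
  zero_iff : ∀ x ∈ U, y x = 0 ↔ x ∈ S
  mfderiv_ne : ∀ x ∈ S, mfderiv 𝓘(ℝ, E) 𝓘(ℝ, ℝ) y x ≠ 0

/-- `y` is a local defining function of `S`. -/
def IsLocalDefiningFunction (E : Type*) [NormedAddCommGroup E] [NormedSpace ℝ E]
    {M : Type*} [TopologicalSpace M] [ChartedSpace E M] (S : Set M) (y : M → ℝ) : Prop :=
  ∃ U : Set M, IsDefiningFunctionOn E S y U

end Jets

section Bk

/-- The structure of a `b^k`-manifold `(M, Z, j_Z)` on `M` (for `k ≥ 1`): `Z` is a closed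
submanifold of `M` with inclusion `incl` (a hypersurface when `E'` has one dimension less
than `E`), and `jet` is a `(k-1)`-jet along `Z` that some local defining function of `Z`
represents. No orientations are needed. -/
structure BkStructure (k : ℕ) (E' : Type*) [NormedAddCommGroup E'] [NormedSpace ℝ E']
    (Z : Type*) [TopologicalSpace Z] [ChartedSpace E' Z]
    (E : Type*) [NormedAddCommGroup E] [NormedSpace ℝ E]
    (M : Type*) [TopologicalSpace M] [ChartedSpace E M] where
  incl : Z → M
  isSmoothEmbedding : Manifold.IsSmoothEmbedding 𝓘(ℝ, E') 𝓘(ℝ, E) ∞ incl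
  isClosed_range : IsClosed (Set.range incl)
  jet : Jet E (Set.range incl) (k - 1)
  exists_represents : ∃ y : M → ℝ,
    IsLocalDefiningFunction E (Set.range incl) y ∧ Represents y jet

variable {k : ℕ} {E' : Type*} [NormedAddCommGroup E'] [NormedSpace ℝ E']
  {Z : Type*} [TopologicalSpace Z] [ChartedSpace E' Z]
  {E : Type*} [NormedAddCommGroup E] [NormedSpace ℝ E]
  {M : Type*} [TopologicalSpace M] [ChartedSpace E M] [IsManifold 𝓘(ℝ, E) ∞ M]

namespace BkStructure

/-- The hypersurface as a subset of `M`. -/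
def hyp (X : BkStructure k E' Z E M) : Set M := Set.range X.incl

/-- `v` is a `b^k`-vector field: a smooth vector field on `M` that is tangent to `Z` along `Z`,
such that `L_v f ∈ I ^ k` for every `f` that represents the jet. -/
structure IsBkVectorField (X : BkStructure k E' Z E M)
    (v : ∀ x : M, TangentSpace 𝓘(ℝ, E) x) : Prop where
  smooth : ContMDiff 𝓘(ℝ, E) (𝓘(ℝ, E).prod 𝓘(ℝ, E)) ∞
    (fun x => (⟨x, v x⟩ : TangentBundle 𝓘(ℝ, E) M))
  tangent : ∀ z : Z, ∃ u : TangentSpace 𝓘(ℝ, E') z,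
    mfderiv 𝓘(ℝ, E') 𝓘(ℝ, E) X.incl z u = v (X.incl z)
  vanishes : ∀ f : M → ℝ, Represents f X.jet →
    VanishesToOrder E X.hyp k (fun x => (mfderiv 𝓘(ℝ, E) 𝓘(ℝ, ℝ) f x (v x) : ℝ))

/-- The `b^k`-forms of degree `p`, the smooth sections of the `p`-th exterior power of the dual
of the bundle whose sections are the `b^k`-vector fields. Since that bundle is the tangent bundle
over the dense open set `M ∖ Z`, such a section is the same as a smooth `p`-form on `M ∖ Z` whose
value on any `p` `b^k`-vector fields of `M` extends to a smooth function on `M`. By convention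
the form is given the value `0` at the points of `Z`. -/
def bkForms (X : BkStructure k E' Z E M) (p : ℕ) : Submodule ℝ (Form E M p) where
  carrier := {w | SmoothFormOn w X.hypᶜ ∧ (∀ x ∈ X.hyp, w x = 0) ∧
    ∀ v : Fin p → (∀ x : M, TangentSpace 𝓘(ℝ, E) x), (∀ l, X.IsBkVectorField (v l)) →
      ∃ g : M → ℝ, ContMDiff 𝓘(ℝ, E) 𝓘(ℝ, ℝ) ∞ g ∧ ∀ x ∉ X.hyp, g x = w x (fun l => v l x)}
  zero_mem' := ⟨smoothFormOn_zero _, fun _ _ => rfl,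
    fun _ _ => ⟨fun _ => 0, contMDiff_const, fun _ _ => rfl⟩⟩
  add_mem' := by
    rintro a b ⟨ha, ha0, ha'⟩ ⟨hb, hb0, hb'⟩
    refine ⟨ha.add hb, fun x hx => ?_, fun v hv => ?_⟩
    · rw [add_apply, ha0 x hx, hb0 x hx, add_zero]
    · obtain ⟨g, hg, hg'⟩ := ha' v hv
      obtain ⟨h, hh, hh'⟩ := hb' v hv
      exact ⟨fun x => g x + h x, hg.add hh, fun x hx => by
        change g x + h x = _
        rw [hg' x hx, hh' x hx]; rfl⟩
  smul_mem' := by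
    rintro c a ⟨ha, ha0, ha'⟩
    refine ⟨ha.smul c, fun x hx => ?_, fun v hv => ?_⟩
    · rw [smul_apply, ha0 x hx, smul_zero]
    · obtain ⟨g, hg, hg'⟩ := ha' v hv
      exact ⟨fun x => c * g x, contMDiff_const.mul hg, fun x hx => by
        change c * g x = _
        rw [hg' x hx]; rfl⟩

/-- The closed `b^k`-forms. The differential of a `b^k`-form is the extension over `Z` of its
differential on `M ∖ Z`. -/
def bkClosed (X : BkStructure k E' Z E M) (p : ℕ) : Submodule ℝ (Form E M p) where
  carrier := {w | w ∈ X.bkForms p ∧ ∀ x ∉ X.hyp, extD w x = 0}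
  zero_mem' := ⟨Submodule.zero_mem _, fun x _ => extD_zero x⟩
  add_mem' := fun {a b} ha hb => ⟨Submodule.add_mem _ ha.1 hb.1, fun x hx => by
    rw [extD_add (U := X.hypᶜ) X.isClosed_range.isOpen_compl ha.1.1 hb.1.1 hx, ha.2 x hx,
      hb.2 x hx, add_zero]⟩
  smul_mem' := fun c a ha => ⟨Submodule.smul_mem _ c ha.1, fun x hx => by
    rw [extD_smul, ha.2 x hx, smul_zero]⟩

/-- The exact `b^k`-forms: only `0` in degree `0`, and the differentials of `b^k`-forms in positive
degree. -/
def bkExact (X : BkStructure k E' Z E M) : (p : ℕ) → Submodule ℝ (Form E M p)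
  | 0 => ⊥
  | p + 1 =>
    { carrier := {w | w ∈ X.bkForms (p + 1) ∧ ∃ η ∈ X.bkForms p, ∀ x ∉ X.hyp, extD η x = w x}
      zero_mem' := ⟨Submodule.zero_mem _, 0, Submodule.zero_mem _, fun x _ => extD_zero x⟩
      add_mem' := by
        rintro a b ⟨ha, η, hη, h⟩ ⟨hb, θ, hθ, h'⟩
        exact ⟨Submodule.add_mem _ ha hb, η + θ, Submodule.add_mem _ hη hθ, fun x hx => by
          rw [extD_add (U := X.hypᶜ) X.isClosed_range.isOpen_compl hη.1 hθ.1 hx, h x hx,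
            h' x hx]; rfl⟩
      smul_mem' := by
        rintro c a ⟨ha, η, hη, h⟩
        exact ⟨Submodule.smul_mem _ c ha, c • η, Submodule.smul_mem _ c hη, fun x hx => by
          rw [extD_smul, h x hx]; rfl⟩ }

/-- The `b^k`-cohomology of `(M, Z, j_Z)` in degree `p`. -/
abbrev BkCohomology (X : BkStructure k E' Z E M) (p : ℕ) : Type _ :=
  X.bkClosed p ⧸ (X.bkExact p).submoduleOf (X.bkClosed p)

/-- `w = ∑_{i=1}^k (dy / y^i) ∧ α_{-i} + β` is a Laurent series of `w`: the function `y`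
is a local defining function of `Z` that represents the jet, and on some neighbourhood `U` of
`Z` the forms `α_{-i}` are smooth and closed, `β` is smooth, and the identity holds on `U ∖ Z`.
The form `α_{-i}` is called `α (i - 1)`. -/
structure IsLaurentSeries (X : BkStructure k E' Z E M) {q : ℕ} (w : Form E M (q + 1))
    (y : M → ℝ) (α : Fin k → Form E M q) (β : Form E M (q + 1)) : Prop where
  represents : Represents y X.jet
  exists_nhds : ∃ U : Set M, IsDefiningFunctionOn E X.hyp y U ∧
    (∀ i, SmoothFormOn (α i) U) ∧ (∀ i, ∀ x ∈ U, extD (α i) x = 0) ∧ SmoothFormOn β U ∧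
    ∀ x ∈ U \ X.hyp,
      w x = ∑ i : Fin k, ((y x) ^ ((i : ℕ) + 1))⁻¹ • dWedge y (α i) x + β x

/-- `L` sends the class of every closed `b^k`-form `w` to the classes `[i^* α_{-1}], …,
[i^* α_{-k}]` of every Laurent series of `w`. -/
def IsLaurentMap (X : BkStructure k E' Z E M) {q : ℕ}
    (L : X.BkCohomology (q + 1) → (Fin k → DeRham E' Z q)) : Prop :=
  ∀ (w : X.bkClosed (q + 1)) (y : M → ℝ) (α : Fin k → Form E M q) (β : Form E M (q + 1)),
    X.IsLaurentSeries w.1 y α β →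
      ∀ i, IsClassOf (L (Submodule.Quotient.mk w) i) (pullback X.incl (α i))

end BkStructure

end Bk

end BkGeometry

end

/-!
Let `i : Z → M` be the inclusion. Near `Z` there is a smooth retraction `r` onto `Z`
(`exists_retraction`), and together with a function `y` which defines `Z` it gives coordinates
`(r, y)` on a neighbourhood of every point of `Z` (`IsTube.exists_isTubeChart`). Everything rests on
expansions in powers of `y`: to every order `N`, a smooth form near `Z` is
`∑ l < N, y ^ l (r^* b l + dy ∧ r^* c l) + y ^ N S`, with smooth forms `b l`, `c l` on `Z` and `S`
near `Z` (`IsTube.exists_expansion`, by Hadamard's lemma). In such an expansion the `c l` are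
determined by the form (`IsTube.coeff_eq_zero`), and so are the `b l`, as one sees on taking the
product with `dy`.

Existence of Laurent series. The coordinate fields tangent to the levels of `y`, and `y ^ k` times
the remaining one, extend from a neighbourhood of a point of `Z` to `b^k`-vector fields of `M`.
Hence, for a `b^k`-form `θ`, the forms `y ^ k θ` and `dy ∧ θ` extend smoothly over `Z`. Expanding the
first and using the second to exclude terms `r^* b / y ^ (l + 1)`, one finds that the polar part of
`θ` is `∑ l < k, dy ∧ r^* c l / y ^ (l + 1)` (`BkStructure.exists_polar_part`). The differential of
`θ` has polar part `-∑ l < k, dy ∧ r^* (d c l) / y ^ (l + 1)`, so that, by uniqueness, the `c l` are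
closed if `θ` is. The forms `r^* c l` are then the coefficients of a Laurent series of `θ`.

Invariance of the residues. If a sum `∑ l < k, dy ∧ δ l / y ^ (l + 1)` with smooth closed `δ l`
extends smoothly over `Z`, then every `i^* δ l` is exact (`IsTube.pullback_mem_exactForms`). Indeed,
the coefficients `b l` of positive order of a closed form are exact, since closedness expresses
`(l + 1) b (l + 1)` as `d c l` (`IsTube.coeff_mem_exactForms`); and uniqueness of coefficients makes
`i^* δ j` a combination of coefficients of positive order of the `δ l` with `l > j`. This is applied
to the difference of two Laurent series. If the two forms differ by `dη`, the polar part of `dη` has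
coefficients pulled back from exact forms of `Z`. If the defining functions `y` and `y'` represent
the same jet, then `y' = y + y ^ k g`, and `dy' / y' ^ (l + 1) - dy / y ^ (l + 1)` is for `l < k` the
differential of a smooth function (`IsTube.exists_dWedge_eq`), which affects the regular part alone.
-/

noncomputable section

namespace BkGeometry

set_option linter.unusedSectionVars false

/-! ### Alternating forms -/

section Alternating

variable {V W : Type*} [NormedAddCommGroup V] [NormedSpace ℝ V]
  [NormedAddCommGroup W] [NormedSpace ℝ W]

/-- A finite-dimensional alternating form is recovered, by a continuous linear map, from its values
on the tuples of vectors of a basis. -/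
theorem exists_reconstruct {ι : Type*} [Finite ι] (b : Module.Basis ι ℝ V) (p : ℕ) :
    ∃ L : ((Fin p → ι) → ℝ) →L[ℝ] V [⋀^Fin p]→L[ℝ] ℝ,
      ∀ a : V [⋀^Fin p]→L[ℝ] ℝ, L (fun J => a (fun j => b (J j))) = a := by
  have := Fintype.ofFinite ι
  let ev : (V [⋀^Fin p]→L[ℝ] ℝ) →ₗ[ℝ] ((Fin p → ι) → ℝ) :=
    { toFun := fun a J => a (fun j => b (J j))
      map_add' := fun _ _ => rfl
      map_smul' := fun _ _ => rfl }
  have hev : LinearMap.ker ev = ⊥ := by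
    rw [LinearMap.ker_eq_bot']
    intro a ha
    have h : a.toAlternatingMap = 0 := Module.Basis.ext_alternating b fun v _ => congrFun ha v
    ext v
    exact congrArg (fun f => f v) h
  obtain ⟨L, hL⟩ := LinearMap.exists_leftInverse_of_injective ev hev
  exact ⟨LinearMap.toContinuousLinearMap L, fun a => LinearMap.congr_fun hL a⟩

/-- The exterior product `l ∧ a` of a linear form and an alternating form. -/
def wedge {q : ℕ} (l : V →L[ℝ] ℝ) (a : V [⋀^Fin q]→L[ℝ] ℝ) : V [⋀^Fin (q + 1)]→L[ℝ] ℝ :=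
  ContinuousAlternatingMap.alternatizeUncurryFin (l.smulRight a)

theorem wedge_apply {q : ℕ} (l : V →L[ℝ] ℝ) (a : V [⋀^Fin q]→L[ℝ] ℝ) (v : Fin (q + 1) → V) :
    wedge l a v = ∑ i : Fin (q + 1), (-1) ^ (i : ℕ) • (l (v i) * a (i.removeNth v)) := by
  simp [wedge, ContinuousAlternatingMap.alternatizeUncurryFin_apply]

/-- The exterior product with a linear form as a continuous bilinear map. -/
def wedgeCLM (V : Type*) [NormedAddCommGroup V] [NormedSpace ℝ V] (q : ℕ) :
    (V →L[ℝ] ℝ) →L[ℝ] (V [⋀^Fin q]→L[ℝ] ℝ) →L[ℝ] V [⋀^Fin (q + 1)]→L[ℝ] ℝ :=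
  ((ContinuousLinearMap.compL ℝ _ _ _)
    (ContinuousAlternatingMap.alternatizeUncurryFinCLM ℝ V ℝ)).comp
      (ContinuousLinearMap.smulRightL ℝ V (V [⋀^Fin q]→L[ℝ] ℝ))

theorem wedgeCLM_apply {q : ℕ} (l : V →L[ℝ] ℝ) (a : V [⋀^Fin q]→L[ℝ] ℝ) :
    wedgeCLM V q l a = wedge l a := rfl

theorem wedge_add {q : ℕ} (l : V →L[ℝ] ℝ) (a b : V [⋀^Fin q]→L[ℝ] ℝ) :
    wedge l (a + b) = wedge l a + wedge l b := by
  simp only [← wedgeCLM_apply, map_add]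

theorem wedge_smul {q : ℕ} (l : V →L[ℝ] ℝ) (c : ℝ) (a : V [⋀^Fin q]→L[ℝ] ℝ) :
    wedge l (c • a) = c • wedge l a := by
  simp only [← wedgeCLM_apply, map_smul]

theorem wedge_zero {q : ℕ} (l : V →L[ℝ] ℝ) : wedge l (0 : V [⋀^Fin q]→L[ℝ] ℝ) = 0 := by
  simp only [← wedgeCLM_apply, map_zero]

theorem wedge_neg {q : ℕ} (l : V →L[ℝ] ℝ) (a : V [⋀^Fin q]→L[ℝ] ℝ) :
    wedge l (-a) = -wedge l a := by
  simp only [← wedgeCLM_apply, map_neg]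

theorem wedge_sum {q : ℕ} {ι : Type*} (s : Finset ι) (l : V →L[ℝ] ℝ)
    (a : ι → V [⋀^Fin q]→L[ℝ] ℝ) : wedge l (∑ i ∈ s, a i) = ∑ i ∈ s, wedge l (a i) := by
  simp only [← wedgeCLM_apply, map_sum]

theorem add_wedge {q : ℕ} (l m : V →L[ℝ] ℝ) (a : V [⋀^Fin q]→L[ℝ] ℝ) :
    wedge (l + m) a = wedge l a + wedge m a := by
  simp only [← wedgeCLM_apply, map_add, _root_.add_apply]

theorem smul_wedge {q : ℕ} (c : ℝ) (l : V →L[ℝ] ℝ) (a : V [⋀^Fin q]→L[ℝ] ℝ) :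
    wedge (c • l) a = c • wedge l a := by
  simp only [← wedgeCLM_apply, map_smul, _root_.smul_apply]

theorem wedge_comp {q : ℕ} (l : V →L[ℝ] ℝ) (a : V [⋀^Fin q]→L[ℝ] ℝ) (g : W →L[ℝ] V) :
    (wedge l a).compContinuousLinearMap g = wedge (l.comp g) (a.compContinuousLinearMap g) := by
  ext v
  simp only [ContinuousAlternatingMap.compContinuousLinearMap_apply, wedge_apply]
  rfl

theorem wedge_wedge_self {q : ℕ} (l : V →L[ℝ] ℝ) (a : V [⋀^Fin q]→L[ℝ] ℝ) :
    wedge l (wedge l a) = 0 := by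
  have h := ContinuousAlternatingMap.alternatizeUncurryFin_alternatizeUncurryFinCLM_comp_of_symmetric
    (f := l.smulRight (l.smulRight a)) (fun x y => by simp [smul_smul, mul_comm])
  rw [← h]
  unfold wedge
  congr 1
  ext v
  simp

theorem smul_compCLM {q : ℕ} (c : ℝ) (a : V [⋀^Fin q]→L[ℝ] ℝ) (g : W →L[ℝ] V) :
    (c • a).compContinuousLinearMap g = c • a.compContinuousLinearMap g := rfl

theorem add_compCLM {q : ℕ} (a b : V [⋀^Fin q]→L[ℝ] ℝ) (g : W →L[ℝ] V) :
    (a + b).compContinuousLinearMap g =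
      a.compContinuousLinearMap g + b.compContinuousLinearMap g := rfl

theorem sum_compCLM {q : ℕ} {ι : Type*} (s : Finset ι) (a : ι → V [⋀^Fin q]→L[ℝ] ℝ)
    (g : W →L[ℝ] V) : (∑ i ∈ s, a i).compContinuousLinearMap g =
      ∑ i ∈ s, (a i).compContinuousLinearMap g :=
  map_sum (ContinuousAlternatingMap.compContinuousLinearMapCLM g) a s

theorem compCLM_comp {X : Type*} [NormedAddCommGroup X] [NormedSpace ℝ X] {q : ℕ}
    (a : V [⋀^Fin q]→L[ℝ] ℝ) (g : W →L[ℝ] V) (h : X →L[ℝ] W) :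
    (a.compContinuousLinearMap g).compContinuousLinearMap h =
      a.compContinuousLinearMap (g.comp h) := rfl

theorem compCLM_id {q : ℕ} (a : V [⋀^Fin q]→L[ℝ] ℝ) :
    a.compContinuousLinearMap (ContinuousLinearMap.id ℝ V) = a := by
  ext v; rfl

/-- Smoothness of a map to a space of alternating forms can be checked on constant vectors. -/
theorem contDiffAt_alternating_iff [FiniteDimensional ℝ V] {p : ℕ} {N : WithTop ℕ∞}
    {f : W → V [⋀^Fin p]→L[ℝ] ℝ} {x : W} :
    ContDiffAt ℝ N f x ↔ ∀ v : Fin p → V, ContDiffAt ℝ N (fun w => f w v) x := by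
  constructor
  · intro h v
    exact (ContinuousAlternatingMap.apply ℝ V ℝ v).contDiff.contDiffAt.comp x h
  · intro h
    obtain ⟨L, hL⟩ := exists_reconstruct (Module.finBasis ℝ V) p
    have h1 : f = fun w => L (fun J => f w (fun j => Module.finBasis ℝ V (J j))) :=
      funext fun w => (hL (f w)).symm
    rw [h1]
    exact L.contDiff.contDiffAt.comp x (contDiffAt_pi.2 fun J => h _)

theorem contDiffAt_alternating_apply [FiniteDimensional ℝ V] {p : ℕ} {N : WithTop ℕ∞}
    {f : W → V [⋀^Fin p]→L[ℝ] ℝ} {g : Fin p → W → V} {x : W} (hf : ContDiffAt ℝ N f x)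
    (hg : ∀ j, ContDiffAt ℝ N (g j) x) : ContDiffAt ℝ N (fun w => f w (fun j => g j w)) x := by
  let b := Module.finBasis ℝ V
  have h1 : (fun w => f w (fun j => g j w)) = fun w =>
      ∑ J : Fin p → Fin (Module.finrank ℝ V),
        (∏ j, b.coord (J j) (g j w)) * f w (fun j => b (J j)) := by
    funext w
    have h2 : (fun j => g j w) = fun j => ∑ a, b.coord a (g j w) • b a :=
      funext fun j => (b.sum_repr (g j w)).symm
    conv_lhs => rw [h2]
    have h3 := ContinuousMultilinearMap.map_sum (f w).toContinuousMultilinearMap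
      (fun j a => b.coord a (g j w) • b a)
    refine h3.trans (Finset.sum_congr rfl fun J _ => ?_)
    have h4 := ContinuousMultilinearMap.map_smul_univ (f w).toContinuousMultilinearMap
      (fun j => b.coord (J j) (g j w)) (fun j => b (J j))
    exact h4
  rw [h1]
  refine ContDiffAt.sum fun J _ => ContDiffAt.mul (contDiffAt_prod fun j _ => ?_)
    (contDiffAt_alternating_iff.1 hf _)
  exact (LinearMap.toContinuousLinearMap (b.coord (J j))).contDiff.contDiffAt.comp x (hg j)

theorem contDiffAt_compCLM {U : Type*} [NormedAddCommGroup U] [NormedSpace ℝ U]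
    [FiniteDimensional ℝ V] [FiniteDimensional ℝ W] {p : ℕ}
    {N : WithTop ℕ∞} {f : U → V [⋀^Fin p]→L[ℝ] ℝ} {g : U → W →L[ℝ] V} {x : U}
    (hf : ContDiffAt ℝ N f x) (hg : ContDiffAt ℝ N g x) :
    ContDiffAt ℝ N (fun w => (f w).compContinuousLinearMap (g w)) x := by
  rw [contDiffAt_alternating_iff]
  intro v
  exact contDiffAt_alternating_apply (g := fun j w => g w (v j)) hf
    fun j => hg.clm_apply contDiffAt_const

theorem contDiffAt_wedge {q : ℕ} {N : WithTop ℕ∞} {l : W → V →L[ℝ] ℝ}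
    {a : W → V [⋀^Fin q]→L[ℝ] ℝ} {x : W} (hl : ContDiffAt ℝ N l x) (ha : ContDiffAt ℝ N a x) :
    ContDiffAt ℝ N (fun w => wedge (l w) (a w)) x := by
  have h := ContinuousLinearMap.contDiff (𝕜 := ℝ) (E := V →L[ℝ] V [⋀^Fin q]→L[ℝ] ℝ)
    (F := V [⋀^Fin (q + 1)]→L[ℝ] ℝ) (n := N)
    (ContinuousAlternatingMap.alternatizeUncurryFinCLM ℝ V ℝ)
  exact h.contDiffAt.comp x (hl.smulRight ha)

/-- The contraction of `dt ∧ c` with `∂ₜ` is `c`, for a form `c` pulled back from `V`. -/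
theorem curryLeft_wedge_snd {q : ℕ} (c : V [⋀^Fin q]→L[ℝ] ℝ) :
    (wedge (ContinuousLinearMap.snd ℝ V ℝ)
      (c.compContinuousLinearMap (ContinuousLinearMap.fst ℝ V ℝ))).curryLeft (0, 1) =
      c.compContinuousLinearMap (ContinuousLinearMap.fst ℝ V ℝ) := by
  ext v
  rw [ContinuousAlternatingMap.curryLeft_apply_apply, wedge_apply, Fin.sum_univ_succ]
  have h : ∀ i : Fin q, (c.compContinuousLinearMap (ContinuousLinearMap.fst ℝ V ℝ))
      (i.succ.removeNth (Matrix.vecCons ((0 : V), (1 : ℝ)) v)) = 0 := by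
    intro i
    obtain ⟨m, rfl⟩ : ∃ m, q = m + 1 := ⟨q - 1, by have := i.2; omega⟩
    exact ContinuousAlternatingMap.map_coord_zero (i := 0) c (by simp [Fin.removeNth])
  simp only [h]
  simp

theorem wedge_snd_comp_inl {q : ℕ} (a : (V × ℝ) [⋀^Fin q]→L[ℝ] ℝ) :
    (wedge (ContinuousLinearMap.snd ℝ V ℝ) a).compContinuousLinearMap
      (ContinuousLinearMap.inl ℝ V ℝ) = 0 := by
  ext v
  simp [wedge_apply]

/-- An alternating form on `V × ℝ` is determined by its restriction to `V` and by the restriction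
to `V` of its contraction with the second unit vector. -/
theorem alternating_prod_ext [FiniteDimensional ℝ V] {q : ℕ} {a a' : (V × ℝ) [⋀^Fin (q + 1)]→L[ℝ] ℝ}
    (h : a.compContinuousLinearMap (ContinuousLinearMap.inl ℝ V ℝ) =
      a'.compContinuousLinearMap (ContinuousLinearMap.inl ℝ V ℝ))
    (h' : (a.curryLeft (0, 1)).compContinuousLinearMap (ContinuousLinearMap.inl ℝ V ℝ) =
      (a'.curryLeft (0, 1)).compContinuousLinearMap (ContinuousLinearMap.inl ℝ V ℝ)) : a = a' := by
  let b := (Module.finBasis ℝ V).prod (Module.Basis.singleton Unit ℝ)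
  have hl : ∀ i, b (Sum.inl i) = (Module.finBasis ℝ V i, 0) := fun i => by simp [b]
  have hr : ∀ u, b (Sum.inr u) = (0, 1) := fun i => by
    simp [b]
  have key : a.toAlternatingMap = a'.toAlternatingMap := by
    refine Module.Basis.ext_alternating b fun J hJ => ?_
    change a (fun i => b (J i)) = a' (fun i => b (J i))
    by_cases hex : ∃ i, J i = Sum.inr ()
    · obtain ⟨i, hi⟩ := hex
      have h1 : (fun i => b (J i)) = i.insertNth (0, 1) (i.removeNth fun i => b (J i)) := by
        rw [eq_comm, Fin.insertNth_eq_iff]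
        simp [hi, hr]
      have h2 : ∃ w : Fin q → V, (i.removeNth fun i => b (J i)) =
          fun j => ContinuousLinearMap.inl ℝ V ℝ (w j) := by
        refine ⟨fun j => (b (J (i.succAbove j))).1, funext fun j => ?_⟩
        have h3 : J (i.succAbove j) ≠ Sum.inr () := fun h =>
          Fin.succAbove_ne i j (hJ (h.trans hi.symm))
        rcases h4 : J (i.succAbove j) with m | m
        · simp [Fin.removeNth, h4, hl]
        · exact absurd h4 h3
      obtain ⟨w, hw⟩ := h2
      rw [h1, ContinuousAlternatingMap.map_insertNth, ContinuousAlternatingMap.map_insertNth, hw]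
      congr 1
      exact congrArg (fun f => f w) h'
    · have h1 : ∃ w : Fin (q + 1) → V, (fun i => b (J i)) =
          fun j => ContinuousLinearMap.inl ℝ V ℝ (w j) := by
        refine ⟨fun j => (b (J j)).1, funext fun j => ?_⟩
        rcases h4 : J j with m | m
        · simp [h4, hl]
        · exact absurd ⟨j, h4⟩ hex
      obtain ⟨w, hw⟩ := h1
      rw [hw]
      exact congrArg (fun f => f w) h
  ext v
  exact congrArg (fun f => f v) key

/-- The decomposition `a = a₀ + dt ∧ c` of an alternating form on `V × ℝ`, where `a₀` and `c`
are pulled back from `V`. -/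
theorem alternating_prod_decomp [FiniteDimensional ℝ V] {q : ℕ}
    (a : (V × ℝ) [⋀^Fin (q + 1)]→L[ℝ] ℝ) :
    a = (a.compContinuousLinearMap (ContinuousLinearMap.inl ℝ V ℝ)).compContinuousLinearMap
        (ContinuousLinearMap.fst ℝ V ℝ) +
      wedge (ContinuousLinearMap.snd ℝ V ℝ)
        (((a.curryLeft (0, 1)).compContinuousLinearMap
          (ContinuousLinearMap.inl ℝ V ℝ)).compContinuousLinearMap
            (ContinuousLinearMap.fst ℝ V ℝ)) := by
  refine alternating_prod_ext ?_ ?_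
  · rw [add_compCLM, wedge_snd_comp_inl, add_zero]
    rfl
  · ext v
    rw [ContinuousAlternatingMap.curryLeft_add, _root_.add_apply, curryLeft_wedge_snd]
    have : ((((a.compContinuousLinearMap (ContinuousLinearMap.inl ℝ V ℝ)).compContinuousLinearMap
        (ContinuousLinearMap.fst ℝ V ℝ)).curryLeft) (0, 1)) = 0 := by
      rw [ContinuousAlternatingMap.curryLeft_compContinuousLinearMap]
      simp only [ContinuousLinearMap.coe_fst', map_zero]
      rfl
    rw [this, zero_add]
    rfl

end Alternating

/-! ### Division by a coordinate -/

section Hadamard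

universe u

/-- Differentiation under the integral sign. The induction changes the target space, from `G` to
`X →L[ℝ] G`, so that both have to lie in the same universe. -/
theorem contDiff_integral_nat {X : Type u} [NormedAddCommGroup X] [NormedSpace ℝ X]
    [FiniteDimensional ℝ X] (N : ℕ) : ∀ {G : Type u} [NormedAddCommGroup G] [NormedSpace ℝ G]
    (f : X × ℝ → G), ContDiff ℝ N f → ContDiff ℝ N (fun x => ∫ s in (0 : ℝ)..1, f (x, s)) := by
  induction N with
  | zero =>
    intro G _ _ f hf
    rw [Nat.cast_zero, contDiff_zero] at hf ⊢
    exact intervalIntegral.continuous_parametric_intervalIntegral_of_continuous'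
      (f := fun x s => f (x, s)) (by simpa [Function.uncurry_def] using hf) 0 1
  | succ N ih =>
    intro G _ _ f hf
    let f' : X × ℝ → X →L[ℝ] G := fun p => (fderiv ℝ f p).comp (ContinuousLinearMap.inl ℝ X ℝ)
    have hf' : ContDiff ℝ N f' :=
      (hf.fderiv_right (m := N) (by norm_cast)).clm_comp contDiff_const
    have hfd : Differentiable ℝ f := hf.differentiable (by norm_cast)
    have hd : ∀ (x : X) (s : ℝ), HasFDerivAt (fun x => f (x, s)) (f' (x, s)) x := fun x s =>
      (hfd (x, s)).hasFDerivAt.comp x (hasFDerivAt_prodMk_left x s)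
    rw [Nat.cast_succ, contDiff_succ_iff_hasFDerivAt]
    refine ⟨fun x => ∫ s in (0 : ℝ)..1, f' (x, s), ih f' hf', fun x => ?_⟩
    have hcf : ∀ x, Continuous fun s => f (x, s) := fun x => hf.continuous.comp (by fun_prop)
    have hcf' : ∀ x, Continuous fun s => f' (x, s) := fun x => hf'.continuous.comp (by fun_prop)
    obtain ⟨C, hC⟩ := ((isCompact_closedBall x 1).prod
      (isCompact_Icc (a := (0 : ℝ)) (b := 1))).exists_bound_of_continuousOn
        hf'.continuous.continuousOn
    refine intervalIntegral.hasFDerivAt_integral_of_dominated_of_fderiv_le (𝕜 := ℝ)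
      (F := fun x s => f (x, s)) (F' := fun x s => f' (x, s)) (bound := fun _ => C)
      (Metric.closedBall_mem_nhds x one_pos) (Filter.Eventually.of_forall fun x =>
        (hcf x).aestronglyMeasurable) ((hcf x).intervalIntegrable _ _)
      (hcf' x).aestronglyMeasurable (Filter.Eventually.of_forall fun s hs y hy => ?_)
      intervalIntegrable_const (Filter.Eventually.of_forall fun s _ y _ => hd y s)
    rw [Set.uIoc_of_le zero_le_one] at hs
    exact hC (y, s) ⟨hy, hs.1.le, hs.2⟩

theorem contDiff_integral {X : Type u} [NormedAddCommGroup X] [NormedSpace ℝ X]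
    [FiniteDimensional ℝ X] {G : Type u} [NormedAddCommGroup G] [NormedSpace ℝ G]
    {f : X × ℝ → G} (hf : ContDiff ℝ ∞ f) :
    ContDiff ℝ ∞ (fun x => ∫ s in (0 : ℝ)..1, f (x, s)) :=
  contDiff_infty.2 fun N => contDiff_integral_nat N f (contDiff_infty.1 hf N)

variable {V : Type u} [NormedAddCommGroup V] [NormedSpace ℝ V] [FiniteDimensional ℝ V]
  {G : Type u} [NormedAddCommGroup G] [NormedSpace ℝ G] [CompleteSpace G]

/-- Hadamard's lemma: the quotient is `∫₀¹ ∂ₜf(u, st) ds`. -/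
theorem exists_eq_smul_of_contDiff {f : V × ℝ → G} (hf : ContDiff ℝ ∞ f)
    (h0 : ∀ u, f (u, 0) = 0) : ∃ g : V × ℝ → G, ContDiff ℝ ∞ g ∧ ∀ p, f p = p.2 • g p := by
  let k : (V × ℝ) × ℝ → G := fun x => fderiv ℝ f (x.1.1, x.2 * x.1.2) (0, 1)
  have hk : ContDiff ℝ ∞ k := by
    refine ContDiff.clm_apply ?_ contDiff_const
    exact (hf.fderiv_right (m := ∞) (by simp)).comp (by fun_prop)
  refine ⟨fun p => ∫ s in (0 : ℝ)..1, k (p, s), contDiff_integral hk, fun p => ?_⟩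
  have hd : ∀ s : ℝ, HasDerivAt (fun s => f (p.1, s * p.2)) (p.2 • k (p, s)) s := by
    intro s
    have h1 : HasFDerivAt f (fderiv ℝ f (p.1, s * p.2)) (p.1, s * p.2) :=
      (hf.differentiable (by simp) _).hasFDerivAt
    have h2 : HasDerivAt (fun s : ℝ => (p.1, s * p.2)) ((0 : V), p.2) s :=
      (hasDerivAt_const s p.1).prodMk (by simpa using (hasDerivAt_id s).mul_const p.2)
    have h3 := h1.comp_hasDerivAt s h2
    have h4 : ((0 : V), p.2) = p.2 • ((0 : V), (1 : ℝ)) := by simp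
    rw [h4, map_smul] at h3
    exact h3
  have hcont : Continuous fun s => p.2 • k (p, s) :=
    (hk.continuous.comp (by fun_prop : Continuous fun s : ℝ => (p, s))).const_smul p.2
  have := intervalIntegral.integral_eq_sub_of_hasDerivAt (fun s _ => hd s)
    (hcont.intervalIntegrable 0 1)
  rw [intervalIntegral.integral_smul] at this
  rw [this]
  simp [h0]

/-- Hadamard's lemma near a point of the hyperplane `t = 0`. -/
theorem exists_eq_smul_near {f : V × ℝ → G} {u₀ : V}
    (hf : ∀ᶠ p in 𝓝 (u₀, (0 : ℝ)), ContDiffAt ℝ ∞ f p)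
    (h0 : ∀ᶠ p in 𝓝 (u₀, (0 : ℝ)), p.2 = 0 → f p = 0) :
    ∃ g : V × ℝ → G, ContDiff ℝ ∞ g ∧ ∀ᶠ p in 𝓝 (u₀, (0 : ℝ)), f p = p.2 • g p := by
  obtain ⟨ε, hε, hε'⟩ := Metric.eventually_nhds_iff.1 (hf.and h0)
  let χ : ContDiffBump (u₀, (0 : ℝ)) := ⟨ε / 4, ε / 2, by positivity, by linarith⟩
  have hout : ∀ p, p ∉ Metric.closedBall (u₀, (0 : ℝ)) (ε / 2) →
      (fun p => χ p • f p) =ᶠ[𝓝 p] fun _ => 0 := by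
    intro p hp
    filter_upwards [Metric.isClosed_closedBall.isOpen_compl.mem_nhds hp] with p' hp'
    have h1 : ε / 2 < dist p' (u₀, 0) := not_le.1 hp'
    rw [χ.zero_of_le_dist h1.le, zero_smul]
  have hin : ∀ p, p ∈ Metric.closedBall (u₀, (0 : ℝ)) (ε / 2) → dist p (u₀, 0) < ε :=
    fun p hp => lt_of_le_of_lt hp (by linarith)
  obtain ⟨g, hg, hg'⟩ := exists_eq_smul_of_contDiff (f := fun p => χ p • f p)
    (contDiff_iff_contDiffAt.2 fun p => by
      by_cases hp : p ∈ Metric.closedBall (u₀, (0 : ℝ)) (ε / 2)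
      · exact χ.contDiff.contDiffAt.smul (hε' (hin p hp)).1
      · exact contDiffAt_const.congr_of_eventuallyEq (hout p hp))
    (fun u => by
      by_cases hp : (u, (0 : ℝ)) ∈ Metric.closedBall (u₀, (0 : ℝ)) (ε / 2)
      · simp only [(hε' (hin _ hp)).2 rfl, smul_zero]
      · exact (hout _ hp).self_of_nhds)
  refine ⟨g, hg, ?_⟩
  filter_upwards [χ.eventuallyEq_one] with p hp
  rw [← hg' p, hp, Pi.one_apply, one_smul]

end Hadamard

/-! ### Calculus of differential forms on a manifold -/

section Calculus

variable {E : Type*} [NormedAddCommGroup E] [NormedSpace ℝ E]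
variable {M : Type*} [TopologicalSpace M] [ChartedSpace E M]
variable {E' : Type*} [NormedAddCommGroup E'] [NormedSpace ℝ E']
variable {N : Type*} [TopologicalSpace N] [ChartedSpace E' N]

/-- `w` is smooth at `x`: its expression in the preferred chart at `x` is. -/
def SmoothFormAt {p : ℕ} (w : Form E M p) (x : M) : Prop :=
  ContDiffAt ℝ ∞ (inChart w x) (chartAt E x x)

/-- The product of a function and a form. -/
def fsmul {p : ℕ} (f : M → ℝ) (w : Form E M p) : Form E M p := fun x => f x • w x

theorem sub_apply {p : ℕ} (w η : Form E M p) (x : M) : (w - η) x = w x - η x := rfl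

theorem sum_apply {p : ℕ} {ι : Type*} (s : Finset ι) (w : ι → Form E M p) (x : M) :
    (∑ i ∈ s, w i) x = ∑ i ∈ s, w i x := Finset.sum_apply x s w

theorem dWedge_eq {q : ℕ} (f : M → ℝ) (α : Form E M q) (x : M) :
    dWedge f α x = wedge (V := E) (mfderiv 𝓘(ℝ, E) 𝓘(ℝ, ℝ) f x) (α x) := rfl

theorem tendsto_chartAt_symm (x : M) :
    Filter.Tendsto (chartAt E x).symm (𝓝 (chartAt E x x)) (𝓝 x) := by
  have h := (chartAt E x).continuousAt_symm (mem_chart_target E x)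
  have h' : Filter.Tendsto (chartAt E x).symm (𝓝 (chartAt E x x))
      (𝓝 ((chartAt E x).symm (chartAt E x x))) := h
  rwa [(chartAt E x).left_inv (mem_chart_source E x)] at h'

theorem inChart_congr {p : ℕ} {w η : Form E M p} {x : M} (h : ∀ᶠ x' in 𝓝 x, w x' = η x') :
    inChart w x =ᶠ[𝓝 (chartAt E x x)] inChart η x := by
  filter_upwards [(tendsto_chartAt_symm (E := E) x).eventually h] with e he
  unfold inChart
  rw [he]

theorem SmoothFormAt.congr {p : ℕ} {w η : Form E M p} {x : M} (hw : SmoothFormAt w x)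
    (h : ∀ᶠ x' in 𝓝 x, η x' = w x') : SmoothFormAt η x :=
  ContDiffAt.congr_of_eventuallyEq hw (inChart_congr h)

theorem extD_congr {p : ℕ} {w η : Form E M p} {x : M} (h : ∀ᶠ x' in 𝓝 x, w x' = η x') :
    extD w x = extD η x := by
  unfold extD
  rw [(inChart_congr h).extDeriv_eq]

theorem smoothFormAt_zero {p : ℕ} (x : M) : SmoothFormAt (0 : Form E M p) x :=
  show ContDiffAt ℝ ∞ (fun _ : E => (0 : E [⋀^Fin p]→L[ℝ] ℝ)) _ from contDiffAt_const

theorem SmoothFormAt.add {p : ℕ} {w η : Form E M p} {x : M} (hw : SmoothFormAt w x)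
    (hη : SmoothFormAt η x) : SmoothFormAt (w + η) x := ContDiffAt.add hw hη

theorem SmoothFormAt.smul {p : ℕ} {w : Form E M p} {x : M} (c : ℝ) (hw : SmoothFormAt w x) :
    SmoothFormAt (c • w) x := ContDiffAt.const_smul c hw

theorem SmoothFormAt.neg {p : ℕ} {w : Form E M p} {x : M} (hw : SmoothFormAt w x) :
    SmoothFormAt (-w) x := by
  have := hw.smul (-1)
  rwa [neg_one_smul] at this

theorem SmoothFormAt.sub {p : ℕ} {w η : Form E M p} {x : M} (hw : SmoothFormAt w x)
    (hη : SmoothFormAt η x) : SmoothFormAt (w - η) x := by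
  rw [sub_eq_add_neg]
  exact hw.add hη.neg

theorem SmoothFormAt.sum {p : ℕ} {ι : Type*} (s : Finset ι) {w : ι → Form E M p} {x : M}
    (hw : ∀ i ∈ s, SmoothFormAt (w i) x) : SmoothFormAt (∑ i ∈ s, w i) x := by
  classical
  induction s using Finset.induction_on with
  | empty => exact smoothFormAt_zero x
  | insert i s hi ih =>
    rw [Finset.sum_insert hi]
    exact (hw i (Finset.mem_insert_self i s)).add
      (ih fun j hj => hw j (Finset.mem_insert_of_mem hj))

theorem extD_add_at {p : ℕ} {w η : Form E M p} {x : M} (hw : SmoothFormAt w x)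
    (hη : SmoothFormAt η x) : extD (w + η) x = extD w x + extD η x := by
  unfold extD
  rw [inChart_add, extDeriv_add (ContDiffAt.differentiableAt hw (by simp))
    (ContDiffAt.differentiableAt hη (by simp))]
  rfl

theorem extD_neg {p : ℕ} (w : Form E M p) (x : M) : extD (-w) x = -extD w x := by
  have h := extD_smul (-1) w x
  rw [neg_one_smul] at h
  exact h.trans (neg_one_smul ℝ (extD w x : E [⋀^Fin (p + 1)]→L[ℝ] ℝ))

theorem extD_sub_at {p : ℕ} {w η : Form E M p} {x : M} (hw : SmoothFormAt w x)
    (hη : SmoothFormAt η x) : extD (w - η) x = extD w x - extD η x := by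
  rw [sub_eq_add_neg, extD_add_at hw hη.neg, extD_neg, sub_eq_add_neg]

theorem extD_sum_at {p : ℕ} {ι : Type*} (s : Finset ι) {w : ι → Form E M p} {x : M}
    (hw : ∀ i ∈ s, SmoothFormAt (w i) x) :
    extD (∑ i ∈ s, w i) x = ∑ i ∈ s, extD (w i) x := by
  classical
  induction s using Finset.induction_on with
  | empty => exact extD_zero x
  | insert i s hi ih =>
    have h2 := fun j hj => hw j (Finset.mem_insert_of_mem hj)
    rw [Finset.sum_insert hi, Finset.sum_insert hi,
      extD_add_at (hw i (Finset.mem_insert_self i s)) (SmoothFormAt.sum s h2), ih h2]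

theorem pullback_congr {p : ℕ} {w η : Form E M p} {g : N → M} {x : N} (h : w (g x) = η (g x)) :
    pullback (E' := E') g w x = pullback g η x := by
  unfold pullback
  rw [h]

theorem pullback_congr_map {p : ℕ} {w : Form E M p} {g g' : N → M} {x : N}
    (h : ∀ᶠ x' in 𝓝 x, g x' = g' x') :
    pullback (E' := E') g w x = pullback g' w x := by
  unfold pullback
  rw [Filter.EventuallyEq.mfderiv_eq (show g =ᶠ[𝓝 x] g' from h), h.self_of_nhds]

theorem pullback_comp {E₂ : Type*} [NormedAddCommGroup E₂] [NormedSpace ℝ E₂]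
    {P : Type*} [TopologicalSpace P] [ChartedSpace E₂ P] {p : ℕ} (w : Form E M p) {f : N → M}
    {g : P → N} {x : P} (hf : MDifferentiableAt 𝓘(ℝ, E') 𝓘(ℝ, E) f (g x))
    (hg : MDifferentiableAt 𝓘(ℝ, E₂) 𝓘(ℝ, E') g x) :
    pullback (E' := E₂) (f ∘ g) w x = pullback g (pullback (E' := E') f w) x := by
  unfold pullback
  rw [mfderiv_comp x hf hg]
  rfl

theorem pullback_id {p : ℕ} (w : Form E M p) (x : M) : pullback (E' := E) id w x = w x := by
  unfold pullback
  rw [mfderiv_id]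
  exact compCLM_id _

theorem pullback_add {p : ℕ} (w η : Form E M p) (g : N → M) :
    pullback (E' := E') g (w + η) = pullback g w + pullback g η := rfl

theorem pullback_sub {p : ℕ} (w η : Form E M p) (g : N → M) :
    pullback (E' := E') g (w - η) = pullback g w - pullback g η := rfl

theorem pullback_sum {p : ℕ} {ι : Type*} (s : Finset ι) (w : ι → Form E M p) (g : N → M) :
    pullback (E' := E') g (∑ i ∈ s, w i) = ∑ i ∈ s, pullback g (w i) := by
  funext x
  rw [sum_apply]
  unfold pullback
  rw [sum_apply]
  exact sum_compCLM s (fun i => (w i (g x) : E [⋀^Fin p]→L[ℝ] ℝ)) _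

theorem pullback_dWedge {q : ℕ} {f : M → ℝ} (a : Form E M q) {g : N → M} {x : N}
    (hf : MDifferentiableAt 𝓘(ℝ, E) 𝓘(ℝ, ℝ) f (g x))
    (hg : MDifferentiableAt 𝓘(ℝ, E') 𝓘(ℝ, E) g x) :
    pullback (E' := E') g (dWedge f a) x = dWedge (f ∘ g) (pullback g a) x := by
  rw [dWedge_eq, mfderiv_comp x hf hg]
  exact wedge_comp _ _ _

theorem two_le_infty : minSmoothness ℝ 2 ≤ (∞ : WithTop ℕ∞) := by
  simp only [minSmoothness_of_isRCLikeNormedField]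
  exact WithTop.coe_le_coe.2 (le_top : (2 : ℕ∞) ≤ ⊤)

theorem eventually_mdifferentiableAt [IsManifold 𝓘(ℝ, E) ∞ M] [IsManifold 𝓘(ℝ, E') ∞ N]
    {g : N → M} {x : N} (hg : ContMDiffAt 𝓘(ℝ, E') 𝓘(ℝ, E) ∞ g x) :
    ∀ᶠ x' in 𝓝 x, MDifferentiableAt 𝓘(ℝ, E') 𝓘(ℝ, E) g x' := by
  have : IsManifold 𝓘(ℝ, E) 1 M := IsManifold.of_le (n := ∞) (by simp)
  have : IsManifold 𝓘(ℝ, E') 1 N := IsManifold.of_le (n := ∞) (by simp)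
  have h1 : ContMDiffAt 𝓘(ℝ, E') 𝓘(ℝ, E) 1 g x := hg.of_le (by simp)
  filter_upwards [(contMDiffAt_iff_contMDiffAt_nhds (by simp)).1 h1] with x' hx'
  exact hx'.mdifferentiableAt (by simp)

variable [IsManifold 𝓘(ℝ, E) ∞ M]

theorem contMDiffAt_chart {x x' : M} (h : x' ∈ (chartAt E x).source) :
    ContMDiffAt 𝓘(ℝ, E) 𝓘(ℝ, E) ∞ (chartAt E x) x' :=
  contMDiffAt_of_mem_maximalAtlas (IsManifold.chart_mem_maximalAtlas x) h

theorem contMDiffAt_chart_symm {x : M} {e : E} (h : e ∈ (chartAt E x).target) :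
    ContMDiffAt 𝓘(ℝ, E) 𝓘(ℝ, E) ∞ (chartAt E x).symm e :=
  contMDiffAt_symm_of_mem_maximalAtlas (IsManifold.chart_mem_maximalAtlas x) h

theorem mfderiv_chart_symm_comp {x x' : M} (h : x' ∈ (chartAt E x).source) :
    (mfderiv 𝓘(ℝ, E) 𝓘(ℝ, E) (chartAt E x).symm (chartAt E x x')).comp
      (mfderiv 𝓘(ℝ, E) 𝓘(ℝ, E) (chartAt E x) x') = ContinuousLinearMap.id ℝ E := by
  have : IsManifold 𝓘(ℝ, E) 1 M := IsManifold.of_le (n := ∞) (by simp)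
  exact (mdifferentiable_chart x).symm_comp_deriv h

theorem eventually_chart_left_inv {x : M} : ∀ᶠ x' in 𝓝 x, (chartAt E x).symm (chartAt E x x') = x' := by
  filter_upwards [(chartAt E x).open_source.mem_nhds (mem_chart_source E x)] with x' hx'
  exact (chartAt E x).left_inv hx'

/-- In the preferred chart at `g u`, the pullback under `g` is a pullback between vector spaces. -/
theorem pullback_eventuallyEq {p : ℕ} (w : Form E M p) {g : E' → M} {u : E'}
    (hg : ContMDiffAt 𝓘(ℝ, E') 𝓘(ℝ, E) ∞ g u) :
    ∀ᶠ u' in 𝓝 u, pullback (E' := E') g w u' =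
      (inChart w (g u) ((chartAt E (g u) ∘ g) u')).compContinuousLinearMap
        (fderiv ℝ (chartAt E (g u) ∘ g) u') := by
  set c := chartAt E (g u)
  have hs : ∀ᶠ u' in 𝓝 u, g u' ∈ c.source :=
    hg.continuousAt.eventually (c.open_source.mem_nhds (mem_chart_source E (g u)))
  have hd := eventually_mdifferentiableAt hg
  filter_upwards [hs.eventually_nhds, hd] with u' hu' hd'
  have h1 : ∀ᶠ u'' in 𝓝 u', (c.symm ∘ (c ∘ g)) u'' = g u'' := by
    filter_upwards [hu'] with u'' hu''
    exact c.left_inv hu''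
  have hc' : ContMDiffAt 𝓘(ℝ, E) 𝓘(ℝ, E) ∞ c (g u') := contMDiffAt_chart hu'.self_of_nhds
  have hcs : ContMDiffAt 𝓘(ℝ, E) 𝓘(ℝ, E) ∞ c.symm (c (g u')) :=
    contMDiffAt_chart_symm (c.map_source hu'.self_of_nhds)
  rw [← pullback_congr_map h1, pullback_comp (E' := E)]
  · rw [← mfderiv_eq_fderiv]
    rfl
  · exact hcs.mdifferentiableAt (by simp)
  · exact (hc'.mdifferentiableAt (by simp)).comp u' hd'

theorem contDiffAt_chart_comp {g : E' → M} {u : E'}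
    (hg : ContMDiffAt 𝓘(ℝ, E') 𝓘(ℝ, E) ∞ g u) : ContDiffAt ℝ ∞ (chartAt E (g u) ∘ g) u :=
  contMDiffAt_iff_contDiffAt.1 ((contMDiffAt_chart (mem_chart_source E (g u))).comp u hg)

theorem contDiffAt_pullback [FiniteDimensional ℝ E] [FiniteDimensional ℝ E'] {p : ℕ}
    {w : Form E M p} {g : E' → M} {u : E'}
    (hg : ContMDiffAt 𝓘(ℝ, E') 𝓘(ℝ, E) ∞ g u) (hw : SmoothFormAt w (g u)) :
    ContDiffAt ℝ ∞ (pullback (E' := E') g w) u := by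
  refine ContDiffAt.congr_of_eventuallyEq ?_ (pullback_eventuallyEq w hg)
  have h := contDiffAt_chart_comp hg
  have hw' : ContDiffAt ℝ ∞ (inChart w (g u)) ((chartAt E (g u) ∘ g) u) := hw
  exact contDiffAt_compCLM (hw'.comp u h) (h.fderiv_right (by simp))

theorem extDeriv_pullback_manifold {p : ℕ} {w : Form E M p} {g : E' → M} {u : E'}
    (hg : ContMDiffAt 𝓘(ℝ, E') 𝓘(ℝ, E) ∞ g u) (hw : SmoothFormAt w (g u)) :
    extDeriv (pullback (E' := E') g w) u = pullback (E' := E') g (extD w) u := by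
  rw [Filter.EventuallyEq.extDeriv_eq (pullback_eventuallyEq w hg)]
  have h := contDiffAt_chart_comp hg
  have hw' : DifferentiableAt ℝ (inChart w (g u)) ((chartAt E (g u) ∘ g) u) :=
    ContDiffAt.differentiableAt hw (by simp)
  rw [extDeriv_pullback hw' h two_le_infty]
  unfold pullback extD
  rw [← mfderiv_eq_fderiv, mfderiv_comp u
    ((contMDiffAt_chart (mem_chart_source E (g u))).mdifferentiableAt (by simp))
    (hg.mdifferentiableAt (by simp))]
  rfl

section Manifold

variable [IsManifold 𝓘(ℝ, E') ∞ N]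

theorem inChart_pullback {p : ℕ} (w : Form E M p) {g : N → M} {x : N}
    (hg : ContMDiffAt 𝓘(ℝ, E') 𝓘(ℝ, E) ∞ g x) :
    ∀ᶠ e in 𝓝 (chartAt E' x x), inChart (pullback (E' := E') g w) x e =
      pullback (E' := E') (g ∘ (chartAt E' x).symm) w e := by
  filter_upwards [(tendsto_chartAt_symm (E := E') x).eventually (eventually_mdifferentiableAt hg),
    (chartAt E' x).open_target.mem_nhds (mem_chart_target E' x)] with e he he'
  rw [pullback_comp w he ((contMDiffAt_chart_symm he').mdifferentiableAt (by simp))]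
  rfl

theorem contMDiffAt_comp_chart_symm {g : N → M} {x : N}
    (hg : ContMDiffAt 𝓘(ℝ, E') 𝓘(ℝ, E) ∞ g x) :
    ContMDiffAt 𝓘(ℝ, E') 𝓘(ℝ, E) ∞ (g ∘ (chartAt E' x).symm) (chartAt E' x x) := by
  have h := (chartAt E' x).left_inv (mem_chart_source E' x)
  refine ContMDiffAt.comp _ ?_ (contMDiffAt_chart_symm (mem_chart_target E' x))
  rwa [h]

/-- The pullback of a smooth form is smooth. -/
theorem SmoothFormAt.pullback [FiniteDimensional ℝ E] [FiniteDimensional ℝ E'] {p : ℕ}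
    {w : Form E M p} {g : N → M} {x : N} (hg : ContMDiffAt 𝓘(ℝ, E') 𝓘(ℝ, E) ∞ g x)
    (hw : SmoothFormAt w (g x)) : SmoothFormAt (pullback (E' := E') g w) x := by
  refine ContDiffAt.congr_of_eventuallyEq ?_ (inChart_pullback w hg)
  refine contDiffAt_pullback (contMDiffAt_comp_chart_symm hg) ?_
  rwa [Function.comp_apply, (chartAt E' x).left_inv (mem_chart_source E' x)]

/-- The exterior derivative commutes with pullbacks. -/
theorem extD_pullback {p : ℕ} {w : Form E M p} {g : N → M} {x : N}
    (hg : ContMDiffAt 𝓘(ℝ, E') 𝓘(ℝ, E) ∞ g x) (hw : SmoothFormAt w (g x)) :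
    extD (BkGeometry.pullback (E' := E') g w) x = BkGeometry.pullback (E' := E') g (extD w) x := by
  have hx := (chartAt E' x).left_inv (mem_chart_source E' x)
  unfold extD
  rw [Filter.EventuallyEq.extDeriv_eq (inChart_pullback w hg),
    extDeriv_pullback_manifold (contMDiffAt_comp_chart_symm hg)
      (by rwa [Function.comp_apply, hx])]
  have h1 : ∀ᶠ x' in 𝓝 x, (g ∘ (chartAt E' x).symm) (chartAt E' x x') = g x' := by
    filter_upwards [eventually_chart_left_inv (E := E') (x := x)] with x' hx'
    rw [Function.comp_apply, hx']
  change BkGeometry.pullback (E' := E') (chartAt E' x)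
    (BkGeometry.pullback (E' := E') (g ∘ (chartAt E' x).symm) (extD w)) x = _
  rw [← pullback_comp]
  · exact pullback_congr_map h1
  · exact (contMDiffAt_comp_chart_symm hg).mdifferentiableAt (by simp)
  · exact (contMDiffAt_chart (mem_chart_source E' x)).mdifferentiableAt (by simp)

end Manifold

theorem SmoothFormOn.smoothFormAt {p : ℕ} {w : Form E M p} {U : Set M} (hU : IsOpen U)
    (hw : SmoothFormOn w U) {x : M} (hx : x ∈ U) : SmoothFormAt w x := by
  refine (hw x).contDiffAt (((chartAt E x).isOpen_inter_preimage_symm hU).mem_nhds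
    ⟨mem_chart_target E x, ?_⟩)
  simpa [(chartAt E x).left_inv (mem_chart_source E x)] using hx

theorem smoothFormOn_of_smoothFormAt [FiniteDimensional ℝ E] {p : ℕ} {w : Form E M p} {U : Set M}
    (hw : ∀ x ∈ U, SmoothFormAt w x) : SmoothFormOn w U := fun _ _ he =>
  (contDiffAt_pullback (contMDiffAt_chart_symm he.1) (hw _ he.2)).contDiffWithinAt

theorem inChart_extD {p : ℕ} {w : Form E M p} {x : M} (hw : ∀ᶠ x' in 𝓝 x, SmoothFormAt w x') :
    inChart (extD w) x =ᶠ[𝓝 (chartAt E x x)] extDeriv (inChart w x) := by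
  filter_upwards [(tendsto_chartAt_symm (E := E) x).eventually hw,
    (chartAt E x).open_target.mem_nhds (mem_chart_target E x)] with e he he'
  exact (extDeriv_pullback_manifold (contMDiffAt_chart_symm he') he).symm

theorem SmoothFormAt.extD {p : ℕ} {w : Form E M p} {x : M}
    (hw : ∀ᶠ x' in 𝓝 x, SmoothFormAt w x') : SmoothFormAt (extD w) x := by
  refine ContDiffAt.congr_of_eventuallyEq ?_ (inChart_extD hw)
  have h := ContinuousLinearMap.contDiff (𝕜 := ℝ) (E := E →L[ℝ] E [⋀^Fin p]→L[ℝ] ℝ)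
    (F := E [⋀^Fin (p + 1)]→L[ℝ] ℝ) (n := ∞)
    (ContinuousAlternatingMap.alternatizeUncurryFinCLM ℝ E ℝ)
  have hw' : ContDiffAt ℝ ∞ (inChart w x) (chartAt E x x) := hw.self_of_nhds
  exact h.contDiffAt.comp _ (hw'.fderiv_right (m := ∞) (by simp))

theorem extD_extD {p : ℕ} {w : Form E M p} {x : M} (hw : ∀ᶠ x' in 𝓝 x, SmoothFormAt w x') :
    BkGeometry.extD (BkGeometry.extD w) x = 0 := by
  have h : extDeriv (inChart (BkGeometry.extD w) x) (chartAt E x x) = 0 := by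
    rw [Filter.EventuallyEq.extDeriv_eq (inChart_extD hw)]
    exact extDeriv_extDeriv_apply (r := ∞) hw.self_of_nhds two_le_infty
  rw [BkGeometry.extD, h]
  rfl

theorem contDiffAt_comp_chart_symm {f : M → ℝ} {x : M} (hf : ContMDiffAt 𝓘(ℝ, E) 𝓘(ℝ, ℝ) ∞ f x) :
    ContDiffAt ℝ ∞ (f ∘ (chartAt E x).symm) (chartAt E x x) :=
  contMDiffAt_iff_contDiffAt.1 (contMDiffAt_comp_chart_symm hf)

theorem SmoothFormAt.fsmul {p : ℕ} {f : M → ℝ} {w : Form E M p} {x : M}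
    (hf : ContMDiffAt 𝓘(ℝ, E) 𝓘(ℝ, ℝ) ∞ f x) (hw : SmoothFormAt w x) :
    SmoothFormAt (fsmul f w) x :=
  (contDiffAt_comp_chart_symm hf).smul hw

theorem inChart_dWedge {q : ℕ} {f : M → ℝ} (a : Form E M q) {x : M}
    (hf : ContMDiffAt 𝓘(ℝ, E) 𝓘(ℝ, ℝ) ∞ f x) :
    ∀ᶠ e in 𝓝 (chartAt E x x), inChart (dWedge f a) x e =
      wedge (fderiv ℝ (f ∘ (chartAt E x).symm) e) (inChart a x e) := by
  filter_upwards [(tendsto_chartAt_symm (E := E) x).eventually (eventually_mdifferentiableAt hf),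
    (chartAt E x).open_target.mem_nhds (mem_chart_target E x)] with e he he'
  have h := pullback_dWedge a he ((contMDiffAt_chart_symm he').mdifferentiableAt (by simp))
  rw [dWedge_eq, mfderiv_eq_fderiv] at h
  exact h

theorem SmoothFormAt.dWedge {q : ℕ} {f : M → ℝ} {a : Form E M q} {x : M}
    (hf : ContMDiffAt 𝓘(ℝ, E) 𝓘(ℝ, ℝ) ∞ f x) (ha : SmoothFormAt a x) :
    SmoothFormAt (dWedge f a) x :=
  ContDiffAt.congr_of_eventuallyEq
    (contDiffAt_wedge ((contDiffAt_comp_chart_symm hf).fderiv_right (by simp)) ha)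
    (inChart_dWedge a hf)

/-- The Leibniz rule `d(f w) = df ∧ w + f dw`. -/
theorem extD_fsmul {p : ℕ} {f : M → ℝ} {w : Form E M p} {x : M}
    (hf : ContMDiffAt 𝓘(ℝ, E) 𝓘(ℝ, ℝ) ∞ f x) (hw : SmoothFormAt w x) :
    BkGeometry.extD (BkGeometry.fsmul f w) x =
      BkGeometry.dWedge f w x + f x • BkGeometry.extD w x := by
  have hx := (chartAt E x).left_inv (mem_chart_source E x)
  have hf' := (contDiffAt_comp_chart_symm hf).differentiableAt (by simp)
  have hw' : DifferentiableAt ℝ (inChart w x) (chartAt E x x) :=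
    ContDiffAt.differentiableAt hw (by simp)
  have h1 : extDeriv (inChart (BkGeometry.fsmul f w) x) (chartAt E x x) =
      wedge (fderiv ℝ (f ∘ (chartAt E x).symm) (chartAt E x x)) (inChart w x (chartAt E x x)) +
        f x • extDeriv (inChart w x) (chartAt E x x) := by
    have h2 : inChart (BkGeometry.fsmul f w) x = fun e =>
        (f ∘ (chartAt E x).symm) e • inChart w x e := rfl
    unfold extDeriv
    rw [h2, fderiv_fun_smul hf' hw', Function.comp_apply, hx,
      ContinuousAlternatingMap.alternatizeUncurryFin_add,
      ContinuousAlternatingMap.alternatizeUncurryFin_smul]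
    exact add_comm _ _
  unfold BkGeometry.extD
  rw [h1]
  refine (add_compCLM _ _ _).trans (congrArg₂ (· + ·) ?_ rfl)
  have h3 := (inChart_dWedge w hf).self_of_nhds
  change (wedge _ _).compContinuousLinearMap _ = _
  rw [← h3]
  change pullback (E' := E) (chartAt E x) (pullback (E' := E) (chartAt E x).symm
    (BkGeometry.dWedge f w)) x = _
  rw [← pullback_comp]
  · exact (pullback_congr_map (g' := id) eventually_chart_left_inv).trans (pullback_id _ x)
  · exact (contMDiffAt_chart_symm (mem_chart_target E x)).mdifferentiableAt (by simp)
  · exact (contMDiffAt_chart (mem_chart_source E x)).mdifferentiableAt (by simp)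

/-- The rule `d(df ∧ a) = -df ∧ da`; it follows from `df ∧ a = d(f a) - f da`. -/
theorem extD_dWedge {q : ℕ} {f : M → ℝ} {a : Form E M q} {x : M}
    (hf : ∀ᶠ x' in 𝓝 x, ContMDiffAt 𝓘(ℝ, E) 𝓘(ℝ, ℝ) ∞ f x')
    (ha : ∀ᶠ x' in 𝓝 x, SmoothFormAt a x') :
    BkGeometry.extD (BkGeometry.dWedge f a) x = -BkGeometry.dWedge f (BkGeometry.extD a) x := by
  have hfa : ∀ᶠ x' in 𝓝 x, SmoothFormAt (BkGeometry.fsmul f a) x' := by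
    filter_upwards [hf, ha] with x' h h' using h'.fsmul h
  have hda := SmoothFormAt.extD ha
  have h : ∀ᶠ x' in 𝓝 x, BkGeometry.dWedge f a x' =
      (BkGeometry.extD (BkGeometry.fsmul f a) - BkGeometry.fsmul f (BkGeometry.extD a)) x' := by
    filter_upwards [hf, ha] with x' h h'
    rw [sub_apply, extD_fsmul h h']
    exact (add_sub_cancel_right _ _).symm
  rw [extD_congr h, extD_sub_at (SmoothFormAt.extD hfa) (hda.fsmul hf.self_of_nhds),
    extD_extD hfa, extD_fsmul hf.self_of_nhds hda, extD_extD ha, smul_zero, add_zero, zero_sub]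

end Calculus

/-! ### Smooth retractions onto a closed submanifold -/

section Retraction

variable {E : Type*} [NormedAddCommGroup E] [NormedSpace ℝ E]
variable {M : Type*} [TopologicalSpace M] [ChartedSpace E M]
variable {E' : Type*} [NormedAddCommGroup E'] [NormedSpace ℝ E']
variable {Z : Type*} [TopologicalSpace Z] [ChartedSpace E' Z]

/-- Near the point `i z`, the map `r` is smooth and is a retraction onto the image of `i`. -/
def IsRetractionAt (E E' : Type*) [NormedAddCommGroup E] [NormedSpace ℝ E]
    {M : Type*} [TopologicalSpace M] [ChartedSpace E M]
    [NormedAddCommGroup E'] [NormedSpace ℝ E']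
    {Z : Type*} [TopologicalSpace Z] [ChartedSpace E' Z] (i : Z → M) (r : M → Z) (z : Z) : Prop :=
  (∀ᶠ x in 𝓝 (i z), ContMDiffAt 𝓘(ℝ, E) 𝓘(ℝ, E') ∞ r x) ∧ ∀ᶠ z' in 𝓝 z, r (i z') = z'

theorem IsRetractionAt.congr {i : Z → M} {r r' : M → Z} {z : Z} (hi : ContinuousAt i z)
    (h : IsRetractionAt E E' i r z) (hr : ∀ᶠ x in 𝓝 (i z), r' x = r x) :
    IsRetractionAt E E' i r' z := by
  refine ⟨?_, ?_⟩
  · filter_upwards [h.1, hr.eventually_nhds] with x hx hx'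
    exact hx.congr_of_eventuallyEq hx'
  · filter_upwards [h.2, hi.eventually hr] with z' hz hz'
    rw [hz', hz]

theorem eventually_isRetractionAt {i : Z → M} {r : M → Z} {z : Z} (hi : Continuous i)
    (h : IsRetractionAt E E' i r z) : ∀ᶠ z' in 𝓝 z, IsRetractionAt E E' i r z' := by
  filter_upwards [hi.continuousAt.eventually h.1.eventually_nhds, h.2.eventually_nhds]
    with z' h1 h2 using ⟨h1, h2⟩

variable [IsManifold 𝓘(ℝ, E) ∞ M] [IsManifold 𝓘(ℝ, E') ∞ Z]

/-- In charts where `i` is a linear inclusion, the linear projection is a retraction. -/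
theorem exists_isRetractionAt {i : Z → M}
    (hi : Manifold.IsSmoothEmbedding 𝓘(ℝ, E') 𝓘(ℝ, E) ∞ i) (z : Z) :
    ∃ r : M → Z, IsRetractionAt E E' i r z := by
  have him := hi.isImmersion.isImmersionAt z
  let dom := him.domChart
  let cod := him.codChart
  have hic : ContinuousAt i z := hi.isEmbedding.continuous.continuousAt
  have hzs : z ∈ dom.source := him.mem_domChart_source
  have hw : ∀ z' ∈ dom.source, (him.equiv.symm (cod (i z'))).1 = dom z' := by
    intro z' hz'
    have h0 : dom z' ∈ (him.domChart.extend 𝓘(ℝ, E')).target := by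
      simpa using dom.map_source hz'
    have h1 := him.writtenInCharts h0
    have h2 : cod (i (dom.symm (dom z'))) = him.equiv (dom z', 0) := by simpa using h1
    rw [dom.left_inv hz'] at h2
    rw [h2]
    simp
  let k : M → E' := fun x => (him.equiv.symm (cod x)).1
  have hk : ∀ x ∈ cod.source, ContMDiffAt 𝓘(ℝ, E) 𝓘(ℝ, E') ∞ k x := by
    intro x hx
    have h1 : ContMDiffAt 𝓘(ℝ, E) 𝓘(ℝ, E) ∞ cod x :=
      contMDiffAt_of_mem_maximalAtlas him.codChart_mem_maximalAtlas hx
    have h2 : ContDiff ℝ ∞ fun e : E => (him.equiv.symm e).1 :=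
      contDiff_fst.comp him.equiv.symm.contDiff
    exact h2.contMDiff.contMDiffAt.comp x h1
  have hcs : ∀ᶠ x in 𝓝 (i z), x ∈ cod.source :=
    cod.open_source.mem_nhds him.mem_codChart_source
  have hkt : ∀ᶠ x in 𝓝 (i z), k x ∈ dom.target := by
    refine (hk _ hcs.self_of_nhds).continuousAt.eventually (dom.open_target.mem_nhds ?_)
    simp only [k]
    rw [hw z hzs]
    exact dom.map_source hzs
  refine ⟨fun x => dom.symm (k x), ?_, ?_⟩
  · filter_upwards [hcs, hkt] with x hx hx'
    have h1 : ContMDiffAt 𝓘(ℝ, E') 𝓘(ℝ, E') ∞ dom.symm (k x) :=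
      contMDiffAt_symm_of_mem_maximalAtlas him.domChart_mem_maximalAtlas hx'
    exact h1.comp x (hk x hx)
  · filter_upwards [dom.open_source.mem_nhds hzs] with z' hz'
    simp only [k]
    rw [hw z' hz', dom.left_inv hz']

/-- Modify the map `r` where `χ ≠ 0`, interpolating between `r` and `r₀` in the chart `c`. -/
def interpolate (c : OpenPartialHomeomorph Z E') (χ : M → ℝ) (r₀ r : M → Z) : M → Z := fun x =>
  if χ x = 0 then r x else c.symm (χ x • c (r₀ x) + (1 - χ x) • c (r x))

/-- Interpolating between two retractions gives a retraction: at the points of `Z` both have the same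
value. No smoothness of `r₀` is needed off the support of `χ`. -/
theorem isRetractionAt_interpolate {i : Z → M} {r₀ r : M → Z} {z z₀ : Z} {χ : M → ℝ}
    (hi : Continuous i) (hχ : ContMDiff 𝓘(ℝ, E) 𝓘(ℝ, ℝ) ∞ χ)
    (hV : i z ∈ tsupport χ → IsRetractionAt E E' i r₀ z ∧ z ∈ (chartAt E' z₀).source)
    (hr : IsRetractionAt E E' i r z) :
    IsRetractionAt E E' i (interpolate (chartAt E' z₀) χ r₀ r) z := by
  set c := chartAt E' z₀
  by_cases hz : i z ∈ tsupport χ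
  swap
  · refine hr.congr hi.continuousAt ?_
    filter_upwards [(isClosed_tsupport χ).isOpen_compl.mem_nhds hz] with x hx
    rw [interpolate, if_pos (image_eq_zero_of_notMem_tsupport hx)]
  · obtain ⟨h₀, hzc⟩ := hV hz
    let k : M → E' := fun x => χ x • c (r₀ x) + (1 - χ x) • c (r x)
    have htend : ∀ {ρ : M → Z}, IsRetractionAt E E' i ρ z → ∀ᶠ x in 𝓝 (i z), ρ x ∈ c.source := by
      intro ρ hρ
      refine hρ.1.self_of_nhds.continuousAt.eventually (c.open_source.mem_nhds ?_)
      rwa [hρ.2.self_of_nhds]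
    have hsm : ∀ {ρ : M → Z}, IsRetractionAt E E' i ρ z →
        ∀ᶠ x in 𝓝 (i z), ContMDiffAt 𝓘(ℝ, E) 𝓘(ℝ, E') ∞ (fun x => c (ρ x)) x := by
      intro ρ hρ
      filter_upwards [hρ.1, htend hρ] with x hx hx'
      exact (contMDiffAt_chart (x := z₀) hx').comp x hx
    have hks : ∀ᶠ x in 𝓝 (i z), ContMDiffAt 𝓘(ℝ, E) 𝓘(ℝ, E') ∞ k x := by
      filter_upwards [hsm h₀, hsm hr] with x h1 h2
      exact ((hχ x).smul h1).add ((contMDiffAt_const.sub (hχ x)).smul h2)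
    have hkz : ∀ z', r₀ (i z') = z' → r (i z') = z' → k (i z') = c z' := by
      intro z' h1 h2
      simp only [k]
      rw [h1, h2, ← add_smul]
      simp
    have hkt : ∀ᶠ x in 𝓝 (i z), k x ∈ c.target := by
      refine hks.self_of_nhds.continuousAt.eventually (c.open_target.mem_nhds ?_)
      rw [hkz z h₀.2.self_of_nhds hr.2.self_of_nhds]
      exact c.map_source hzc
    have hF : IsRetractionAt E E' i (fun x => c.symm (k x)) z := by
      refine ⟨?_, ?_⟩
      · filter_upwards [hks, hkt] with x h1 h2
        exact (contMDiffAt_chart_symm (x := z₀) h2).comp x h1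
      · filter_upwards [h₀.2, hr.2, c.open_source.mem_nhds hzc] with z' h1 h2 h3
        rw [hkz z' h1 h2, c.left_inv h3]
    refine hF.congr hi.continuousAt ?_
    filter_upwards [htend hr] with x hx
    by_cases h : χ x = 0
    · rw [interpolate, if_pos h]
      simp only [k, h, zero_smul, sub_zero, one_smul, zero_add]
      rw [c.left_inv hx]
    · rw [interpolate, if_neg h]

/-- Where `χ = 1`, the interpolation is a retraction even if `r` is not. -/
theorem isRetractionAt_interpolate_of_eq_one {i : Z → M} {r₀ r : M → Z} {z z₀ : Z} {χ : M → ℝ}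
    (hi : Continuous i) (hχ : ∀ᶠ x in 𝓝 (i z), χ x = 1)
    (h₀ : IsRetractionAt E E' i r₀ z) (hzc : z ∈ (chartAt E' z₀).source) :
    IsRetractionAt E E' i (interpolate (chartAt E' z₀) χ r₀ r) z := by
  refine h₀.congr hi.continuousAt ?_
  have hs : ∀ᶠ x in 𝓝 (i z), r₀ x ∈ (chartAt E' z₀).source := by
    refine h₀.1.self_of_nhds.continuousAt.eventually ((chartAt E' z₀).open_source.mem_nhds ?_)
    rwa [h₀.2.self_of_nhds]
  filter_upwards [hχ, hs] with x h1 h2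
  rw [interpolate, if_neg (by rw [h1]; exact one_ne_zero), h1]
  simp [(chartAt E' z₀).left_inv h2]

/-- A closed submanifold is a smooth retract of a neighbourhood. Local retractions are glued one
after the other, by interpolation in charts of the submanifold, along a locally finite countable
family of bump functions. -/
theorem exists_retraction [FiniteDimensional ℝ E] [T2Space M] [SecondCountableTopology M]
    [Nonempty Z] {i : Z → M} (hi : Manifold.IsSmoothEmbedding 𝓘(ℝ, E') 𝓘(ℝ, E) ∞ i)
    (hcl : IsClosed (Set.range i)) : ∃ r : M → Z, ∀ z, IsRetractionAt E E' i r z := by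
  classical
  have hic : Continuous i := hi.isEmbedding.continuous
  have : LocallyCompactSpace M := ChartedSpace.locallyCompactSpace E M
  choose ρ hρ using fun z => exists_isRetractionAt hi z
  have hV : ∀ z₀ : Z, ∃ V ∈ 𝓝 (i z₀), ∀ z, i z ∈ V →
      IsRetractionAt E E' i (ρ z₀) z ∧ z ∈ (chartAt E' z₀).source := by
    intro z₀
    have h1 : ∀ᶠ z in 𝓝 z₀, IsRetractionAt E E' i (ρ z₀) z ∧ z ∈ (chartAt E' z₀).source :=
      (eventually_isRetractionAt hic (hρ z₀)).and
        ((chartAt E' z₀).open_source.mem_nhds (mem_chart_source E' z₀))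
    rw [hi.isEmbedding.isInducing.nhds_eq_comap, Filter.eventually_comap] at h1
    exact ⟨_, h1, fun z hz => hz z rfl⟩
  choose V hVn hV using hV
  have hpt : ∀ x : M, ∃ U ∈ 𝓝 x, ∀ z, i z = x → ∃ z₀, U = V z₀ := by
    intro x
    by_cases hx : x ∈ Set.range i
    · obtain ⟨z, rfl⟩ := hx
      exact ⟨V z, hVn z, fun _ _ => ⟨z, rfl⟩⟩
    · exact ⟨Set.univ, Filter.univ_mem, fun z hz => absurd ⟨z, hz⟩ hx⟩
  choose U hUn hU using hpt
  obtain ⟨ι, fs, hfs⟩ := SmoothBumpCovering.exists_isSubordinate 𝓘(ℝ, E) hcl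
    (fun x _ => hUn x)
  have hz : ∀ a, ∃ z₀, U (fs.c a) = V z₀ := by
    intro a
    obtain ⟨z, hz⟩ := fs.c_mem' a
    exact hU _ z hz
  choose zz hzz using hz
  have hsub : ∀ a, tsupport (fs a) ⊆ V (zz a) := fun a => by
    rw [← hzz a]; exact hfs a
  have hcount : Countable ι := by
    rw [← Set.countable_univ_iff]
    exact fs.locallyFinite.countable_univ fun a => (fs a).nonempty_support
  have := Encodable.ofCountable ι
  let step : ℕ → (M → Z) → (M → Z) := fun n r =>
    (Encodable.decode₂ ι n).elim r
      (fun a => interpolate (chartAt E' (zz a)) (fs a) (ρ (zz a)) r)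
  -- The initial map is irrelevant: each point `i z` has a neighbourhood where some bump function is
  -- one, and at that step the map becomes a retraction there.
  let seq : ℕ → (M → Z) := fun n => Nat.rec (fun _ => Classical.arbitrary Z) step n
  have hstep : ∀ n r z, IsRetractionAt E E' i r z → IsRetractionAt E E' i (step n r) z := by
    intro n r z hr
    simp only [step]
    rcases Encodable.decode₂ ι n with _ | a
    · exact hr
    · exact isRetractionAt_interpolate hic (fs a).contMDiff (fun h => hV _ _ (hsub a h)) hr
  have hlf : LocallyFinite fun n => {x | seq (n + 1) x ≠ seq n x} := by
    intro x
    obtain ⟨t, ht, hfin⟩ := fs.locallyFinite x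
    refine ⟨t, ht, (hfin.image Encodable.encode).subset ?_⟩
    rintro n ⟨x', hx', hxt⟩
    have h1 : step n (seq n) x' ≠ seq n x' := hx'
    simp only [step] at h1
    rcases ha : Encodable.decode₂ ι n with _ | a
    · rw [ha] at h1
      exact absurd rfl h1
    · rw [ha] at h1
      refine ⟨a, ⟨x', ?_, hxt⟩, Encodable.mem_decode₂.1 ha⟩
      intro h0
      exact h1 (by rw [Option.elim_some, interpolate, if_pos h0])
  obtain ⟨F, hF⟩ := hlf.exists_forall_eventually_atTop_eventuallyEq
  refine ⟨F, fun z => ?_⟩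
  have hzr : i z ∈ Set.range i := ⟨z, rfl⟩
  set a := fs.ind (i z) hzr
  have h1 : ∀ᶠ x in 𝓝 (i z), fs a x = 1 := fs.eventuallyEq_one _ hzr
  have h2 : IsRetractionAt E E' i (seq (Encodable.encode a + 1)) z := by
    change IsRetractionAt E E' i (step (Encodable.encode a) (seq (Encodable.encode a))) z
    simp only [step, Encodable.encodek₂, Option.elim_some]
    have h3 : i z ∈ tsupport (fs a) := subset_tsupport _ (by
      rw [Function.mem_support, h1.self_of_nhds]; exact one_ne_zero)
    exact isRetractionAt_interpolate_of_eq_one hic h1 (hV _ _ (hsub a h3)).1 (hV _ _ (hsub a h3)).2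
  have h3 : ∀ n, Encodable.encode a + 1 ≤ n → IsRetractionAt E E' i (seq n) z := by
    intro n hn
    induction n, hn using Nat.le_induction with
    | base => exact h2
    | succ n _ ih => exact hstep n _ z ih
  obtain ⟨n, hn, hn'⟩ := ((hF (i z)).and (Filter.eventually_ge_atTop _)).exists
  exact (h3 n hn').congr hic.continuousAt (hn.mono fun _ h => h.symm)

end Retraction

/-! ### Coordinates adapted to a hypersurface -/

section Tube

variable {E : Type*} [NormedAddCommGroup E] [NormedSpace ℝ E]
variable {M : Type*} [TopologicalSpace M] [ChartedSpace E M]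
variable {E' : Type*} [NormedAddCommGroup E'] [NormedSpace ℝ E']
variable {Z : Type*} [TopologicalSpace Z] [ChartedSpace E' Z]

theorem mfderiv_clm_comp {F G : Type*} [NormedAddCommGroup F] [NormedSpace ℝ F]
    [NormedAddCommGroup G] [NormedSpace ℝ G] (L : F →L[ℝ] G) {f : M → F} {x : M}
    (hf : MDifferentiableAt 𝓘(ℝ, E) 𝓘(ℝ, F) f x) :
    mfderiv 𝓘(ℝ, E) 𝓘(ℝ, G) (fun x => L (f x)) x = L.comp (mfderiv 𝓘(ℝ, E) 𝓘(ℝ, F) f x) := by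
  have h := mfderiv_comp x (g := L) (I' := 𝓘(ℝ, F)) (I'' := 𝓘(ℝ, G))
    L.differentiableAt.mdifferentiableAt hf
  rw [mfderiv_eq_fderiv, L.fderiv] at h
  exact h

/-- A hypersurface `i : Z → M` with a smooth retraction `r` onto it and a function `y` which
defines it, both given near the hypersurface. -/
structure IsTube (E E' : Type*) [NormedAddCommGroup E] [NormedSpace ℝ E]
    {M : Type*} [TopologicalSpace M] [ChartedSpace E M]
    [NormedAddCommGroup E'] [NormedSpace ℝ E']
    {Z : Type*} [TopologicalSpace Z] [ChartedSpace E' Z]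
    (i : Z → M) (r : M → Z) (y : M → ℝ) : Prop where
  finrank_eq : Module.finrank ℝ E = Module.finrank ℝ E' + 1
  smooth_incl : ContMDiff 𝓘(ℝ, E') 𝓘(ℝ, E) ∞ i
  isRetraction : ∀ z, IsRetractionAt E E' i r z
  smooth_fun : ∀ z, ∀ᶠ x in 𝓝 (i z), ContMDiffAt 𝓘(ℝ, E) 𝓘(ℝ, ℝ) ∞ y x
  zero_iff : ∀ z, ∀ᶠ x in 𝓝 (i z), y x = 0 ↔ x ∈ Set.range i
  mfderiv_ne : ∀ z, mfderiv 𝓘(ℝ, E) 𝓘(ℝ, ℝ) y (i z) ≠ 0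

/-- The coordinates near `i z₀` given by the chart of `Z` at `z₀`, the retraction `r` and the
function `y`. -/
def tubeMap (E' : Type*) {M : Type*} [NormedAddCommGroup E']
    {Z : Type*} [TopologicalSpace Z] [ChartedSpace E' Z] (r : M → Z) (y : M → ℝ) (z₀ : Z) :
    M → E' × ℝ := fun x => (chartAt E' z₀ (r x), y x)

/-- `G` is a smooth local inverse of the coordinates `tubeMap`. -/
structure IsTubeChart (E E' : Type*) [NormedAddCommGroup E] [NormedSpace ℝ E]
    {M : Type*} [TopologicalSpace M] [ChartedSpace E M]
    [NormedAddCommGroup E'] [NormedSpace ℝ E']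
    {Z : Type*} [TopologicalSpace Z] [ChartedSpace E' Z]
    (i : Z → M) (r : M → Z) (y : M → ℝ) (z₀ : Z) (G : E' × ℝ → M) : Prop where
  smooth : ∀ᶠ p in 𝓝 (chartAt E' z₀ z₀, (0 : ℝ)), ContMDiffAt 𝓘(ℝ, E' × ℝ) 𝓘(ℝ, E) ∞ G p
  left_inv : ∀ᶠ x in 𝓝 (i z₀), G (tubeMap E' r y z₀ x) = x
  right_inv : ∀ᶠ p in 𝓝 (chartAt E' z₀ z₀, (0 : ℝ)), tubeMap E' r y z₀ (G p) = p
  base : G (chartAt E' z₀ z₀, 0) = i z₀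

namespace IsTube

variable [IsManifold 𝓘(ℝ, E) ∞ M] [IsManifold 𝓘(ℝ, E') ∞ Z]
variable {i : Z → M} {r : M → Z} {y : M → ℝ}

theorem r_incl (T : IsTube E E' i r y) (z : Z) : r (i z) = z :=
  (T.isRetraction z).2.self_of_nhds

theorem y_incl (T : IsTube E E' i r y) (z : Z) : y (i z) = 0 :=
  (T.zero_iff z).self_of_nhds.2 ⟨z, rfl⟩

theorem tubeMap_incl (T : IsTube E E' i r y) (z₀ z : Z) :
    tubeMap E' r y z₀ (i z) = (chartAt E' z₀ z, 0) := by
  rw [tubeMap, T.r_incl, T.y_incl]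

theorem eventually_r_mem (T : IsTube E E' i r y) (z₀ : Z) :
    ∀ᶠ x in 𝓝 (i z₀), r x ∈ (chartAt E' z₀).source := by
  refine (T.isRetraction z₀).1.self_of_nhds.continuousAt.eventually
    ((chartAt E' z₀).open_source.mem_nhds ?_)
  rw [T.r_incl]
  exact mem_chart_source E' z₀

theorem smooth_tubeMap (T : IsTube E E' i r y) (z₀ : Z) :
    ∀ᶠ x in 𝓝 (i z₀), ContMDiffAt 𝓘(ℝ, E) 𝓘(ℝ, E' × ℝ) ∞ (tubeMap E' r y z₀) x := by
  filter_upwards [(T.isRetraction z₀).1, T.smooth_fun z₀, T.eventually_r_mem z₀] with x h1 h2 h3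
  exact ((contMDiffAt_chart (x := z₀) h3).comp x h1).prodMk_space h2

theorem tendsto_tubeMap (T : IsTube E E' i r y) (z₀ : Z) :
    Filter.Tendsto (tubeMap E' r y z₀) (𝓝 (i z₀)) (𝓝 (chartAt E' z₀ z₀, 0)) := by
  have h := (T.smooth_tubeMap z₀).self_of_nhds.continuousAt
  unfold ContinuousAt at h
  rwa [T.tubeMap_incl] at h

theorem mfderiv_tubeMap_snd {z₀ : Z} {x : M}
    (h : ContMDiffAt 𝓘(ℝ, E) 𝓘(ℝ, E' × ℝ) ∞ (tubeMap E' r y z₀) x) (v : E) :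
    (mfderiv 𝓘(ℝ, E) 𝓘(ℝ, E' × ℝ) (tubeMap E' r y z₀) x v : E' × ℝ).2 =
      mfderiv 𝓘(ℝ, E) 𝓘(ℝ, ℝ) y x v :=
  (congrArg (fun f => f v) (mfderiv_clm_comp (ContinuousLinearMap.snd ℝ E' ℝ)
    (h.mdifferentiableAt (by simp)))).symm

/-- On the tangent space of `Z`, the differential of the coordinates is that of the chart. -/
theorem mfderiv_tubeMap_incl (T : IsTube E E' i r y) (z₀ : Z) (u : E') :
    mfderiv 𝓘(ℝ, E) 𝓘(ℝ, E' × ℝ) (tubeMap E' r y z₀) (i z₀)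
      (mfderiv 𝓘(ℝ, E') 𝓘(ℝ, E) i z₀ u) =
      ((mfderiv 𝓘(ℝ, E') 𝓘(ℝ, E') (chartAt E' z₀) z₀ u : E'), (0 : ℝ)) := by
  have hh := (T.smooth_tubeMap z₀).self_of_nhds.mdifferentiableAt (by simp)
  have hi := (T.smooth_incl z₀).mdifferentiableAt (by simp)
  have hti := hh.comp z₀ hi
  have h3 := mfderiv_comp z₀ hh hi
  have h4 := mfderiv_clm_comp (ContinuousLinearMap.fst ℝ E' ℝ) hti
  have h5 := mfderiv_clm_comp (ContinuousLinearMap.snd ℝ E' ℝ) hti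
  have h6 : (fun z => ContinuousLinearMap.fst ℝ E' ℝ ((tubeMap E' r y z₀ ∘ i) z)) =
      chartAt E' z₀ := funext fun z => by simp [T.tubeMap_incl]
  have h7 : (fun z => ContinuousLinearMap.snd ℝ E' ℝ ((tubeMap E' r y z₀ ∘ i) z)) =
      fun _ => (0 : ℝ) := funext fun z => by simp [T.tubeMap_incl]
  rw [h6, h3] at h4
  rw [h7, h3, mfderiv_const] at h5
  exact Prod.ext (congrArg (fun f => f u) h4).symm (congrArg (fun f => f u) h5).symm

theorem surjective_mfderiv_chart (z₀ : Z) :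
    Function.Surjective (mfderiv 𝓘(ℝ, E') 𝓘(ℝ, E') (chartAt E' z₀) z₀) := by
  have : IsManifold 𝓘(ℝ, E') 1 Z := IsManifold.of_le (n := ∞) (by simp)
  exact (mdifferentiable_chart z₀).mfderiv_surjective (mem_chart_source E' z₀)

/-- The differential of the coordinates is onto: its restriction to the tangent space of `Z` is that
of the chart, and `dy ≠ 0`. -/
theorem surjective_mfderiv_tubeMap (T : IsTube E E' i r y) (z₀ : Z) :
    Function.Surjective (mfderiv 𝓘(ℝ, E) 𝓘(ℝ, E' × ℝ) (tubeMap E' r y z₀) (i z₀)) := by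
  set D : E →L[ℝ] E' × ℝ := mfderiv 𝓘(ℝ, E) 𝓘(ℝ, E' × ℝ) (tubeMap E' r y z₀) (i z₀)
  let di : E' →L[ℝ] E := mfderiv 𝓘(ℝ, E') 𝓘(ℝ, E) i z₀
  let dc : E' →L[ℝ] E' := mfderiv 𝓘(ℝ, E') 𝓘(ℝ, E') (chartAt E' z₀) z₀
  let dy : E →L[ℝ] ℝ := mfderiv 𝓘(ℝ, E) 𝓘(ℝ, ℝ) y (i z₀)
  have h1 : ∀ u, D (di u) = (dc u, 0) := T.mfderiv_tubeMap_incl z₀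
  have h2 : ∀ v, (D v).2 = dy v := mfderiv_tubeMap_snd (T.smooth_tubeMap z₀).self_of_nhds
  obtain ⟨v, hv⟩ : ∃ v, dy v ≠ 0 := by
    by_contra hcon
    push Not at hcon
    exact T.mfderiv_ne z₀ (ContinuousLinearMap.ext hcon)
  rintro ⟨a, s⟩
  obtain ⟨u, hu⟩ : ∃ u : E', dc u = a - (s / dy v) • (D v).1 := surjective_mfderiv_chart z₀ _
  refine ⟨(s / dy v) • v + di u, ?_⟩
  change D _ = _
  rw [map_add, map_smul, h1, hu]
  refine Prod.ext ?_ ?_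
  · simp
  · simp [h2, hv]

/-- The tangent space of `Z` is the kernel of `dy`. -/
theorem mem_range_mfderiv_incl [FiniteDimensional ℝ E] [FiniteDimensional ℝ E']
    (T : IsTube E E' i r y) (z : Z) {v : E}
    (hv : mfderiv 𝓘(ℝ, E) 𝓘(ℝ, ℝ) y (i z) v = 0) :
    ∃ u : E', mfderiv 𝓘(ℝ, E') 𝓘(ℝ, E) i z u = v := by
  let D : E →L[ℝ] E' × ℝ := mfderiv 𝓘(ℝ, E) 𝓘(ℝ, E' × ℝ) (tubeMap E' r y z) (i z)
  have hdim : Module.finrank ℝ E = Module.finrank ℝ (E' × ℝ) := by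
    rw [T.finrank_eq, Module.finrank_prod, Module.finrank_self]
  have hinj : Function.Injective D :=
    (LinearMap.injective_iff_surjective_of_finrank_eq_finrank (f := (D : E →ₗ[ℝ] E' × ℝ)) hdim).2
      (T.surjective_mfderiv_tubeMap z)
  obtain ⟨u, hu⟩ := surjective_mfderiv_chart z (D v).1
  refine ⟨u, hinj ((T.mfderiv_tubeMap_incl z u).trans (Prod.ext hu ?_))⟩
  exact ((mfderiv_tubeMap_snd (T.smooth_tubeMap z).self_of_nhds v).trans hv).symm

/-- The coordinates have a smooth local inverse, by the inverse function theorem. -/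
theorem exists_isTubeChart [FiniteDimensional ℝ E] [FiniteDimensional ℝ E']
    (T : IsTube E E' i r y) (z₀ : Z) : ∃ G, IsTubeChart E E' i r y z₀ G := by
  have : CompleteSpace E := FiniteDimensional.complete ℝ E
  have : IsManifold 𝓘(ℝ, E) 1 M := IsManifold.of_le (n := ∞) (by simp)
  set c := chartAt E (i z₀)
  have hcs : i z₀ ∈ c.source := mem_chart_source E (i z₀)
  set e₀ : E := c (i z₀)
  have hce : c.symm e₀ = i z₀ := c.left_inv hcs
  let f : E → E' × ℝ := tubeMap E' r y z₀ ∘ c.symm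
  have hfe : f e₀ = (chartAt E' z₀ z₀, 0) := by
    simp only [f, Function.comp_apply, hce, T.tubeMap_incl]
  have hf : ∀ᶠ e in 𝓝 e₀, ContDiffAt ℝ ∞ f e := by
    have h1 : Filter.Tendsto c.symm (𝓝 e₀) (𝓝 (i z₀)) := tendsto_chartAt_symm (i z₀)
    filter_upwards [h1.eventually (T.smooth_tubeMap z₀),
      c.open_target.mem_nhds (mem_chart_target E (i z₀))] with e h2 h3
    exact contMDiffAt_iff_contDiffAt.1 (h2.comp e (contMDiffAt_chart_symm (x := i z₀) h3))
  have hf₀ := hf.self_of_nhds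
  have hsurj : Function.Surjective (fderiv ℝ f e₀) := by
    have h1 : tubeMap E' r y z₀ =ᶠ[𝓝 (i z₀)] f ∘ c := by
      filter_upwards [eventually_chart_left_inv (E := E) (x := i z₀)] with x hx
      simp only [f, Function.comp_apply]
      rw [hx]
    have h2 := T.surjective_mfderiv_tubeMap z₀
    have h3 := mfderiv_comp (I' := 𝓘(ℝ, E)) (I'' := 𝓘(ℝ, E' × ℝ)) (i z₀) (g := f) (f := c)
      (hf₀.differentiableAt (by simp)).mdifferentiableAt
      ((contMDiffAt_chart hcs).mdifferentiableAt (by simp))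
    intro b
    obtain ⟨v, hv⟩ := h2 b
    refine ⟨mfderiv 𝓘(ℝ, E) 𝓘(ℝ, E) c (i z₀) v, ?_⟩
    rw [← mfderiv_eq_fderiv]
    have h4 : (mfderiv 𝓘(ℝ, E) 𝓘(ℝ, E' × ℝ) (tubeMap E' r y z₀) (i z₀) : E →L[ℝ] E' × ℝ) =
        mfderiv 𝓘(ℝ, E) 𝓘(ℝ, E' × ℝ) (f ∘ c) (i z₀) := h1.mfderiv_eq
    exact (congrArg (fun g => g v) h3).symm.trans
      ((congrArg (fun g : E →L[ℝ] E' × ℝ => g v) h4).symm.trans hv)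
  have hdim : Module.finrank ℝ E = Module.finrank ℝ (E' × ℝ) := by
    rw [T.finrank_eq, Module.finrank_prod, Module.finrank_self]
  let L : E ≃L[ℝ] E' × ℝ := (LinearEquiv.ofBijective (fderiv ℝ f e₀ : E →ₗ[ℝ] E' × ℝ)
    ⟨(LinearMap.injective_iff_surjective_of_finrank_eq_finrank hdim).2 hsurj,
      hsurj⟩).toContinuousLinearEquiv
  have hL : (L : E →L[ℝ] E' × ℝ) = fderiv ℝ f e₀ := by
    ext v <;> rfl
  have hfL : HasFDerivAt f (L : E →L[ℝ] E' × ℝ) e₀ := by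
    rw [hL]
    exact (hf₀.differentiableAt (by simp)).hasFDerivAt
  let φ := hf₀.toOpenPartialHomeomorph f hfL (by simp)
  have hφ : ∀ e, φ e = f e := fun e => rfl
  have hes : e₀ ∈ φ.source := hf₀.mem_toOpenPartialHomeomorph_source hfL (by simp)
  have het : (chartAt E' z₀ z₀, (0 : ℝ)) ∈ φ.target := by
    rw [← hfe, ← hφ]
    exact φ.map_source hes
  have hφs : φ.symm (chartAt E' z₀ z₀, 0) = e₀ := by
    rw [← hfe, ← hφ, φ.left_inv hes]
  have htend : Filter.Tendsto φ.symm (𝓝 (chartAt E' z₀ z₀, 0)) (𝓝 e₀) := by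
    have h1 : Filter.Tendsto φ.symm (𝓝 (chartAt E' z₀ z₀, 0))
      (𝓝 (φ.symm (chartAt E' z₀ z₀, 0))) := φ.continuousAt_symm het
    rwa [hφs] at h1
  -- invertibility of the differential persists near `e₀`
  have hinv : ∀ᶠ e in 𝓝 e₀, ∃ L' : E ≃L[ℝ] E' × ℝ, (L' : E →L[ℝ] E' × ℝ) = fderiv ℝ f e := by
    have h1 : ContinuousAt (fderiv ℝ f) e₀ :=
      (hf₀.fderiv_right (m := 0) (by simp)).continuousAt
    have h2 : Set.range ((↑) : (E ≃L[ℝ] E' × ℝ) → E →L[ℝ] E' × ℝ) ∈ 𝓝 (fderiv ℝ f e₀) := by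
      rw [← hL]
      exact ContinuousLinearEquiv.nhds L
    exact h1.eventually h2
  have hφt : ∀ᶠ p in 𝓝 (chartAt E' z₀ z₀, (0 : ℝ)), p ∈ φ.target := φ.open_target.mem_nhds het
  refine ⟨fun p => c.symm (φ.symm p), ?_, ?_, ?_, ?_⟩
  · filter_upwards [hφt, htend.eventually hinv, htend.eventually hf,
      htend.eventually (c.open_target.mem_nhds (mem_chart_target E (i z₀)))] with p h1 h2 h3 h4
    obtain ⟨L', hL'⟩ := h2
    have h5 : ContDiffAt ℝ ∞ φ.symm p := by
      refine φ.contDiffAt_symm (f₀' := L') h1 ?_ h3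
      rw [hL']
      exact (h3.differentiableAt (by simp)).hasFDerivAt
    exact (contMDiffAt_chart_symm (x := i z₀) h4).comp p h5.contMDiffAt
  · have h1 : Filter.Tendsto c (𝓝 (i z₀)) (𝓝 e₀) := c.continuousAt hcs
    filter_upwards [c.open_source.mem_nhds hcs, h1.eventually (φ.open_source.mem_nhds hes)]
      with x h2 h3
    have h4 : tubeMap E' r y z₀ x = φ (c x) := by
      rw [hφ]
      simp only [f, Function.comp_apply]
      rw [c.left_inv h2]
    rw [h4, φ.left_inv h3, c.left_inv h2]
  · filter_upwards [hφt] with p h1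
    exact φ.right_inv h1
  · rw [hφs, hce]

end IsTube

namespace IsTubeChart

variable [IsManifold 𝓘(ℝ, E) ∞ M] [IsManifold 𝓘(ℝ, E') ∞ Z]
variable {i : Z → M} {r : M → Z} {y : M → ℝ} {z₀ : Z} {G : E' × ℝ → M}

theorem tendsto (C : IsTubeChart E E' i r y z₀ G) :
    Filter.Tendsto G (𝓝 (chartAt E' z₀ z₀, 0)) (𝓝 (i z₀)) := by
  have h := C.smooth.self_of_nhds.continuousAt
  unfold ContinuousAt at h
  rwa [C.base] at h

theorem y_eq (C : IsTubeChart E E' i r y z₀ G) :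
    ∀ᶠ p in 𝓝 (chartAt E' z₀ z₀, (0 : ℝ)), y (G p) = p.2 := by
  filter_upwards [C.right_inv] with p hp using congrArg Prod.snd hp

theorem r_eq (C : IsTubeChart E E' i r y z₀ G) (T : IsTube E E' i r y) :
    ∀ᶠ p in 𝓝 (chartAt E' z₀ z₀, (0 : ℝ)), r (G p) = (chartAt E' z₀).symm p.1 := by
  filter_upwards [C.right_inv, C.tendsto.eventually (T.eventually_r_mem z₀)] with p h1 h2
  rw [← congrArg Prod.fst h1]
  exact ((chartAt E' z₀).left_inv h2).symm

theorem mem_range_iff (C : IsTubeChart E E' i r y z₀ G) (T : IsTube E E' i r y) :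
    ∀ᶠ p in 𝓝 (chartAt E' z₀ z₀, (0 : ℝ)), G p ∈ Set.range i ↔ p.2 = 0 := by
  filter_upwards [C.y_eq, C.tendsto.eventually (T.zero_iff z₀)] with p h1 h2
  rw [← h2, h1]

theorem slice_eq (C : IsTubeChart E E' i r y z₀ G) (T : IsTube E E' i r y) :
    ∀ᶠ u in 𝓝 (chartAt E' z₀ z₀), G (u, 0) = i ((chartAt E' z₀).symm u) := by
  have h1 : Filter.Tendsto (fun u => i ((chartAt E' z₀).symm u)) (𝓝 (chartAt E' z₀ z₀))
      (𝓝 (i z₀)) :=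
    (T.smooth_incl z₀).continuousAt.tendsto.comp (tendsto_chartAt_symm z₀)
  filter_upwards [h1.eventually C.left_inv,
    (chartAt E' z₀).open_target.mem_nhds (mem_chart_target E' z₀)] with u h2 h3
  rw [T.tubeMap_incl, (chartAt E' z₀).right_inv h3] at h2
  exact h2

theorem tendsto_line (z₀ : Z) : Filter.Tendsto (fun t : ℝ => (chartAt E' z₀ z₀, t)) (𝓝 0)
    (𝓝 (chartAt E' z₀ z₀, 0)) :=
  (Continuous.prodMk_right _).tendsto' _ _ rfl

theorem tendsto_slice (z₀ : Z) : Filter.Tendsto (fun u : E' => (u, (0 : ℝ)))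
    (𝓝 (chartAt E' z₀ z₀)) (𝓝 (chartAt E' z₀ z₀, 0)) :=
  (Continuous.prodMk_left _).tendsto' _ _ rfl

/-- A form is recovered from its expression in the coordinates. -/
theorem pullback_pullback (C : IsTubeChart E E' i r y z₀ G) (T : IsTube E E' i r y) {p : ℕ} :
    ∀ᶠ x in 𝓝 (i z₀), ∀ w : Form E M p,
      pullback (E' := E) (tubeMap E' r y z₀) (pullback (E' := E' × ℝ) G w) x = w x := by
  filter_upwards [T.smooth_tubeMap z₀, (T.tendsto_tubeMap z₀).eventually C.smooth,
    C.left_inv.eventually_nhds] with x h1 h2 h3 w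
  rw [← pullback_comp w (h2.mdifferentiableAt (by simp)) (h1.mdifferentiableAt (by simp))]
  exact (pullback_congr_map (g' := id) h3).trans (pullback_id w x)

theorem contDiffAt_pullback [FiniteDimensional ℝ E] [FiniteDimensional ℝ E']
    (C : IsTubeChart E E' i r y z₀ G) {p : ℕ} {w : Form E M p}
    (hw : ∀ᶠ x in 𝓝 (i z₀), SmoothFormAt w x) :
    ∀ᶠ p in 𝓝 (chartAt E' z₀ z₀, (0 : ℝ)), ContDiffAt ℝ ∞ (pullback (E' := E' × ℝ) G w) p := by
  filter_upwards [C.smooth, C.tendsto.eventually hw] with p h1 h2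
  exact BkGeometry.contDiffAt_pullback h1 h2

end IsTubeChart

theorem inChart_self {F : Type*} [NormedAddCommGroup F] [NormedSpace ℝ F] {p : ℕ}
    (w : F → F [⋀^Fin p]→L[ℝ] ℝ) (x : F) : inChart (M := F) w x = w := by
  funext e
  unfold inChart
  have h : mfderiv 𝓘(ℝ, F) 𝓘(ℝ, F) (chartAt F x).symm e = ContinuousLinearMap.id ℝ F := by
    rw [chartAt_self_eq]
    exact mfderiv_id
  rw [h]
  exact compCLM_id _

theorem smoothFormAt_self {F : Type*} [NormedAddCommGroup F] [NormedSpace ℝ F] {p : ℕ}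
    (w : F → F [⋀^Fin p]→L[ℝ] ℝ) (x : F) : SmoothFormAt (M := F) w x ↔ ContDiffAt ℝ ∞ w x := by
  change ContDiffAt ℝ ∞ (inChart (M := F) w x) _ ↔ _
  rw [inChart_self]
  rfl

/-- A form whose expression in the coordinates is smooth is smooth. -/
theorem IsTube.smoothFormAt_pullback [IsManifold 𝓘(ℝ, E) ∞ M] [IsManifold 𝓘(ℝ, E') ∞ Z]
    [FiniteDimensional ℝ E] [FiniteDimensional ℝ E']
    {i : Z → M} {r : M → Z} {y : M → ℝ} {z₀ : Z} (T : IsTube E E' i r y) {p : ℕ}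
    {w : E' × ℝ → (E' × ℝ) [⋀^Fin p]→L[ℝ] ℝ}
    (hw : ∀ᶠ p in 𝓝 (chartAt E' z₀ z₀, (0 : ℝ)), ContDiffAt ℝ ∞ w p) :
    ∀ᶠ x in 𝓝 (i z₀), SmoothFormAt (pullback (E' := E) (tubeMap E' r y z₀)
      (show Form (E' × ℝ) (E' × ℝ) p from w)) x := by
  filter_upwards [T.smooth_tubeMap z₀, (T.tendsto_tubeMap z₀).eventually hw] with x h1 h2
  exact SmoothFormAt.pullback h1 ((smoothFormAt_self _ _).2 h2)

end Tube

/-! ### Extension and division along a hypersurface -/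

section Division

variable {E : Type*} [NormedAddCommGroup E] [NormedSpace ℝ E]
variable {M : Type*} [TopologicalSpace M] [ChartedSpace E M] [IsManifold 𝓘(ℝ, E) ∞ M]
variable {E' : Type*} [NormedAddCommGroup E'] [NormedSpace ℝ E']
variable {Z : Type*} [TopologicalSpace Z] [ChartedSpace E' Z] [IsManifold 𝓘(ℝ, E') ∞ Z]
variable {i : Z → M} {r : M → Z} {y : M → ℝ}

theorem eventually_nhdsSet_range {P : M → Prop} :
    (∀ᶠ x in 𝓝ˢ (Set.range i), P x) ↔ ∀ z, ∀ᶠ x in 𝓝 (i z), P x := by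
  rw [eventually_nhdsSet_iff_forall, Set.forall_mem_range]

/-- A form is determined at a point by its expression in the chart. -/
theorem eq_of_inChart_eq {p : ℕ} {w η : Form E M p} {x : M}
    (h : inChart w x (chartAt E x x) = inChart η x (chartAt E x x)) : w x = η x := by
  have h1 : ∀ w : Form E M p, ContinuousAlternatingMap.compContinuousLinearMap
      (inChart w x (chartAt E x x)) (mfderiv 𝓘(ℝ, E) 𝓘(ℝ, E) (chartAt E x) x : E →L[ℝ] E)
      = w x := by
    intro w
    unfold inChart
    have h2 := mfderiv_chart_symm_comp (E := E) (mem_chart_source E x)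
    refine (compCLM_comp (V := E) (W := E) (X := E) _ _ _).trans ?_
    refine (congrArg (fun f : E →L[ℝ] E => ContinuousAlternatingMap.compContinuousLinearMap
      (w ((chartAt E x).symm (chartAt E x x))) f) h2).trans ?_
    rw [(chartAt E x).left_inv (mem_chart_source E x)]
    exact compCLM_id _
  rw [← h1 w, ← h1 η, h]

/-- Smooth forms which agree at points arbitrarily close to `x` agree at `x`, by continuity. -/
theorem SmoothFormAt.eq_of_frequently {p : ℕ} {w η : Form E M p} {x : M} (hw : SmoothFormAt w x)
    (hη : SmoothFormAt η x) (h : ∃ᶠ x' in 𝓝 x, w x' = η x') : w x = η x := by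
  refine eq_of_inChart_eq ?_
  have h1 : ContinuousAt (fun e => inChart w x e - inChart η x e) (chartAt E x x) :=
    (ContDiffAt.continuousAt hw).sub (ContDiffAt.continuousAt hη)
  have h2 : ∃ᶠ e in 𝓝 (chartAt E x x), inChart w x e - inChart η x e = 0 := by
    have h3 : Filter.Tendsto (chartAt E x) (𝓝 x) (𝓝 (chartAt E x x)) :=
      (chartAt E x).continuousAt (mem_chart_source E x)
    refine h3.frequently ((h.and_eventually (eventually_chart_left_inv (E := E))).mono ?_)
    rintro x' ⟨h4, h5⟩
    unfold inChart
    rw [h5, h4, sub_self]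
  by_contra hne
  exact h2 (h1.eventually_ne (sub_ne_zero.2 hne))

variable [FiniteDimensional ℝ E] [FiniteDimensional ℝ E']

theorem IsTube.frequently_notMem (T : IsTube E E' i r y) (z : Z) :
    ∃ᶠ x in 𝓝 (i z), x ∉ Set.range i := by
  obtain ⟨G, C⟩ := T.exists_isTubeChart z
  have h1 : Filter.Tendsto (fun t : ℝ => G (chartAt E' z z, t)) (𝓝 0) (𝓝 (i z)) :=
    C.tendsto.comp (IsTubeChart.tendsto_line z)
  refine h1.frequently ?_
  have h2 : ∃ᶠ t : ℝ in 𝓝 0, t ≠ 0 := by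
    have h3 : ∀ᶠ t in 𝓝[≠] (0 : ℝ), t ≠ 0 := eventually_mem_nhdsWithin
    exact h3.frequently.filter_mono nhdsWithin_le_nhds
  refine (h2.and_eventually
    ((IsTubeChart.tendsto_line z).eventually (C.mem_range_iff T))).mono ?_
  rintro t ⟨h3, h4⟩ h5
  exact h3 (h4.1 h5)

/-- A form given off `Z`, which extends smoothly over `Z` locally, does so near `Z`: local
extensions agree on `Z` by continuity. -/
theorem IsTube.exists_extension (T : IsTube E E' i r y) {p : ℕ} (w : Form E M p)
    (h : ∀ z, ∃ s : Form E M p, (∀ᶠ x in 𝓝 (i z), SmoothFormAt s x) ∧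
      ∀ᶠ x in 𝓝 (i z), x ∉ Set.range i → s x = w x) :
    ∃ W : Form E M p, (∀ᶠ x in 𝓝ˢ (Set.range i), SmoothFormAt W x) ∧
      ∀ x ∉ Set.range i, W x = w x := by
  classical
  choose s hs hsw using h
  let W : Form E M p := fun x => if hx : x ∈ Set.range i then s hx.choose x else w x
  have hW : ∀ x ∉ Set.range i, W x = w x := fun x hx => dif_neg hx
  refine ⟨W, eventually_nhdsSet_range.2 fun z => ?_, hW⟩
  have key : ∀ᶠ x in 𝓝 (i z), W x = s z x := by
    filter_upwards [(hsw z).eventually_nhds, hs z] with x h1 h2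
    by_cases hx : x ∈ Set.range i
    · have h3 : W x = s hx.choose x := dif_pos hx
      rw [h3]
      have h4 := hs hx.choose
      have h5 := hsw hx.choose
      have h6 := T.frequently_notMem hx.choose
      rw [hx.choose_spec] at h4 h5 h6
      refine h4.self_of_nhds.eq_of_frequently h2 ((h6.and_eventually (h1.and h5)).mono ?_)
      rintro x' ⟨h7, h8, h9⟩
      rw [h8 h7, h9 h7]
    · rw [hW x hx, h1.self_of_nhds hx]
  filter_upwards [key.eventually_nhds, hs z] with x h1 h2 using h2.congr h1

theorem IsTube.eventually_zero_iff (T : IsTube E E' i r y) :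
    ∀ᶠ x in 𝓝ˢ (Set.range i), y x = 0 ↔ x ∈ Set.range i := eventually_nhdsSet_range.2 T.zero_iff

theorem IsTube.eventually_smooth (T : IsTube E E' i r y) :
    ∀ᶠ x in 𝓝ˢ (Set.range i), ContMDiffAt 𝓘(ℝ, E) 𝓘(ℝ, ℝ) ∞ y x :=
  eventually_nhdsSet_range.2 T.smooth_fun

theorem IsTube.eventually_smooth_retraction (T : IsTube E E' i r y) :
    ∀ᶠ x in 𝓝ˢ (Set.range i), ContMDiffAt 𝓘(ℝ, E) 𝓘(ℝ, E') ∞ r x :=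
  eventually_nhdsSet_range.2 fun z => (T.isRetraction z).1

/-- A form which vanishes at the points of `Z` is divisible by `y`. -/
theorem IsTube.exists_eq_smul (T : IsTube E E' i r y) {p : ℕ} {w : Form E M p}
    (hw : ∀ᶠ x in 𝓝ˢ (Set.range i), SmoothFormAt w x) (h0 : ∀ z, w (i z) = 0) :
    ∃ S : Form E M p, (∀ᶠ x in 𝓝ˢ (Set.range i), SmoothFormAt S x) ∧
      ∀ᶠ x in 𝓝ˢ (Set.range i), w x = y x • S x := by
  obtain ⟨S, hS, hSw⟩ := T.exists_extension (fun x => (y x)⁻¹ • w x) (fun z => by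
    obtain ⟨G, C⟩ := T.exists_isTubeChart z
    have h1 := C.contDiffAt_pullback (eventually_nhdsSet_range.1 hw z)
    have h2 : ∀ᶠ p in 𝓝 (chartAt E' z z, (0 : ℝ)), p.2 = 0 → pullback (E' := E' × ℝ) G w p = 0 := by
      filter_upwards [C.mem_range_iff T] with p hp hp0
      obtain ⟨z', hz'⟩ := hp.2 hp0
      unfold pullback
      rw [← hz', h0 z']
      rfl
    obtain ⟨g, hg, hgw⟩ := exists_eq_smul_near h1 h2
    refine ⟨_, T.smoothFormAt_pullback (w := g) (Filter.Eventually.of_forall fun p =>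
      hg.contDiffAt), ?_⟩
    filter_upwards [T.zero_iff z, C.pullback_pullback T (p := p),
      (T.tendsto_tubeMap z).eventually hgw]
      with x h3 h4 h5 h6
    have h7 : y x ≠ 0 := fun h => h6 (h3.1 h)
    rw [eq_inv_smul_iff₀ h7, ← h4 w]
    unfold pullback at h5 ⊢
    rw [h5]
    rfl)
  refine ⟨S, hS, ?_⟩
  filter_upwards [T.eventually_zero_iff] with x hx
  by_cases h : x ∈ Set.range i
  · obtain ⟨z, rfl⟩ := h
    rw [hx.2 ⟨z, rfl⟩, h0, zero_smul]
  · rw [hSw x h, smul_inv_smul₀ fun h' => h (hx.1 h')]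

end Division

/-! ### Expansions in powers of the defining function -/

section Expansion

variable {E : Type*} [NormedAddCommGroup E] [NormedSpace ℝ E]
variable {M : Type*} [TopologicalSpace M] [ChartedSpace E M] [IsManifold 𝓘(ℝ, E) ∞ M]
variable {E' : Type*} [NormedAddCommGroup E'] [NormedSpace ℝ E']
variable {Z : Type*} [TopologicalSpace Z] [ChartedSpace E' Z] [IsManifold 𝓘(ℝ, E') ∞ Z]
variable {i : Z → M} {r : M → Z} {y : M → ℝ}

/-- A relation between powers of `t`, with constant coefficients and modulo `t ^ N`, is trivial. -/
theorem coeff_eq_zero_of_sum_pow {G : Type*} [NormedAddCommGroup G] [NormedSpace ℝ G]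
    {s : ℝ → G} (hs : ContinuousAt s 0) : ∀ (N : ℕ) (X : ℕ → G),
    (∀ᶠ t : ℝ in 𝓝[≠] 0, ∑ l ∈ Finset.range N, t ^ l • X l = t ^ N • s t) →
    ∀ l < N, X l = 0 := by
  intro N
  induction N with
  | zero => intro X _ l hl; omega
  | succ N ih =>
    intro X h
    have h0 : X 0 = 0 := by
      have h1 : Filter.Tendsto (fun t : ℝ => t ^ (N + 1) • s t -
          ∑ l ∈ Finset.range N, t ^ (l + 1) • X (l + 1)) (𝓝[≠] 0) (𝓝 0) := by
        have h2 : ContinuousAt (fun t : ℝ => t ^ (N + 1) • s t -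
          ∑ l ∈ Finset.range N, t ^ (l + 1) • X (l + 1)) 0 := by fun_prop
        have h3 : Filter.Tendsto _ _ _ := h2
        simp only [ne_eq, Nat.add_eq_zero_iff, one_ne_zero, and_false, not_false_eq_true, zero_pow,
          zero_smul, Finset.sum_const_zero, sub_zero] at h3
        exact h3.mono_left nhdsWithin_le_nhds
      refine tendsto_nhds_unique (tendsto_const_nhds.congr' ?_) h1
      filter_upwards [h] with t ht
      rw [← ht, Finset.sum_range_succ', add_sub_cancel_left, pow_zero, one_smul]
    have h1 : ∀ l < N, X (l + 1) = 0 := by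
      refine ih (fun l => X (l + 1)) ?_
      filter_upwards [h, eventually_mem_nhdsWithin] with t ht ht0
      rw [Finset.sum_range_succ', h0, smul_zero, add_zero] at ht
      refine smul_right_injective G (show t ≠ 0 from ht0) ?_
      simp only [Finset.smul_sum, smul_smul, ← pow_succ']
      exact ht
    intro l hl
    rcases l with _ | l
    · exact h0
    · exact h1 l (by omega)

theorem pullback_fst {p : ℕ} (a : Form E' E' p) (x : E' × ℝ) :
    pullback (E' := E' × ℝ) (Prod.fst : E' × ℝ → E') a x =
      (a x.1).compContinuousLinearMap (ContinuousLinearMap.fst ℝ E' ℝ) := by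
  unfold pullback
  have h : (mfderiv 𝓘(ℝ, E' × ℝ) 𝓘(ℝ, E') (Prod.fst : E' × ℝ → E') x : E' × ℝ →L[ℝ] E') =
      ContinuousLinearMap.fst ℝ E' ℝ := mfderiv_eq_fderiv.trans fderiv_fst
  exact congrArg (fun g : E' × ℝ →L[ℝ] E' =>
    ContinuousAlternatingMap.compContinuousLinearMap (a x.1) g) h

namespace IsTubeChart

variable {z₀ : Z} {G : E' × ℝ → M}

/-- In the coordinates, the pullback of a form under the retraction does not depend on `t` or
involve `dt`. -/
theorem pullback_retraction (C : IsTubeChart E E' i r y z₀ G) (T : IsTube E E' i r y) {p : ℕ} :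
    ∀ᶠ x in 𝓝 (chartAt E' z₀ z₀, (0 : ℝ)), ∀ c : Form E' Z p,
      pullback (E' := E' × ℝ) G (pullback (E' := E) r c) x =
        (inChart c z₀ x.1).compContinuousLinearMap (ContinuousLinearMap.fst ℝ E' ℝ) := by
  have h0 : Filter.Tendsto (Prod.fst : E' × ℝ → E') (𝓝 (chartAt E' z₀ z₀, (0 : ℝ)))
      (𝓝 (chartAt E' z₀ z₀)) := continuous_fst.tendsto _
  filter_upwards [(C.r_eq T).eventually_nhds, C.smooth,
    C.tendsto.eventually (T.isRetraction z₀).1,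
    h0.eventually ((chartAt E' z₀).open_target.mem_nhds (mem_chart_target E' z₀))]
    with x h1 h2 h3 h4 c
  rw [← pullback_comp c (h3.mdifferentiableAt (by simp)) (h2.mdifferentiableAt (by simp)),
    pullback_congr_map (g := r ∘ G) (g' := (chartAt E' z₀).symm ∘ Prod.fst) h1,
    pullback_comp c ((contMDiffAt_chart_symm h4).mdifferentiableAt (by simp))
      (differentiableAt_fst.mdifferentiableAt)]
  exact pullback_fst _ x

theorem pullback_dWedge_fun (C : IsTubeChart E E' i r y z₀ G) (T : IsTube E E' i r y) {q : ℕ} :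
    ∀ᶠ x in 𝓝 (chartAt E' z₀ z₀, (0 : ℝ)), ∀ a : Form E M q,
      pullback (E' := E' × ℝ) G (dWedge y a) x =
        wedge (ContinuousLinearMap.snd ℝ E' ℝ) (pullback (E' := E' × ℝ) G a x) := by
  filter_upwards [C.y_eq.eventually_nhds, C.smooth, C.tendsto.eventually (T.smooth_fun z₀)]
    with x h1 h2 h3 a
  rw [pullback_dWedge a (h3.mdifferentiableAt (by simp)) (h2.mdifferentiableAt (by simp)),
    dWedge_eq]
  have h4 : y ∘ G =ᶠ[𝓝 x] Prod.snd := h1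
  have h5 : (mfderiv 𝓘(ℝ, E' × ℝ) 𝓘(ℝ, ℝ) (y ∘ G) x : E' × ℝ →L[ℝ] ℝ) =
      ContinuousLinearMap.snd ℝ E' ℝ := h4.mfderiv_eq.trans (mfderiv_eq_fderiv.trans fderiv_snd)
  exact congrArg (fun l => wedge l (pullback (E' := E' × ℝ) G a x)) h5

/-- Forms which agree in the coordinates are equal. -/
theorem eq_of_pullback_eq (C : IsTubeChart E E' i r y z₀ G) (T : IsTube E E' i r y) {p : ℕ} :
    ∀ᶠ x in 𝓝 (i z₀), ∀ w η : Form E M p, pullback (E' := E' × ℝ) G w (tubeMap E' r y z₀ x) =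
      pullback (E' := E' × ℝ) G η (tubeMap E' r y z₀ x) → w x = η x := by
  filter_upwards [C.pullback_pullback T (p := p)] with x h1 w η h
  rw [← h1 w, ← h1 η]
  exact pullback_congr h

end IsTubeChart

variable [FiniteDimensional ℝ E] [FiniteDimensional ℝ E']

/-- The terms `dy ∧ r^* c` of an expansion in powers of `y` are unique: on a line `t ↦ G (u, t)`, the
expansion is a polynomial in `t` with constant coefficients. -/
theorem IsTube.coeff_eq_zero (T : IsTube E E' i r y) {q N : ℕ} (b : ℕ → Form E' Z (q + 1))
    (c : ℕ → Form E' Z q) {S : Form E M (q + 1)}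
    (hS : ∀ᶠ x in 𝓝ˢ (Set.range i), SmoothFormAt S x)
    (h : ∀ᶠ x in 𝓝ˢ (Set.range i), x ∉ Set.range i →
      ∑ l ∈ Finset.range N, y x ^ l • (pullback (E' := E) r (b l) x +
        dWedge y (pullback (E' := E) r (c l)) x) = y x ^ N • S x) :
    ∀ l < N, c l = 0 := by
  intro l hl
  funext z
  obtain ⟨G, C⟩ := T.exists_isTubeChart z
  let X : ℕ → (E' × ℝ) [⋀^Fin (q + 1)]→L[ℝ] ℝ := fun l =>
    (inChart (b l) z (chartAt E' z z)).compContinuousLinearMap (ContinuousLinearMap.fst ℝ E' ℝ) +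
      wedge (ContinuousLinearMap.snd ℝ E' ℝ) ((inChart (c l) z
        (chartAt E' z z)).compContinuousLinearMap (ContinuousLinearMap.fst ℝ E' ℝ))
  have hs : ContinuousAt (fun t : ℝ => pullback (E' := E' × ℝ) G S (chartAt E' z z, t)) 0 :=
    ContinuousAt.comp (g := pullback (E' := E' × ℝ) G S)
      ((C.contDiffAt_pullback (eventually_nhdsSet_range.1 hS z)).self_of_nhds.continuousAt)
      (Continuous.prodMk_right _).continuousAt
  have hX := coeff_eq_zero_of_sum_pow hs N X (by
    have hl := IsTubeChart.tendsto_line (E' := E') z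
    have hG := C.tendsto.comp hl
    filter_upwards [eventually_mem_nhdsWithin,
      (hl.mono_left nhdsWithin_le_nhds).eventually (C.pullback_retraction T (p := q + 1)),
      (hl.mono_left nhdsWithin_le_nhds).eventually (C.pullback_retraction T (p := q)),
      (hl.mono_left nhdsWithin_le_nhds).eventually (C.pullback_dWedge_fun T (q := q)),
      (hl.mono_left nhdsWithin_le_nhds).eventually C.y_eq,
      (hl.mono_left nhdsWithin_le_nhds).eventually (C.mem_range_iff T),
      (hG.mono_left nhdsWithin_le_nhds).eventually (eventually_nhdsSet_range.1 h z)]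
      with t h0 h1 h2 h3 h4 h5 h6
    have h7 := h6 fun hm => h0 (h5.1 hm)
    have h8 := congrArg (fun a : E [⋀^Fin (q + 1)]→L[ℝ] ℝ => a.compContinuousLinearMap
      (mfderiv 𝓘(ℝ, E' × ℝ) 𝓘(ℝ, E) G (chartAt E' z z, t) : E' × ℝ →L[ℝ] E)) h7
    have h9 := (sum_compCLM (V := E) (W := E' × ℝ) _ _ _).symm.trans h8
    simp only [Function.comp_apply, h4] at h9
    refine Eq.trans (Finset.sum_congr rfl fun l _ => ?_) h9
    have h10 : X l = pullback (E' := E' × ℝ) G (pullback (E' := E) r (b l)) (chartAt E' z z, t) +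
        pullback (E' := E' × ℝ) G (dWedge y (pullback (E' := E) r (c l))) (chartAt E' z z, t) := by
      rw [h1, h3, h2]
    exact congrArg (fun a : (E' × ℝ) [⋀^Fin (q + 1)]→L[ℝ] ℝ => t ^ l • a) h10)
  have h1 := congrArg (fun a => (a.curryLeft (0, 1)).compContinuousLinearMap
    (ContinuousLinearMap.inl ℝ E' ℝ)) (hX l hl)
  have h2 : inChart (c l) z (chartAt E' z z) = 0 := by
    have h3 : (((inChart (b l) z (chartAt E' z z)).compContinuousLinearMap
        (ContinuousLinearMap.fst ℝ E' ℝ)).curryLeft) (0, 1) = 0 := by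
      rw [ContinuousAlternatingMap.curryLeft_compContinuousLinearMap]
      simp only [ContinuousLinearMap.coe_fst', map_zero]
      rfl
    simp only [X] at h1
    rw [ContinuousAlternatingMap.curryLeft_add, _root_.add_apply, curryLeft_wedge_snd, h3,
      zero_add] at h1
    exact h1
  exact eq_of_inChart_eq (η := 0) h2

end Expansion

/-! ### Existence of expansions -/

section Peel

variable {E : Type*} [NormedAddCommGroup E] [NormedSpace ℝ E]
variable {M : Type*} [TopologicalSpace M] [ChartedSpace E M] [IsManifold 𝓘(ℝ, E) ∞ M]
variable {E' : Type*} [NormedAddCommGroup E'] [NormedSpace ℝ E']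
variable {Z : Type*} [TopologicalSpace Z] [ChartedSpace E' Z] [IsManifold 𝓘(ℝ, E') ∞ Z]
variable {i : Z → M} {r : M → Z} {y : M → ℝ}
variable [FiniteDimensional ℝ E] [FiniteDimensional ℝ E']

/-- At the points of `Z`, the form `dy ∧ r^* c` determines `c`. -/
theorem IsTube.eq_of_dWedge_eq (T : IsTube E E' i r y) {q : ℕ} {c c' : Form E' Z q} {z : Z}
    (h : dWedge y (pullback (E' := E) r c) (i z) = dWedge y (pullback (E' := E) r c') (i z)) :
    c z = c' z := by
  obtain ⟨G, C⟩ := T.exists_isTubeChart z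
  refine eq_of_inChart_eq ?_
  have h1 : ∀ c : Form E' Z q, inChart c z (chartAt E' z z) =
      ((pullback (E' := E' × ℝ) G (dWedge y (pullback (E' := E) r c))
        (chartAt E' z z, 0)).curryLeft (0, 1)).compContinuousLinearMap
          (ContinuousLinearMap.inl ℝ E' ℝ) := by
    intro c
    rw [(C.pullback_dWedge_fun T).self_of_nhds, (C.pullback_retraction T).self_of_nhds,
      curryLeft_wedge_snd]
    rfl
  rw [h1, h1, pullback_congr (g := G) (w := dWedge y (pullback (E' := E) r c))
    (η := dWedge y (pullback (E' := E) r c')) (by rw [C.base]; exact h)]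

theorem smoothFormAt_chart_pullback {p : ℕ} {a : Form E' E' p} {z₀ : Z}
    (ha : ∀ᶠ u in 𝓝 (chartAt E' z₀ z₀), ContDiffAt ℝ ∞ a u) :
    ∀ᶠ z in 𝓝 z₀, SmoothFormAt (pullback (E' := E') (chartAt E' z₀) a) z := by
  have h : Filter.Tendsto (chartAt E' z₀) (𝓝 z₀) (𝓝 (chartAt E' z₀ z₀)) :=
    (chartAt E' z₀).continuousAt (mem_chart_source E' z₀)
  filter_upwards [h.eventually ha, (chartAt E' z₀).open_source.mem_nhds (mem_chart_source E' z₀)]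
    with z h1 h2
  exact SmoothFormAt.pullback (contMDiffAt_chart h2) ((smoothFormAt_self _ _).2 h1)

theorem inChart_chart_pullback {p : ℕ} (a : Form E' E' p) (z₀ : Z) :
    ∀ᶠ u in 𝓝 (chartAt E' z₀ z₀),
      inChart (pullback (E' := E') (chartAt E' z₀) a) z₀ u = a u := by
  filter_upwards [((chartAt E' z₀).open_target.mem_nhds
    (mem_chart_target E' z₀) : ∀ᶠ u in _, u ∈ (chartAt E' z₀).target),
    ((chartAt E' z₀).open_target.eventually_mem (mem_chart_target E' z₀)).eventually_nhds]
    with u h1 h2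
  have h3 : (chartAt E' z₀) ∘ (chartAt E' z₀).symm =ᶠ[𝓝 u] id := by
    filter_upwards [h2] with u' hu'
    exact (chartAt E' z₀).right_inv hu'
  have h4 := pullback_comp a (f := chartAt E' z₀) (g := (chartAt E' z₀).symm) (x := u)
    ((contMDiffAt_chart ((chartAt E' z₀).map_target h1)).mdifferentiableAt (by simp))
    ((contMDiffAt_chart_symm h1).mdifferentiableAt (by simp))
  exact h4.symm.trans ((pullback_congr_map (g' := id) h3).trans (pullback_id a u))

theorem mfderiv_prodMk_zero (u : E') :
    (mfderiv 𝓘(ℝ, E') 𝓘(ℝ, E' × ℝ) (fun u : E' => (u, (0 : ℝ))) u : E' →L[ℝ] E' × ℝ) =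
      ContinuousLinearMap.inl ℝ E' ℝ :=
  mfderiv_eq_fderiv.trans (ContinuousLinearMap.inl ℝ E' ℝ).fderiv

/-- In the coordinates, the restriction of a form to `Z` is its restriction to `t = 0`. -/
theorem IsTubeChart.inChart_pullback_incl {z₀ : Z} {G : E' × ℝ → M}
    (C : IsTubeChart E E' i r y z₀ G) (T : IsTube E E' i r y) {p : ℕ} (w : Form E M p) :
    ∀ᶠ u in 𝓝 (chartAt E' z₀ z₀), inChart (pullback (E' := E') i w) z₀ u =
      (pullback (E' := E' × ℝ) G w (u, 0)).compContinuousLinearMap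
        (ContinuousLinearMap.inl ℝ E' ℝ) := by
  filter_upwards [inChart_pullback w (T.smooth_incl z₀), (C.slice_eq T).eventually_nhds,
    (IsTubeChart.tendsto_slice z₀).eventually C.smooth] with u h1 h2 h3
  have h4 : i ∘ (chartAt E' z₀).symm =ᶠ[𝓝 u] G ∘ fun u => (u, (0 : ℝ)) := by
    filter_upwards [h2] with u' hu' using hu'.symm
  have h5 : DifferentiableAt ℝ (fun u : E' => (u, (0 : ℝ))) u := by fun_prop
  rw [h1, pullback_congr_map (g := i ∘ (chartAt E' z₀).symm) (g' := G ∘ fun u => (u, (0 : ℝ))) h4,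
    pullback_comp w (g := fun u : E' => (u, (0 : ℝ))) (x := u)
      (h3.mdifferentiableAt (by simp)) h5.mdifferentiableAt]
  exact congrArg (fun g : E' →L[ℝ] E' × ℝ => ContinuousAlternatingMap.compContinuousLinearMap
    (pullback (E' := E' × ℝ) G w (u, 0)) g) (mfderiv_prodMk_zero u)

/-- Along `Z`, locally, a smooth form is `r^* (i^* Θ) + dy ∧ r^* c`. -/
theorem IsTube.exists_local_vertical (T : IsTube E E' i r y) {q : ℕ} {Θ : Form E M (q + 1)}
    (hΘ : ∀ᶠ x in 𝓝ˢ (Set.range i), SmoothFormAt Θ x) (z₀ : Z) :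
    ∃ c : Form E' Z q, (∀ᶠ z in 𝓝 z₀, SmoothFormAt c z) ∧ ∀ᶠ z in 𝓝 z₀,
      Θ (i z) = pullback (E' := E) r (pullback (E' := E') i Θ) (i z) +
        dWedge y (pullback (E' := E) r c) (i z) := by
  obtain ⟨G, C⟩ := T.exists_isTubeChart z₀
  let a : Form E' E' q := fun u =>
    ((pullback (E' := E' × ℝ) G Θ (u, 0)).curryLeft (0, 1)).compContinuousLinearMap
      (ContinuousLinearMap.inl ℝ E' ℝ)
  have hs := IsTubeChart.tendsto_slice (E' := E') z₀
  refine ⟨pullback (E' := E') (chartAt E' z₀) a, smoothFormAt_chart_pullback ?_, ?_⟩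
  · filter_upwards [hs.eventually (C.contDiffAt_pullback (eventually_nhdsSet_range.1 hΘ z₀))]
      with u hu
    rw [contDiffAt_alternating_iff]
    intro v
    have h1 : ContDiffAt ℝ ∞ (fun u : E' => pullback (E' := E' × ℝ) G Θ (u, (0 : ℝ))) u :=
      hu.comp u (contDiffAt_id.prodMk contDiffAt_const)
    exact contDiffAt_alternating_iff.1 h1
      (Matrix.vecCons (0, 1) fun j => ContinuousLinearMap.inl ℝ E' ℝ (v j))
  · have hi : Filter.Tendsto i (𝓝 z₀) (𝓝 (i z₀)) := (T.smooth_incl z₀).continuousAt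
    have hc : Filter.Tendsto (chartAt E' z₀) (𝓝 z₀) (𝓝 (chartAt E' z₀ z₀)) :=
      (chartAt E' z₀).continuousAt (mem_chart_source E' z₀)
    filter_upwards [hi.eventually (C.eq_of_pullback_eq T (p := q + 1)),
      hc.eventually (C.inChart_pullback_incl T Θ), hc.eventually (inChart_chart_pullback a z₀),
      (hs.comp hc).eventually (C.pullback_retraction T (p := q + 1)),
      (hs.comp hc).eventually (C.pullback_retraction T (p := q)),
      (hs.comp hc).eventually (C.pullback_dWedge_fun T (q := q))] with z h1 h2 h3 h4 h5 h6
    refine h1 Θ (pullback (E' := E) r (pullback (E' := E') i Θ) +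
      dWedge y (pullback (E' := E) r (pullback (E' := E') (chartAt E' z₀) a))) ?_
    rw [T.tubeMap_incl, pullback_add, add_apply]
    simp only [Function.comp_apply] at h4 h5 h6
    rw [h6, h5, h4, h2, h3]
    exact alternating_prod_decomp _

/-- `κ = dy ∧ r^* c` for a smooth form `c` on `Z`, and `e = dc`. In degree zero the only vertical form
is `κ = 0`. This notion lets the arguments treat all degrees alike, although the degree of `c` is one
less than that of `κ`. -/
def IsVertical (r : M → Z) (y : M → ℝ) : (p : ℕ) → Form E M p → Form E' Z p → Prop
  | 0, κ, e => κ = 0 ∧ e = 0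
  | _ + 1, κ, e => ∃ c : Form E' Z _, (∀ z, SmoothFormAt c z) ∧
      κ = dWedge y (pullback (E' := E) r c) ∧ e = extD c

/-- A smooth form is `r^* (i^* Θ)` plus a vertical form along `Z`. -/
theorem IsTube.exists_vertical (T : IsTube E E' i r y) {p : ℕ} {Θ : Form E M p}
    (hΘ : ∀ᶠ x in 𝓝ˢ (Set.range i), SmoothFormAt Θ x) :
    ∃ (κ : Form E M p) (e : Form E' Z p), IsVertical r y p κ e ∧
      ∀ z, Θ (i z) = pullback (E' := E) r (pullback (E' := E') i Θ) (i z) + κ (i z) := by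
  rcases p with _ | q
  · refine ⟨0, 0, ⟨rfl, rfl⟩, fun z => ?_⟩
    change _ = pullback (E' := E) r (pullback (E' := E') i Θ) (i z) + 0
    rw [add_zero]
    refine ContinuousAlternatingMap.ext fun v => ?_
    change Θ (i z) v = Θ (i (r (i z))) _
    rw [T.r_incl]
    exact congrArg _ (Subsingleton.elim _ _)
  · choose c hc hc' using T.exists_local_vertical hΘ
    let c₀ : Form E' Z q := fun z => c z z
    have key : ∀ z₀, ∀ᶠ z in 𝓝 z₀, c₀ z = c z₀ z := by
      intro z₀
      filter_upwards [hc' z₀] with z hz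
      exact T.eq_of_dWedge_eq (c := c z) (add_left_cancel ((hc' z).self_of_nhds.symm.trans hz))
    have h1 : ∀ z, pullback (E' := E) r c₀ (i z) = pullback (E' := E) r (c z) (i z) := fun z =>
      pullback_congr (by rw [T.r_incl])
    refine ⟨_, _, ⟨c₀, fun z => (hc z).self_of_nhds.congr (key z), rfl, rfl⟩, fun z => ?_⟩
    rw [dWedge_eq, h1, ← dWedge_eq]
    exact (hc' z).self_of_nhds

namespace IsVertical

theorem smoothFormAt (T : IsTube E E' i r y) : ∀ {p : ℕ} {κ : Form E M p} {e : Form E' Z p},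
    IsVertical r y p κ e → ∀ᶠ x in 𝓝ˢ (Set.range i), SmoothFormAt κ x
  | 0, κ, e, h => by
    rw [h.1]
    exact Filter.Eventually.of_forall smoothFormAt_zero
  | p + 1, κ, e, ⟨c, hc, hκ, _⟩ => by
    filter_upwards [T.eventually_smooth, T.eventually_smooth_retraction] with x h1 h2
    rw [hκ]
    exact SmoothFormAt.dWedge h1 (SmoothFormAt.pullback h2 (hc _))

theorem extD_eq (T : IsTube E E' i r y) : ∀ {p : ℕ} {κ : Form E M p} {e : Form E' Z p},
    IsVertical r y p κ e →
      ∀ᶠ x in 𝓝ˢ (Set.range i), extD κ x = -dWedge y (pullback (E' := E) r e) x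
  | 0, κ, e, h => by
    rw [h.1, h.2]
    refine Filter.Eventually.of_forall fun x => (extD_zero x).trans ?_
    rw [dWedge_eq]
    exact (neg_eq_zero.2 (wedge_zero _)).symm
  | p + 1, κ, e, ⟨c, hc, hκ, he⟩ => by
    filter_upwards [T.eventually_smooth.eventually_nhdsSet,
      T.eventually_smooth_retraction.eventually_nhdsSet] with x h1 h2
    rw [hκ, he, extD_dWedge h1 (h2.mono fun x' h => SmoothFormAt.pullback h (hc _)), dWedge_eq,
      dWedge_eq, extD_pullback h2.self_of_nhds (hc _)]

theorem dWedge_eq_zero : ∀ {p : ℕ} {κ : Form E M p} {e : Form E' Z p},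
    IsVertical r y p κ e → ∀ x, dWedge y κ x = 0
  | 0, κ, e, h, x => by
    rw [h.1, dWedge_eq]
    exact wedge_zero _
  | p + 1, κ, e, ⟨c, hc, hκ, _⟩, x => by
    rw [hκ, dWedge_eq, dWedge_eq]
    exact wedge_wedge_self _ _

theorem mem_exactForms : ∀ {p : ℕ} {κ : Form E M p} {e : Form E' Z p},
    IsVertical r y p κ e → e ∈ exactForms E' Z p
  | 0, κ, e, h => h.2
  | p + 1, κ, e, ⟨c, hc, _, he⟩ =>
    ⟨c, smoothFormOn_of_smoothFormAt fun z _ => hc z, fun z => by rw [he]⟩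

theorem smoothFormAt_right : ∀ {p : ℕ} {κ : Form E M p} {e : Form E' Z p},
    IsVertical r y p κ e → ∀ z, SmoothFormAt e z
  | 0, κ, e, h, z => by
    rw [h.2]
    exact smoothFormAt_zero z
  | p + 1, κ, e, ⟨c, hc, _, he⟩, z => by
    rw [he]
    exact SmoothFormAt.extD (Filter.Eventually.of_forall hc)

theorem extD_right : ∀ {p : ℕ} {κ : Form E M p} {e : Form E' Z p},
    IsVertical r y p κ e → ∀ z, extD e z = 0
  | 0, κ, e, h, z => by
    rw [h.2]
    exact extD_zero z
  | p + 1, κ, e, ⟨c, hc, _, he⟩, z => by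
    rw [he]
    exact extD_extD (Filter.Eventually.of_forall hc)

end IsVertical

/-- The expansion of a smooth form near `Z` in powers of `y`, to the order `N`: subtract the value
along `Z`, divide by `y`, and repeat. -/
theorem IsTube.exists_expansion (T : IsTube E E' i r y) {p : ℕ} (N : ℕ) : ∀ {Θ : Form E M p},
    (∀ᶠ x in 𝓝ˢ (Set.range i), SmoothFormAt Θ x) →
    ∃ (b : ℕ → Form E' Z p) (κ : ℕ → Form E M p) (e : ℕ → Form E' Z p) (S : Form E M p),
      (∀ l z, SmoothFormAt (b l) z) ∧ (∀ l, IsVertical r y p (κ l) (e l)) ∧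
      (∀ᶠ x in 𝓝ˢ (Set.range i), SmoothFormAt S x) ∧
      b 0 = pullback (E' := E') i Θ ∧
      ∀ᶠ x in 𝓝ˢ (Set.range i), Θ x =
        ∑ l ∈ Finset.range N, y x ^ l • (pullback (E' := E) r (b l) x + κ l x) + y x ^ N • S x := by
  have hb : ∀ {Θ : Form E M p}, (∀ᶠ x in 𝓝ˢ (Set.range i), SmoothFormAt Θ x) →
      ∀ z, SmoothFormAt (BkGeometry.pullback (E' := E') i Θ) z := fun hΘ z =>
    SmoothFormAt.pullback (T.smooth_incl z) (eventually_nhdsSet_range.1 hΘ z).self_of_nhds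
  induction N with
  | zero =>
    intro Θ hΘ
    obtain ⟨κ, e, hκ, -⟩ := T.exists_vertical hΘ
    refine ⟨fun _ => BkGeometry.pullback (E' := E') i Θ, fun _ => κ, fun _ => e, Θ,
      fun _ => hb hΘ, fun _ => hκ, hΘ, rfl, Filter.Eventually.of_forall fun x => ?_⟩
    rw [Finset.sum_range_zero, zero_add, pow_zero, one_smul]
  | succ N ih =>
    intro Θ hΘ
    obtain ⟨κ, e, hκ, hΘκ⟩ := T.exists_vertical hΘ
    have hrest : ∀ᶠ x in 𝓝ˢ (Set.range i), SmoothFormAt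
        (Θ - (BkGeometry.pullback (E' := E) r (BkGeometry.pullback (E' := E') i Θ) + κ)) x := by
      filter_upwards [hΘ, hκ.smoothFormAt T, T.eventually_smooth_retraction] with x h1 h2 h3
      exact h1.sub ((SmoothFormAt.pullback h3 (hb hΘ _)).add h2)
    obtain ⟨S₀, hS₀, hS₀'⟩ := T.exists_eq_smul hrest fun z => sub_eq_zero.2 (hΘκ z)
    obtain ⟨b, κ', e', S, h1, h2, h3, -, h5⟩ := ih hS₀
    refine ⟨fun l => l.casesOn (BkGeometry.pullback (E' := E') i Θ) b, fun l => l.casesOn κ κ',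
      fun l => l.casesOn e e', S, ?_, ?_, h3, rfl, ?_⟩
    · rintro (_ | l)
      · exact hb hΘ
      · exact h1 l
    · rintro (_ | l)
      · exact hκ
      · exact h2 l
    · filter_upwards [hS₀', h5] with x h6 h7
      have h8 : Θ x = (BkGeometry.pullback (E' := E) r (BkGeometry.pullback (E' := E') i Θ) x
          + κ x) + y x • S₀ x := by
        rw [← h6]
        exact (add_sub_cancel _ _).symm
      rw [h8, h7, Finset.sum_range_succ', pow_zero, one_smul, smul_add, Finset.smul_sum]
      simp only [smul_smul, ← pow_succ']
      have h9 : ∀ a s t : E [⋀^Fin p]→L[ℝ] ℝ, a + (s + t) = s + a + t := fun a s t => by abel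
      exact h9 _ _ _

end Peel

/-! ### Closed forms near the hypersurface -/

section Closed

variable {E : Type*} [NormedAddCommGroup E] [NormedSpace ℝ E]
variable {M : Type*} [TopologicalSpace M] [ChartedSpace E M] [IsManifold 𝓘(ℝ, E) ∞ M]
variable {E' : Type*} [NormedAddCommGroup E'] [NormedSpace ℝ E']
variable {Z : Type*} [TopologicalSpace Z] [ChartedSpace E' Z] [IsManifold 𝓘(ℝ, E') ∞ Z]
variable {i : Z → M} {r : M → Z} {y : M → ℝ}

theorem dWedge_add {q : ℕ} (f : M → ℝ) (a b : Form E M q) (x : M) :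
    dWedge f (a + b) x = dWedge f a x + dWedge f b x := wedge_add _ _ _

theorem dWedge_smul {q : ℕ} (f : M → ℝ) (c : ℝ) (a : Form E M q) (x : M) :
    dWedge f (c • a) x = c • dWedge f a x := wedge_smul _ _ _

theorem dWedge_fsmul {q : ℕ} (f g : M → ℝ) (a : Form E M q) (x : M) :
    dWedge f (fsmul g a) x = g x • dWedge f a x := wedge_smul _ _ _

theorem dWedge_sub {q : ℕ} (f : M → ℝ) (a b : Form E M q) (x : M) :
    dWedge f (a - b) x = dWedge f a x - dWedge f b x := by
  rw [sub_eq_add_neg, sub_eq_add_neg, dWedge_add]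
  exact congrArg _ (wedge_neg _ _)

theorem dWedge_sum {q : ℕ} {ι : Type*} (s : Finset ι) (f : M → ℝ) (a : ι → Form E M q) (x : M) :
    dWedge f (∑ j ∈ s, a j) x = ∑ j ∈ s, dWedge f (a j) x := by
  rw [dWedge_eq, sum_apply]
  exact wedge_sum s _ (fun j => (a j x : E [⋀^Fin q]→L[ℝ] ℝ))

theorem dWedge_congr {q : ℕ} {f : M → ℝ} {a b : Form E M q} {x : M} (h : a x = b x) :
    dWedge f a x = dWedge f b x := by
  rw [dWedge_eq, h, ← dWedge_eq]

theorem dWedge_comp {q : ℕ} {φ : ℝ → ℝ} {φ' : ℝ} {f : M → ℝ} (a : Form E M q) {x : M}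
    (hφ : HasDerivAt φ φ' (f x)) (hf : MDifferentiableAt 𝓘(ℝ, E) 𝓘(ℝ, ℝ) f x) :
    dWedge (φ ∘ f) a x = φ' • dWedge f a x := by
  have h : (mfderiv 𝓘(ℝ, E) 𝓘(ℝ, ℝ) (φ ∘ f) x : E →L[ℝ] ℝ) =
      φ' • (mfderiv 𝓘(ℝ, E) 𝓘(ℝ, ℝ) f x : E →L[ℝ] ℝ) := by
    have h1 := mfderiv_comp x (I' := 𝓘(ℝ, ℝ)) hφ.differentiableAt.mdifferentiableAt hf
    refine h1.trans ?_
    rw [mfderiv_eq_fderiv]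
    refine ContinuousLinearMap.ext fun v => ?_
    change fderiv ℝ φ (f x) (mfderiv 𝓘(ℝ, E) 𝓘(ℝ, ℝ) f x v) = φ' * _
    rw [hφ.hasFDerivAt.fderiv]
    exact (mul_comm _ _)
  rw [dWedge_eq, dWedge_eq]
  exact (congrArg (fun l : E →L[ℝ] ℝ => wedge l (a x)) h).trans (smul_wedge _ _ _)

theorem contMDiffAt_comp_real {φ : ℝ → ℝ} {f : M → ℝ} {x : M} (hφ : ContDiffAt ℝ ∞ φ (f x))
    (hf : ContMDiffAt 𝓘(ℝ, E) 𝓘(ℝ, ℝ) ∞ f x) : ContMDiffAt 𝓘(ℝ, E) 𝓘(ℝ, ℝ) ∞ (φ ∘ f) x :=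
  hφ.contMDiffAt.comp x hf

theorem extD_fsmul_comp {p : ℕ} {φ : ℝ → ℝ} {φ' : ℝ} {f : M → ℝ} {w : Form E M p} {x : M}
    (hφ : HasDerivAt φ φ' (f x)) (hφ' : ContDiffAt ℝ ∞ φ (f x))
    (hf : ContMDiffAt 𝓘(ℝ, E) 𝓘(ℝ, ℝ) ∞ f x) (hw : SmoothFormAt w x) :
    extD (fsmul (φ ∘ f) w) x = φ' • dWedge f w x + φ (f x) • extD w x := by
  rw [extD_fsmul (contMDiffAt_comp_real hφ' hf) hw, dWedge_comp w hφ
    (hf.mdifferentiableAt (by simp))]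
  rfl

variable [FiniteDimensional ℝ E] [FiniteDimensional ℝ E']

/-- The coefficients of positive order of a closed form are exact: by uniqueness of the expansion of
`dδ = 0`, the coefficient `b (l + 1)` is a multiple of `e l`. -/
theorem IsTube.coeff_mem_exactForms (T : IsTube E E' i r y) {p N : ℕ} {δ S : Form E M p}
    {b e : ℕ → Form E' Z p} {κ : ℕ → Form E M p} (hb : ∀ l z, SmoothFormAt (b l) z)
    (hκ : ∀ l, IsVertical r y p (κ l) (e l))
    (hS : ∀ᶠ x in 𝓝ˢ (Set.range i), SmoothFormAt S x)
    (h : ∀ᶠ x in 𝓝ˢ (Set.range i), δ x = ∑ l ∈ Finset.range (N + 1),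
      y x ^ l • (pullback (E' := E) r (b l) x + κ l x) + y x ^ (N + 1) • S x)
    (hδ : ∀ᶠ x in 𝓝ˢ (Set.range i), extD δ x = 0) :
    ∀ l < N, b (l + 1) ∈ exactForms E' Z p := by
  -- minus the remainder of the expansion of `dδ` to the order `N`
  let R : Form E M (p + 1) := -((N + 1 : ℝ) • dWedge y S + fsmul y (extD S) +
    (pullback (E' := E) r (extD (b N)) - dWedge y (pullback (E' := E) r (e N))))
  have hR : ∀ᶠ x in 𝓝ˢ (Set.range i), SmoothFormAt R x := by
    filter_upwards [T.eventually_smooth, T.eventually_smooth_retraction, hS.eventually_nhdsSet]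
      with x h1 h2 h3
    have h4 := SmoothFormAt.pullback h2
      (SmoothFormAt.extD (Filter.Eventually.of_forall (hb N) : ∀ᶠ z in 𝓝 (r x), _))
    exact ((((SmoothFormAt.dWedge h1 h3.self_of_nhds).smul _).add
      (SmoothFormAt.fsmul h1 (SmoothFormAt.extD h3))).add
      (h4.sub (SmoothFormAt.dWedge h1
        (SmoothFormAt.pullback h2 ((hκ N).smoothFormAt_right _))))).neg
  have key := T.coeff_eq_zero (q := p) (N := N) (fun l => extD (b l))
    (fun l => ((l : ℝ) + 1) • b (l + 1) - e l) hR (by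
      filter_upwards [h.eventually_nhdsSet, hδ, T.eventually_smooth,
        T.eventually_smooth_retraction, hS,
        (Finset.range (N + 1)).eventually_all.2 fun l _ => (hκ l).smoothFormAt T,
        (Finset.range (N + 1)).eventually_all.2 fun l _ => (hκ l).extD_eq T]
        with x h1 h2 h3 h4 h5 h6 h7 hx
      have hterm : ∀ l ∈ Finset.range (N + 1),
          SmoothFormAt (pullback (E' := E) r (b l) + κ l) x := fun l hl =>
        (SmoothFormAt.pullback h4 (hb l _)).add (h6 l hl)
      have hpow : ∀ l : ℕ, ContMDiffAt 𝓘(ℝ, E) 𝓘(ℝ, ℝ) ∞ ((fun t : ℝ => t ^ l) ∘ y) x :=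
        fun l => contMDiffAt_comp_real (by fun_prop) h3
      have h8 : extD δ x = extD ((∑ l ∈ Finset.range (N + 1),
          fsmul ((fun t : ℝ => t ^ l) ∘ y) (pullback (E' := E) r (b l) + κ l)) +
          fsmul ((fun t : ℝ => t ^ (N + 1)) ∘ y) S) x := by
        refine extD_congr (h1.mono fun x' h' => ?_)
        rw [h', add_apply, sum_apply]
        rfl
      rw [h2, extD_add_at (SmoothFormAt.sum _ fun l hl => (hterm l hl).fsmul (hpow l))
        (h5.fsmul (hpow _)), extD_sum_at _ fun l hl => (hterm l hl).fsmul (hpow l),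
        extD_fsmul_comp (hasDerivAt_pow (N + 1) (y x)) (by fun_prop) h3 h5] at h8
      have h9 : ∀ l ∈ Finset.range (N + 1),
          extD (fsmul ((fun t : ℝ => t ^ l) ∘ y) (pullback (E' := E) r (b l) + κ l)) x =
          ((l : ℝ) * y x ^ (l - 1)) • dWedge y (pullback (E' := E) r (b l)) x +
          y x ^ l • (pullback (E' := E) r (extD (b l)) x -
            dWedge y (pullback (E' := E) r (e l)) x) := by
        intro l hl
        rw [extD_fsmul_comp (hasDerivAt_pow l (y x)) (by fun_prop) h3 (hterm l hl), dWedge_add,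
          (hκ l).dWedge_eq_zero, add_zero,
          extD_add_at (SmoothFormAt.pullback h4 (hb l _)) (h6 l hl), h7 l hl,
          extD_pullback h4 (hb l _), sub_eq_add_neg]
      rw [Finset.sum_congr rfl h9, Finset.sum_add_distrib, Finset.sum_range_succ',
        Finset.sum_range_succ (fun l => y x ^ l • (pullback (E' := E) r (extD (b l)) x -
            dWedge y (pullback (E' := E) r (e l)) x))] at h8
      have h10 : ∀ l, y x ^ l • (pullback (E' := E) r (extD (b l)) x + dWedge y (pullback (E' := E)
            r (((l : ℝ) + 1) • b (l + 1) - e l)) x) =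
          (((l + 1 : ℕ) : ℝ) * y x ^ (l + 1 - 1)) • dWedge y (pullback (E' := E) r (b (l + 1))) x +
          y x ^ l • (pullback (E' := E) r (extD (b l)) x -
            dWedge y (pullback (E' := E) r (e l)) x) := by
        intro l
        have h11 : pullback (E' := E) r (((l : ℝ) + 1) • b (l + 1) - e l) =
          ((l : ℝ) + 1) • pullback (E' := E) r (b (l + 1)) - pullback (E' := E) r (e l) := rfl
        rw [h11, dWedge_sub, dWedge_smul, Nat.add_sub_cancel, Nat.cast_succ]
        module
      rw [Finset.sum_congr rfl fun l _ => h10 l, Finset.sum_add_distrib]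
      have h12 : R x = -(((N : ℝ) + 1) • dWedge y S x + y x • extD S x +
        (pullback (E' := E) r (extD (b N)) x - dWedge y (pullback (E' := E) r (e N)) x)) := rfl
      rw [h12]
      simp only [Nat.cast_zero, zero_mul, zero_smul, add_zero, Nat.add_sub_cancel,
        Nat.cast_succ] at h8 ⊢
      rw [← sub_eq_zero]
      refine Eq.trans ?_ h8.symm
      module)
  intro l hl
  have h1 : b (l + 1) = ((l : ℝ) + 1)⁻¹ • e l := by
    rw [eq_inv_smul_iff₀ (by positivity)]
    exact sub_eq_zero.1 (key l hl)
  rw [h1]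
  exact Submodule.smul_mem _ _ (hκ l).mem_exactForms

/-- If the polar part with closed coefficients `δ` extends smoothly over `Z`, then the `δ` are exact
on `Z`: the coefficient of `y ^ (-(j + 1))` is `i^* δ j` plus coefficients of positive order of the
forms `δ m` with `m > j`, and these are exact. -/
theorem IsTube.pullback_mem_exactForms (T : IsTube E E' i r y) {q k : ℕ} {δ : ℕ → Form E M q}
    {β : Form E M (q + 1)} (hδ : ∀ j, ∀ᶠ x in 𝓝ˢ (Set.range i), SmoothFormAt (δ j) x)
    (hδ' : ∀ j, ∀ᶠ x in 𝓝ˢ (Set.range i), extD (δ j) x = 0)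
    (hβ : ∀ᶠ x in 𝓝ˢ (Set.range i), SmoothFormAt β x)
    (h : ∀ᶠ x in 𝓝ˢ (Set.range i), x ∉ Set.range i →
      ∑ j ∈ Finset.range k, (y x ^ (j + 1))⁻¹ • dWedge y (δ j) x = β x) :
    ∀ j < k, pullback (E' := E') i (δ j) ∈ exactForms E' Z q := by
  choose b κ e S hb hκ hS hb0 hexp using fun j => T.exists_expansion (j + 1) (hδ j)
  have hex : ∀ j, ∀ l < j, b j (l + 1) ∈ exactForms E' Z q := fun j =>
    T.coeff_mem_exactForms (hb j) (hκ j) (hS j) (hexp j) (hδ' j)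
  -- After multiplication by `y ^ k`, the term `y ^ l` of `δ j` contributes to the power
  -- `m = k - 1 - j + l`.
  let c : ℕ → Form E' Z q := fun m =>
    ∑ j ∈ Finset.range k, if k ≤ m + j + 1 then b j (m + j + 1 - k) else 0
  have hR : ∀ᶠ x in 𝓝ˢ (Set.range i),
      SmoothFormAt (β - ∑ j ∈ Finset.range k, dWedge y (S j)) x := by
    filter_upwards [hβ, T.eventually_smooth,
      (Finset.range k).eventually_all.2 fun j _ => hS j] with x h1 h2 h3
    exact h1.sub (SmoothFormAt.sum _ fun j hj => SmoothFormAt.dWedge h2 (h3 j hj))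
  have key := T.coeff_eq_zero (N := k) (fun _ => 0) c hR (by
    filter_upwards [h, (Finset.range k).eventually_all.2 fun j _ => hexp j,
      T.eventually_zero_iff] with x h1 h2 h3 hx
    have hy : y x ≠ 0 := fun h => hx (h3.1 h)
    rw [sub_apply, sum_apply, ← h1 hx, smul_sub, Finset.smul_sum, Finset.smul_sum,
      ← Finset.sum_sub_distrib]
    have h4 : ∀ j ∈ Finset.range k, y x ^ k • (y x ^ (j + 1))⁻¹ • dWedge y (δ j) x -
        y x ^ k • dWedge y (S j) x = ∑ m ∈ Finset.range k, y x ^ m •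
          dWedge y (pullback (E' := E) r (if k ≤ m + j + 1 then b j (m + j + 1 - k) else 0)) x := by
      intro j hj
      have hjk := Finset.mem_range.1 hj
      have h5 : dWedge y (δ j) x = ∑ l ∈ Finset.range (j + 1),
          y x ^ l • dWedge y (pullback (E' := E) r (b j l)) x + y x ^ (j + 1) • dWedge y (S j) x := by
        have h6 : δ j x = ((∑ l ∈ Finset.range (j + 1), fsmul (fun x => y x ^ l)
            (pullback (E' := E) r (b j l) + κ j l)) + fsmul (fun x => y x ^ (j + 1)) (S j)) x := by
          rw [h2 j hj, add_apply, sum_apply]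
          rfl
        rw [dWedge_congr h6, dWedge_add, dWedge_sum, dWedge_fsmul]
        refine congrArg (· + _) (Finset.sum_congr rfl fun l _ => ?_)
        rw [dWedge_fsmul, dWedge_add, (hκ j l).dWedge_eq_zero, add_zero]
      rw [h5, smul_add, smul_add, inv_smul_smul₀ (pow_ne_zero _ hy), add_sub_cancel_right,
        Finset.smul_sum, Finset.smul_sum]
      have h7 : ∀ m ∈ Finset.range k, y x ^ m •
          dWedge y (pullback (E' := E) r (if k ≤ m + j + 1 then b j (m + j + 1 - k) else 0)) x =
          if k ≤ m + j + 1 then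
            y x ^ m • dWedge y (pullback (E' := E) r (b j (m + j + 1 - k))) x else 0 := by
        intro m _
        split_ifs
        · rfl
        · rw [dWedge_eq]
          exact (congrArg (y x ^ m • ·) (wedge_zero _)).trans (smul_zero _)
      rw [Finset.sum_congr rfl h7, ← Finset.sum_filter]
      refine Finset.sum_nbij' (fun l => k - 1 - j + l) (fun m => m + j + 1 - k) ?_ ?_ ?_ ?_ ?_
      · intro l hl
        simp only [Finset.mem_range, Finset.mem_filter] at hl ⊢
        omega
      · intro m hm
        simp only [Finset.mem_range, Finset.mem_filter] at hm ⊢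
        omega
      · intro l hl
        simp only [Finset.mem_range] at hl
        omega
      · intro m hm
        simp only [Finset.mem_range, Finset.mem_filter] at hm
        omega
      · intro l hl
        simp only [Finset.mem_range] at hl
        have h8 : k - 1 - j + l + j + 1 - k = l := by omega
        have h9 : y x ^ k = y x ^ (k - 1 - j) * y x ^ (j + 1) := by
          rw [← pow_add]
          congr 1
          omega
        rw [h8, h9, smul_smul, smul_smul]
        congr 1
        field_simp
        rw [pow_add]
    rw [Finset.sum_congr rfl h4, Finset.sum_comm]
    refine Finset.sum_congr rfl fun m _ => ?_
    rw [pullback_sum, dWedge_sum]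
    have h5 : pullback (E' := E) r (0 : Form E' Z (q + 1)) x = 0 := rfl
    rw [h5, zero_add, Finset.smul_sum])
  intro j hj
  have h1 := key (k - 1 - j) (by omega)
  simp only [c] at h1
  rw [← Finset.add_sum_erase _ _ (Finset.mem_range.2 hj), if_pos (by omega)] at h1
  have h2 : k - 1 - j + j + 1 - k = 0 := by omega
  rw [h2, hb0] at h1
  rw [eq_neg_of_add_eq_zero_left h1]
  refine Submodule.neg_mem _ (Submodule.sum_mem _ fun m hm => ?_)
  simp only [Finset.mem_erase, Finset.mem_range] at hm
  split_ifs with h3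
  · have h4 : k - 1 - j + m + 1 - k = (m - j - 1) + 1 := by omega
    rw [h4]
    exact hex m _ (by omega)
  · exact Submodule.zero_mem _

end Closed

/-! ### Powers of the ideal of functions which vanish on the hypersurface -/

section Functions

variable {E : Type*} [NormedAddCommGroup E] [NormedSpace ℝ E]
variable {M : Type*} [TopologicalSpace M] [ChartedSpace E M] [IsManifold 𝓘(ℝ, E) ∞ M]
variable {E' : Type*} [NormedAddCommGroup E'] [NormedSpace ℝ E']
variable {Z : Type*} [TopologicalSpace Z] [ChartedSpace E' Z] [IsManifold 𝓘(ℝ, E') ∞ Z]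
variable {i : Z → M} {r : M → Z} {y : M → ℝ}

/-- A function as a form of degree zero. -/
def ofFun (E : Type*) [NormedAddCommGroup E] [NormedSpace ℝ E] {M : Type*} [TopologicalSpace M]
    [ChartedSpace E M] (f : M → ℝ) : Form E M 0 :=
  fun x => ContinuousAlternatingMap.constOfIsEmpty ℝ E (Fin 0) (f x)

theorem ofFun_apply (f : M → ℝ) (x : M) (v : Fin 0 → E) : ofFun E f x v = f x := rfl

theorem eq_ofFun (w : Form E M 0) : w = ofFun E fun x => w x 0 := by
  funext x
  refine ContinuousAlternatingMap.ext fun v => ?_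
  rw [ofFun_apply, Subsingleton.elim v 0]

theorem smoothFormAt_ofFun [FiniteDimensional ℝ E] {f : M → ℝ} {x : M} :
    SmoothFormAt (ofFun E f) x ↔ ContMDiffAt 𝓘(ℝ, E) 𝓘(ℝ, ℝ) ∞ f x := by
  have h1 : SmoothFormAt (ofFun E f) x ↔
      ContDiffAt ℝ ∞ (f ∘ (chartAt E x).symm) (chartAt E x x) := by
    refine contDiffAt_alternating_iff.trans ?_
    exact ⟨fun h => h 0, fun h _ => h⟩
  rw [h1]
  refine ⟨fun h => ?_, contDiffAt_comp_chart_symm⟩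
  refine ContMDiffAt.congr_of_eventuallyEq (h.contMDiffAt.comp x
    (contMDiffAt_chart (mem_chart_source E x))) ?_
  filter_upwards [eventually_chart_left_inv (E := E) (x := x)] with x' hx'
  simp only [Function.comp_apply]
  rw [hx']

theorem mem_smoothNear {S : Set M} {f : M → ℝ} :
    f ∈ smoothNear E S ↔ ∀ᶠ x in 𝓝ˢ S, ContMDiffAt 𝓘(ℝ, E) 𝓘(ℝ, ℝ) ∞ f x := by
  rw [eventually_nhdsSet_iff_exists]
  constructor
  · rintro ⟨U, hU, hSU, hf⟩
    exact ⟨U, hU, hSU, fun x hx => hf.contMDiffAt (hU.mem_nhds hx)⟩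
  · rintro ⟨U, hU, hSU, hf⟩
    exact ⟨U, hU, hSU, fun x hx => (hf x hx).contMDiffWithinAt⟩

variable [FiniteDimensional ℝ E] [FiniteDimensional ℝ E']

/-- A function which vanishes on `Z` is divisible by `y`. -/
theorem IsTube.exists_eq_mul (T : IsTube E E' i r y) {f : M → ℝ}
    (hf : ∀ᶠ x in 𝓝ˢ (Set.range i), ContMDiffAt 𝓘(ℝ, E) 𝓘(ℝ, ℝ) ∞ f x) (h0 : ∀ z, f (i z) = 0) :
    ∃ g : M → ℝ, (∀ᶠ x in 𝓝ˢ (Set.range i), ContMDiffAt 𝓘(ℝ, E) 𝓘(ℝ, ℝ) ∞ g x) ∧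
      ∀ᶠ x in 𝓝ˢ (Set.range i), f x = y x * g x := by
  obtain ⟨S, hS, hfS⟩ := T.exists_eq_smul (w := ofFun E f)
    (hf.mono fun x hx => smoothFormAt_ofFun.2 hx)
    (fun z => ContinuousAlternatingMap.ext fun v => (ofFun_apply f (i z) v).trans (h0 z))
  refine ⟨fun x => S x 0, ?_, ?_⟩
  · rw [eq_ofFun S] at hS
    exact hS.mono fun x hx => smoothFormAt_ofFun.1 hx
  · exact hfS.mono fun x hx => congrArg (fun a : E [⋀^Fin 0]→L[ℝ] ℝ => a 0) hx

/-- Functions in the `k`-th power of the ideal of `Z` are divisible by `y ^ k` near `Z`. -/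
theorem IsTube.exists_eq_pow_mul (T : IsTube E E' i r y) (k : ℕ) :
    ∀ f : smoothNear E (Set.range i), f ∈ vanishingIdeal E (Set.range i) ^ k →
    ∃ g : M → ℝ, (∀ᶠ x in 𝓝ˢ (Set.range i), ContMDiffAt 𝓘(ℝ, E) 𝓘(ℝ, ℝ) ∞ g x) ∧
      ∀ᶠ x in 𝓝ˢ (Set.range i), f.1 x = y x ^ k * g x := by
  induction k with
  | zero =>
    exact fun f _ => ⟨f.1, mem_smoothNear.1 f.2, Filter.Eventually.of_forall fun x => by simp⟩
  | succ k ih =>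
    intro f hf
    rw [pow_succ] at hf
    refine Submodule.mul_induction_on hf ?_ ?_
    · intro a ha b hb
      obtain ⟨g, hg, hag⟩ := ih a ha
      obtain ⟨h, hh, hbh⟩ := T.exists_eq_mul (mem_smoothNear.1 b.2) fun z => hb _ ⟨z, rfl⟩
      refine ⟨fun x => g x * h x, hg.mp (hh.mono fun x h1 h2 => h2.mul h1), ?_⟩
      filter_upwards [hag, hbh] with x h1 h2
      change a.1 x * b.1 x = _
      rw [h1, h2]
      ring
    · rintro a b ⟨g, hg, hag⟩ ⟨h, hh, hbh⟩
      refine ⟨fun x => g x + h x, hg.mp (hh.mono fun x h1 h2 => h2.add h1), ?_⟩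
      filter_upwards [hag, hbh] with x h1 h2
      change a.1 x + b.1 x = _
      rw [h1, h2]
      ring

/-- A function divisible by `y ^ k` near `Z` lies in the `k`-th power of the ideal of `Z`. As elements
of `smoothNear` are functions on all of `M`, the identity has to be arranged off a neighbourhood of
`Z` as well. -/
theorem IsTube.vanishesToOrder (T : IsTube E E' i r y) {k : ℕ} {f g : M → ℝ}
    (hf : ∀ᶠ x in 𝓝ˢ (Set.range i), ContMDiffAt 𝓘(ℝ, E) 𝓘(ℝ, ℝ) ∞ f x)
    (hg : ∀ᶠ x in 𝓝ˢ (Set.range i), ContMDiffAt 𝓘(ℝ, E) 𝓘(ℝ, ℝ) ∞ g x)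
    (h : ∀ᶠ x in 𝓝ˢ (Set.range i), f x = y x ^ k * g x) :
    VanishesToOrder E (Set.range i) k f := by
  classical
  let f' : smoothNear E (Set.range i) := ⟨f, mem_smoothNear.2 hf⟩
  let g' : smoothNear E (Set.range i) := ⟨g, mem_smoothNear.2 hg⟩
  let y' : smoothNear E (Set.range i) := ⟨y, mem_smoothNear.2 T.eventually_smooth⟩
  obtain ⟨U, hU, hZU, hfU⟩ := eventually_nhdsSet_iff_exists.1 h
  -- an idempotent function which vanishes near `Z` and is one where the identity may fail
  let χ : smoothNear E (Set.range i) := ⟨Uᶜ.indicator fun _ => 1, U, hU, hZU,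
    contMDiffOn_const.congr fun x hx => Set.indicator_of_notMem (Set.notMem_compl_iff.2 hx) _⟩
  have hχ : χ ∈ vanishingIdeal E (Set.range i) := fun x hx =>
    Set.indicator_of_notMem (Set.notMem_compl_iff.2 (hZU hx)) (fun _ => (1 : ℝ))
  have hy : y' ∈ vanishingIdeal E (Set.range i) := by
    rintro x ⟨z, rfl⟩
    exact T.y_incl z
  refine ⟨f'.2, ?_⟩
  change f' ∈ _
  have key : f' = y' ^ k * g' + χ ^ k * (f' - y' ^ k * g') := by
    refine Subtype.ext (funext fun x => ?_)
    change f x = y x ^ k * g x + (Uᶜ.indicator (fun _ => (1 : ℝ)) x) ^ k * (f x - y x ^ k * g x)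
    by_cases hx : x ∈ U
    · rw [hfU x hx]
      ring
    · rw [Set.indicator_of_mem hx]
      ring
  rw [key]
  exact Ideal.add_mem _ (Ideal.mul_mem_right _ _ (Ideal.pow_mem_pow hy k))
    (Ideal.mul_mem_right _ _ (Ideal.pow_mem_pow hχ k))

/-- Functions with the same jet differ by a multiple of `y ^ k`. -/
theorem IsTube.exists_eq_add_of_represents (T : IsTube E E' i r y) {k : ℕ} (hk : 1 ≤ k)
    {j : Jet E (Set.range i) (k - 1)} {f f' : M → ℝ} (hf : Represents f j)
    (hf' : Represents f' j) :
    ∃ g : M → ℝ, (∀ᶠ x in 𝓝ˢ (Set.range i), ContMDiffAt 𝓘(ℝ, E) 𝓘(ℝ, ℝ) ∞ g x) ∧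
      ∀ᶠ x in 𝓝ˢ (Set.range i), f' x = f x + y x ^ k * g x := by
  obtain ⟨h, hj⟩ := hf
  obtain ⟨h', hj'⟩ := hf'
  rw [← hj, Ideal.Quotient.eq, Nat.sub_add_cancel hk] at hj'
  obtain ⟨g, hg, hfg⟩ := T.exists_eq_pow_mul k _ hj'
  refine ⟨g, hg, hfg.mono fun x hx => ?_⟩
  rw [← hx]
  change f' x = f x + (f' x - f x)
  ring

/-- Near `Z` the complement of `Z` is open, being defined by `y ≠ 0`. -/
theorem IsTube.eventually_notMem (T : IsTube E E' i r y) : ∀ᶠ x in 𝓝ˢ (Set.range i),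
    x ∉ Set.range i → ∀ᶠ x' in 𝓝 x, x' ∉ Set.range i := by
  filter_upwards [T.eventually_zero_iff.eventually_nhdsSet, T.eventually_smooth] with x h1 h2 h3
  filter_upwards [h1, h2.continuousAt.eventually_ne fun h => h3 (h1.self_of_nhds.1 h)]
    with x' h4 h5 h6
  exact h5 (h4.2 h6)

theorem add_dWedge {q : ℕ} {f g : M → ℝ} (a : Form E M q) {x : M}
    (hf : MDifferentiableAt 𝓘(ℝ, E) 𝓘(ℝ, ℝ) f x) (hg : MDifferentiableAt 𝓘(ℝ, E) 𝓘(ℝ, ℝ) g x) :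
    dWedge (fun x => f x + g x) a x = dWedge f a x + dWedge g a x := by
  let df : E →L[ℝ] ℝ := mfderiv 𝓘(ℝ, E) 𝓘(ℝ, ℝ) f x
  let dg : E →L[ℝ] ℝ := mfderiv 𝓘(ℝ, E) 𝓘(ℝ, ℝ) g x
  have h : (mfderiv 𝓘(ℝ, E) 𝓘(ℝ, ℝ) (fun x => f x + g x) x : E →L[ℝ] ℝ) = df + dg :=
    mfderiv_add hf hg
  rw [dWedge_eq, dWedge_eq, dWedge_eq]
  exact (congrArg (fun l : E →L[ℝ] ℝ => wedge l (a x)) h).trans (add_wedge _ _ _)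

theorem dWedge_congr_fun {q : ℕ} {f g : M → ℝ} (a : Form E M q) {x : M}
    (h : ∀ᶠ x' in 𝓝 x, f x' = g x') : dWedge f a x = dWedge g a x := by
  rw [dWedge_eq, dWedge_eq, Filter.EventuallyEq.mfderiv_eq (show f =ᶠ[𝓝 x] g from h)]

/-- A primitive of `t ^ (-(m + 1))` on the nonzero reals. -/
def powPrimitive : ℕ → ℝ → ℝ
  | 0 => Real.log
  | m + 1 => fun t => -((m : ℝ) + 1)⁻¹ * (t ^ (m + 1))⁻¹

theorem hasDerivAt_powPrimitive (m : ℕ) {t : ℝ} (ht : t ≠ 0) :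
    HasDerivAt (powPrimitive m) ((t ^ (m + 1))⁻¹) t := by
  rcases m with _ | m
  · exact (Real.hasDerivAt_log ht).congr_deriv (by simp)
  · have h := ((hasDerivAt_pow (m + 1) t).inv (pow_ne_zero _ ht)).const_mul (-((m : ℝ) + 1)⁻¹)
    refine h.congr_deriv ?_
    have : (m : ℝ) + 1 ≠ 0 := by positivity
    push_cast
    field_simp
    ring

/-- Passing to another defining function in the jet changes `dy / y ^ (m + 1)`, for `m < k`, by
the differential of a smooth function: `log |u|` for `m = 0`, where the new function is `u y`, and
otherwise a difference of negative powers, which is smooth as `u - 1` is divisible by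
`y ^ (k - 1)`. -/
theorem IsTube.exists_dWedge_eq (T : IsTube E E' i r y) {y' : M → ℝ} (T' : IsTube E E' i r y')
    {k m : ℕ} (hm : m < k) {g : M → ℝ}
    (hg : ∀ᶠ x in 𝓝ˢ (Set.range i), ContMDiffAt 𝓘(ℝ, E) 𝓘(ℝ, ℝ) ∞ g x)
    (hy : ∀ᶠ x in 𝓝ˢ (Set.range i), y' x = y x + y x ^ k * g x) :
    ∃ h : M → ℝ, (∀ᶠ x in 𝓝ˢ (Set.range i), ContMDiffAt 𝓘(ℝ, E) 𝓘(ℝ, ℝ) ∞ h x) ∧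
      ∀ᶠ x in 𝓝ˢ (Set.range i), x ∉ Set.range i → ∀ (q : ℕ) (a : Form E M q),
        (y' x ^ (m + 1))⁻¹ • dWedge y' a x = (y x ^ (m + 1))⁻¹ • dWedge y a x + dWedge h a x := by
  -- the unit `u = y' / y`
  let u : M → ℝ := fun x => 1 + y x ^ (k - 1) * g x
  have hyu : ∀ᶠ x in 𝓝ˢ (Set.range i), y' x = u x * y x := by
    filter_upwards [hy] with x hx
    have : y x ^ k = y x ^ (k - 1) * y x := by
      rw [← pow_succ]
      congr 1
      omega
    rw [hx, this]
    ring
  have hu : ∀ᶠ x in 𝓝ˢ (Set.range i), ContMDiffAt 𝓘(ℝ, E) 𝓘(ℝ, ℝ) ∞ u x := by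
    filter_upwards [T.eventually_smooth, hg] with x h1 h2
    exact contMDiffAt_const.add ((h1.pow _).mul h2)
  -- `u ≠ 0` on `Z`, as `dy' = u dy` there; this matters for `k = 1`
  have hu0 : ∀ᶠ x in 𝓝ˢ (Set.range i), u x ≠ 0 := by
    rw [eventually_nhdsSet_range] at hyu hu ⊢
    intro z
    refine (hu z).self_of_nhds.continuousAt.eventually_ne fun h0 => T'.mfderiv_ne z ?_
    have h1 : y' =ᶠ[𝓝 (i z)] u * y := hyu z
    rw [h1.mfderiv_eq]
    have h2 := ((hu z).self_of_nhds.mdifferentiableAt (by simp)).hasMFDerivAt.mul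
      ((T.smooth_fun z).self_of_nhds.mdifferentiableAt (by simp)).hasMFDerivAt
    rw [h2.mfderiv, h0, T.y_incl]
    exact (congrArg₂ (· + ·) (zero_smul ℝ _) (zero_smul ℝ _)).trans (add_zero _)
  -- the difference of primitives of `dy' / y' ^ (m + 1)` and `dy / y ^ (m + 1)`
  obtain ⟨h, hh, hhy⟩ : ∃ h : M → ℝ,
      (∀ᶠ x in 𝓝ˢ (Set.range i), ContMDiffAt 𝓘(ℝ, E) 𝓘(ℝ, ℝ) ∞ h x) ∧
      ∀ᶠ x in 𝓝ˢ (Set.range i), x ∉ Set.range i →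
        powPrimitive m (y' x) = powPrimitive m (y x) + h x := by
    rcases m with _ | m
    · refine ⟨Real.log ∘ u, ?_, ?_⟩
      · filter_upwards [hu, hu0] with x h1 h2
        exact contMDiffAt_comp_real (Real.contDiffAt_log.2 h2) h1
      · filter_upwards [hyu, hu0, T.eventually_zero_iff] with x h1 h2 h3 h4
        change Real.log (y' x) = Real.log (y x) + Real.log (u x)
        rw [h1, Real.log_mul h2 fun h => h4 (h3.1 h), add_comm]
    · refine ⟨fun x => ((m : ℝ) + 1)⁻¹ * (y x ^ (k - 2 - m) * g x *
        (∑ j ∈ Finset.range (m + 1), u x ^ j) * (u x ^ (m + 1))⁻¹), ?_, ?_⟩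
      · filter_upwards [hu, hu0, hg, T.eventually_smooth] with x h1 h2 h3 h4
        have h5 : ContMDiffAt 𝓘(ℝ, E) 𝓘(ℝ, ℝ) ∞ (fun x => (u x ^ (m + 1))⁻¹) x :=
          contMDiffAt_comp_real (φ := fun t => (t ^ (m + 1))⁻¹)
            ((contDiffAt_id.pow _).inv (pow_ne_zero _ h2)) h1
        have h6 : ContMDiffAt 𝓘(ℝ, E) 𝓘(ℝ, ℝ) ∞
            (fun x => ∑ j ∈ Finset.range (m + 1), u x ^ j) x :=
          contMDiffAt_comp_real (φ := fun t => ∑ j ∈ Finset.range (m + 1), t ^ j)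
            (ContDiffAt.sum fun j _ => contDiffAt_id.pow _) h1
        exact contMDiffAt_const.mul ((((h4.pow _).mul h3).mul h6).mul h5)
      · filter_upwards [hyu, hu0, T.eventually_zero_iff] with x h1 h2 h3 h4
        have h5 : y x ≠ 0 := fun h => h4 (h3.1 h)
        have h6 := geom_sum_mul (u x) (m + 1)
        have h7 : u x - 1 = y x ^ (k - 2 - m) * y x ^ (m + 1) * g x := by
          rw [← pow_add, show k - 2 - m + (m + 1) = k - 1 by omega]
          ring
        have h8 : u x ^ (m + 1) = 1 + (∑ j ∈ Finset.range (m + 1), u x ^ j) *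
            (y x ^ (k - 2 - m) * y x ^ (m + 1) * g x) := by
          rw [← h7, h6]
          ring
        change -((m : ℝ) + 1)⁻¹ * (y' x ^ (m + 1))⁻¹ = -((m : ℝ) + 1)⁻¹ * (y x ^ (m + 1))⁻¹ + _
        rw [h1, mul_pow]
        have h9 : (m : ℝ) + 1 ≠ 0 := by positivity
        have h10 : u x ^ (m + 1) ≠ 0 := pow_ne_zero _ h2
        have h11 : y x ^ (m + 1) ≠ 0 := pow_ne_zero _ h5
        generalize y x ^ (m + 1) = Y at *
        generalize u x ^ (m + 1) = U at *
        field_simp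
        rw [h8]
        ring
  refine ⟨h, hh, ?_⟩
  filter_upwards [hh, hhy.eventually_nhdsSet, T.eventually_notMem, T.eventually_zero_iff,
    T'.eventually_zero_iff, T.eventually_smooth, T'.eventually_smooth]
    with x h1 h2 h3 h4 h5 h6 h7 hx q a
  have hyx : y x ≠ 0 := fun h => hx (h4.1 h)
  have hyx' : y' x ≠ 0 := fun h => hx (h5.1 h)
  have h8 := h6.mdifferentiableAt (by simp)
  have h9 : MDifferentiableAt 𝓘(ℝ, E) 𝓘(ℝ, ℝ) (powPrimitive m ∘ y) x :=
    (hasDerivAt_powPrimitive m hyx).differentiableAt.mdifferentiableAt.comp x h8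
  rw [← dWedge_comp a (hasDerivAt_powPrimitive m hyx) h8,
    ← dWedge_comp a (hasDerivAt_powPrimitive m hyx') (h7.mdifferentiableAt (by simp)),
    ← add_dWedge a h9 (h1.mdifferentiableAt (by simp))]
  refine dWedge_congr_fun a ?_
  filter_upwards [h2, h3 hx] with x' h10 h11 using h10 h11

end Functions

/-! ### Vector fields adapted to the jet -/

section Fields

variable {E : Type*} [NormedAddCommGroup E] [NormedSpace ℝ E]
variable {M : Type*} [TopologicalSpace M] [ChartedSpace E M] [IsManifold 𝓘(ℝ, E) ∞ M]
variable {E' : Type*} [NormedAddCommGroup E'] [NormedSpace ℝ E']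
variable {Z : Type*} [TopologicalSpace Z] [ChartedSpace E' Z] [IsManifold 𝓘(ℝ, E') ∞ Z]
variable {k : ℕ} {r : M → Z} {y : M → ℝ}

/-- The derivative of a smooth function along a smooth vector field is smooth. -/
theorem contMDiffAt_mfderiv_apply {f : M → ℝ} {v : ∀ x : M, TangentSpace 𝓘(ℝ, E) x} {x : M}
    (hf : ContMDiffAt 𝓘(ℝ, E) 𝓘(ℝ, ℝ) ∞ f x)
    (hv : ContMDiffAt 𝓘(ℝ, E) (𝓘(ℝ, E).prod 𝓘(ℝ, E)) ∞
      (fun x => (⟨x, v x⟩ : TangentBundle 𝓘(ℝ, E) M)) x) :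
    ContMDiffAt 𝓘(ℝ, E) 𝓘(ℝ, ℝ) ∞ (fun x => (mfderiv 𝓘(ℝ, E) 𝓘(ℝ, ℝ) f x (v x) : ℝ)) x := by
  have : IsManifold 𝓘(ℝ, E) 1 M := IsManifold.of_le (n := ∞) (by simp)
  have : IsManifold 𝓘(ℝ, E) (∞ + 1) M := IsManifold.of_le (n := ∞) (by simp)
  have h1 := ContMDiffAt.clm_apply_of_inCoordinates (hf.mfderiv_const (m := ∞) (by simp)) hv hf
  exact (contMDiff_snd_tangentBundle_modelSpace ℝ 𝓘(ℝ, ℝ) (n := ∞)).contMDiffAt.comp x h1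

variable [FiniteDimensional ℝ E] [FiniteDimensional ℝ E']

/-- A smooth vector field `v` with `dy(v)` divisible by `y ^ k` is a `b^k`-vector field: every other
function in the jet is `y + y ^ k g`. -/
theorem BkStructure.isBkVectorField_of_eq (X : BkStructure k E' Z E M)
    (T : IsTube E E' X.incl r y) (hk : 1 ≤ k) (hy : Represents y X.jet)
    {v : ∀ x : M, TangentSpace 𝓘(ℝ, E) x}
    (hv : ContMDiff 𝓘(ℝ, E) (𝓘(ℝ, E).prod 𝓘(ℝ, E)) ∞
      (fun x => (⟨x, v x⟩ : TangentBundle 𝓘(ℝ, E) M))) {a : M → ℝ}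
    (ha : ∀ᶠ x in 𝓝ˢ (Set.range X.incl), ContMDiffAt 𝓘(ℝ, E) 𝓘(ℝ, ℝ) ∞ a x)
    (h : ∀ᶠ x in 𝓝ˢ (Set.range X.incl),
      (mfderiv 𝓘(ℝ, E) 𝓘(ℝ, ℝ) y x (v x) : ℝ) = y x ^ k * a x) : X.IsBkVectorField v := by
  refine ⟨hv, fun z => ?_, fun f hf => ?_⟩
  · refine T.mem_range_mfderiv_incl z ?_
    refine ((eventually_nhdsSet_range.1 h z).self_of_nhds).trans ?_
    rw [T.y_incl, zero_pow (by omega), zero_mul]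
    rfl
  · obtain ⟨g, hg, hfg⟩ := T.exists_eq_add_of_represents hk hy hf
    have hf' : ∀ᶠ x in 𝓝ˢ (Set.range X.incl), ContMDiffAt 𝓘(ℝ, E) 𝓘(ℝ, ℝ) ∞ f x :=
      mem_smoothNear.1 hf.choose
    let gv : M → ℝ := fun x => mfderiv 𝓘(ℝ, E) 𝓘(ℝ, ℝ) g x (v x)
    refine T.vanishesToOrder
      (g := fun x => a x + (k : ℝ) * y x ^ (k - 1) * g x * a x + gv x) ?_ ?_ ?_
    · exact hf'.mono fun x hx => contMDiffAt_mfderiv_apply hx hv.contMDiffAt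
    · filter_upwards [ha, hg, T.eventually_smooth] with x h1 h2 h3
      exact (h1.add (((contMDiffAt_const.mul (h3.pow _)).mul h2).mul h1)).add
        (contMDiffAt_mfderiv_apply h2 hv.contMDiffAt)
    · filter_upwards [h, hg, T.eventually_smooth, hfg.eventually_nhdsSet] with x h1 h2 h3 h4
      have h5 := (h3.mdifferentiableAt (by simp)).hasMFDerivAt
      have h6 := (h2.mdifferentiableAt (by simp)).hasMFDerivAt
      have h7 := h5.add ((((hasDerivAt_pow k (y x)).hasFDerivAt.hasMFDerivAt).comp x h5).mul h6)
      have h8 : f =ᶠ[𝓝 x] y + ((fun t : ℝ => t ^ k) ∘ y) * g := h4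
      rw [h8.mfderiv_eq, h7.mfderiv]
      let yv : ℝ := mfderiv 𝓘(ℝ, E) 𝓘(ℝ, ℝ) y x (v x)
      have h9 : yv = y x ^ k * a x := h1
      have h10 : yv + (y x ^ k * gv x + g x * (yv * ((k : ℝ) * y x ^ (k - 1)))) =
          y x ^ k * (a x + (k : ℝ) * y x ^ (k - 1) * g x * a x + gv x) := by
        rw [h9]
        ring
      exact h10

/-- Near `i z₀`, the differentials of the coordinates and of `G` are inverse to each other. -/
theorem IsTubeChart.eventually_inverse {i : Z → M} {z₀ : Z} {G : E' × ℝ → M}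
    (C : IsTubeChart E E' i r y z₀ G) (T : IsTube E E' i r y) : ∀ᶠ x in 𝓝 (i z₀),
    ∃ (A : E →L[ℝ] E' × ℝ) (B : E' × ℝ →L[ℝ] E),
      A = mfderiv 𝓘(ℝ, E) 𝓘(ℝ, E' × ℝ) (tubeMap E' r y z₀) x ∧
      B = mfderiv 𝓘(ℝ, E' × ℝ) 𝓘(ℝ, E) G (tubeMap E' r y z₀ x) ∧
      A.comp B = ContinuousLinearMap.id ℝ (E' × ℝ) ∧ B.comp A = ContinuousLinearMap.id ℝ E := by
  filter_upwards [T.smooth_tubeMap z₀, (T.tendsto_tubeMap z₀).eventually C.smooth,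
    C.left_inv.eventually_nhds, (T.tendsto_tubeMap z₀).eventually C.right_inv.eventually_nhds]
    with x h1 h2 h3 h4
  refine ⟨_, _, rfl, rfl, ?_, ?_⟩
  · have h5 : (tubeMap E' r y z₀) ∘ G =ᶠ[𝓝 (tubeMap E' r y z₀ x)] id := h4
    have h1' := h1
    rw [← h3.self_of_nhds] at h1'
    have h6 := mfderiv_comp (tubeMap E' r y z₀ x) (h1'.mdifferentiableAt (by simp))
      (h2.mdifferentiableAt (by simp))
    rw [h5.mfderiv_eq, mfderiv_id, h3.self_of_nhds] at h6
    exact h6.symm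
  · have h5 : G ∘ (tubeMap E' r y z₀) =ᶠ[𝓝 x] id := h3
    have h6 := mfderiv_comp x (h2.mdifferentiableAt (by simp)) (h1.mdifferentiableAt (by simp))
    rw [h5.mfderiv_eq, mfderiv_id] at h6
    exact h6.symm

/-- The coordinate fields tangent to the levels of `y`, and `y ^ m` times the other one for `m ≥ k`,
extend from a neighbourhood of a point of `Z` to `b^k`-vector fields. -/
theorem BkStructure.exists_isBkVectorField [T2Space M] (X : BkStructure k E' Z E M)
    (T : IsTube E E' X.incl r y) (hk : 1 ≤ k) (hy : Represents y X.jet) {z₀ : Z}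
    {G : E' × ℝ → M} (C : IsTubeChart E E' X.incl r y z₀ G) (e : E' × ℝ) (m : ℕ)
    (he : e.2 = 0 ∨ k ≤ m) : ∃ v : ∀ x : M, TangentSpace 𝓘(ℝ, E) x, X.IsBkVectorField v ∧
      ∀ᶠ p in 𝓝 (chartAt E' z₀ z₀, (0 : ℝ)),
        v (G p) = (p.2 ^ m • (mfderiv 𝓘(ℝ, E' × ℝ) 𝓘(ℝ, E) G p e : E) : E) := by
  have : IsManifold 𝓘(ℝ, E) 1 M := IsManifold.of_le (n := ∞) (by simp)
  have : IsManifold 𝓘(ℝ, E) (∞ + 1) M := IsManifold.of_le (n := ∞) (by simp)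
  have : CompleteSpace E := FiniteDimensional.complete ℝ E
  have : CompleteSpace E' := FiniteDimensional.complete ℝ E'
  let w : ∀ x : M, TangentSpace 𝓘(ℝ, E) x :=
    VectorField.mpullback 𝓘(ℝ, E) 𝓘(ℝ, E' × ℝ) (tubeMap E' r y z₀) fun _ => e
  have hw : ∀ᶠ x in 𝓝 (X.incl z₀), ContMDiffAt 𝓘(ℝ, E) (𝓘(ℝ, E).prod 𝓘(ℝ, E)) ∞
      (fun x => (⟨x, w x⟩ : TangentBundle 𝓘(ℝ, E) M)) x := by
    filter_upwards [C.eventually_inverse T, T.smooth_tubeMap z₀] with x ⟨A, B, hA, hB, h1, h2⟩ h3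
    have h4 : A.IsInvertible := ContinuousLinearMap.IsInvertible.of_inverse h1 h2
    rw [hA] at h4
    exact ContMDiffAt.mpullback_vectorField_preimage
      (contMDiffAt_vectorSpace_iff_contDiffAt.2 contDiffAt_const) h3 h4 (by simp)
  have hdw : ∀ᶠ x in 𝓝 (X.incl z₀), (mfderiv 𝓘(ℝ, E) 𝓘(ℝ, ℝ) y x (w x) : ℝ) = e.2 := by
    filter_upwards [C.eventually_inverse T, T.smooth_tubeMap z₀] with x ⟨A, B, hA, hB, h1, h2⟩ h3
    refine (IsTube.mfderiv_tubeMap_snd h3 (w x)).symm.trans ?_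
    have h4 : w x = B e := by
      have h5 := ContinuousLinearMap.inverse_eq h1 h2
      rw [hA] at h5
      exact congrArg (fun f : E' × ℝ →L[ℝ] E => f e) h5
    rw [h4]
    have h6 : A (B e) = e := congrArg (fun f : E' × ℝ →L[ℝ] E' × ℝ => f e) h1
    rw [hA] at h6
    exact congrArg Prod.snd h6
  have hwG : ∀ᶠ p in 𝓝 (chartAt E' z₀ z₀, (0 : ℝ)),
      w (G p) = (mfderiv 𝓘(ℝ, E' × ℝ) 𝓘(ℝ, E) G p e : E) := by
    filter_upwards [C.tendsto.eventually (C.eventually_inverse T), C.right_inv]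
      with p ⟨A, B, hA, hB, h1, h2⟩ h3
    have h5 := ContinuousLinearMap.inverse_eq h1 h2
    rw [h3] at hB
    rw [hA, hB] at h5
    exact congrArg (fun f : E' × ℝ →L[ℝ] E => f e) h5
  obtain ⟨U, hU, hUo, hUz⟩ := eventually_nhds_iff.1 (hw.and (hdw.and (T.smooth_fun z₀)))
  obtain ⟨χ, -, hχ⟩ := (SmoothBumpFunction.nhds_basis_tsupport (I := 𝓘(ℝ, E))
    (X.incl z₀)).mem_iff.1 (hUo.mem_nhds hUz)
  -- the coordinate field `w`, cut off near `i z₀`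
  let v : ∀ x : M, TangentSpace 𝓘(ℝ, E) x := fun x => χ x • (y x ^ m • w x)
  have hv : ContMDiff 𝓘(ℝ, E) (𝓘(ℝ, E).prod 𝓘(ℝ, E)) ∞
      (fun x => (⟨x, v x⟩ : TangentBundle 𝓘(ℝ, E) M)) := by
    refine ContMDiffOn.smul_section_of_tsupport χ.contMDiff.contMDiffOn hUo hχ fun x hx => ?_
    exact (ContMDiffAt.smul_section ((hU x hx).2.2.pow m) (hU x hx).1).contMDiffWithinAt
  have hdv : ∀ x, (mfderiv 𝓘(ℝ, E) 𝓘(ℝ, ℝ) y x (v x) : ℝ) = χ x * (y x ^ m * e.2) := by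
    intro x
    by_cases hx : x ∈ U
    · rw [← (hU x hx).2.1]
      exact ((mfderiv 𝓘(ℝ, E) 𝓘(ℝ, ℝ) y x).map_smul _ _).trans
        (congrArg (χ x • ·) ((mfderiv 𝓘(ℝ, E) 𝓘(ℝ, ℝ) y x).map_smul _ _))
    · have h1 : χ x = 0 := image_eq_zero_of_notMem_tsupport fun h => hx (hχ h)
      have h2 : v x = 0 := by
        change χ x • _ = _
        rw [h1]
        exact zero_smul ℝ _
      rw [h2, h1, zero_mul]
      exact map_zero _
  refine ⟨v, X.isBkVectorField_of_eq T hk hy hv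
    (a := fun x => χ x * (y x ^ (m - k) * e.2)) ?_ ?_, ?_⟩
  · filter_upwards [T.eventually_smooth] with x hx
    exact χ.contMDiff.contMDiffAt.mul ((hx.pow _).mul contMDiffAt_const)
  · refine Filter.Eventually.of_forall fun x => ?_
    have h1 : χ x * (y x ^ m * e.2) = y x ^ k * (χ x * (y x ^ (m - k) * e.2)) := by
      rcases he with he | he
      · rw [he]
        ring
      · obtain ⟨d, rfl⟩ := Nat.exists_eq_add_of_le he
        rw [Nat.add_sub_cancel_left, pow_add]
        ring
    exact (hdv x).trans h1
  · filter_upwards [hwG, C.tendsto.eventually χ.eventuallyEq_one, C.y_eq] with p h1 h2 h3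
    change χ (G p) • (y (G p) ^ m • w (G p)) = _
    rw [h2, h3, h1]
    exact one_smul ℝ _

end Fields

/-! ### Expansions of `b^k`-forms -/

section BkForms

variable {E : Type*} [NormedAddCommGroup E] [NormedSpace ℝ E]
variable {M : Type*} [TopologicalSpace M] [ChartedSpace E M] [IsManifold 𝓘(ℝ, E) ∞ M]
variable {E' : Type*} [NormedAddCommGroup E'] [NormedSpace ℝ E']
variable {Z : Type*} [TopologicalSpace Z] [ChartedSpace E' Z] [IsManifold 𝓘(ℝ, E') ∞ Z]
variable {k : ℕ} {r : M → Z} {y : M → ℝ}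
variable [FiniteDimensional ℝ E] [FiniteDimensional ℝ E']

/-- A form given off `Z`, whose expressions in the coordinates extend smoothly over `t = 0`,
extends smoothly over `Z`. -/
theorem IsTube.exists_extension_of_pullback {i : Z → M} (T : IsTube E E' i r y) {p : ℕ}
    (w : Form E M p) (h : ∀ (z : Z) (G : E' × ℝ → M), IsTubeChart E E' i r y z G →
      ∃ v : E' × ℝ → (E' × ℝ) [⋀^Fin p]→L[ℝ] ℝ,
        (∀ᶠ x in 𝓝 (chartAt E' z z, (0 : ℝ)), ContDiffAt ℝ ∞ v x) ∧
        ∀ᶠ x in 𝓝 (chartAt E' z z, (0 : ℝ)), x.2 ≠ 0 → pullback (E' := E' × ℝ) G w x = v x) :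
    ∃ W : Form E M p, (∀ᶠ x in 𝓝ˢ (Set.range i), SmoothFormAt W x) ∧
      ∀ x ∉ Set.range i, W x = w x := by
  refine T.exists_extension w fun z => ?_
  obtain ⟨G, C⟩ := T.exists_isTubeChart z
  obtain ⟨v, hv, hvw⟩ := h z G C
  refine ⟨_, T.smoothFormAt_pullback hv, ?_⟩
  filter_upwards [T.zero_iff z, C.pullback_pullback T (p := p),
    (T.tendsto_tubeMap z).eventually hvw]
    with x h1 h2 h3 h4
  rw [← h2 w]
  exact pullback_congr (h3 fun h => h4 (h1.1 h)).symm

/-- The components of a `b^k`-form in the coordinates, multiplied by `t ^ k` for each occurrence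
of the vector `(0, 1)`, extend smoothly over `t = 0`. -/
theorem BkStructure.exists_component [T2Space M] (X : BkStructure k E' Z E M)
    (T : IsTube E E' X.incl r y) (hk : 1 ≤ k) (hy : Represents y X.jet) {z₀ : Z}
    {G : E' × ℝ → M} (C : IsTubeChart E E' X.incl r y z₀ G) {p : ℕ} {θ : Form E M p}
    (hθ : θ ∈ X.bkForms p) (e : Fin p → E' × ℝ) (m : Fin p → ℕ)
    (hem : ∀ j, (e j).2 = 0 ∨ k ≤ m j) : ∃ g : E' × ℝ → ℝ,
      (∀ᶠ x in 𝓝 (chartAt E' z₀ z₀, (0 : ℝ)), ContDiffAt ℝ ∞ g x) ∧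
      ∀ᶠ x in 𝓝 (chartAt E' z₀ z₀, (0 : ℝ)), x.2 ≠ 0 →
        g x = (∏ j, x.2 ^ m j) * pullback (E' := E' × ℝ) G θ x e := by
  choose v hv hvG using fun j => X.exists_isBkVectorField T hk hy C (e j) (m j) (hem j)
  obtain ⟨g, hg, hgθ⟩ := hθ.2.2 v hv
  refine ⟨g ∘ G, ?_, ?_⟩
  · filter_upwards [C.smooth] with x hx
    exact contMDiffAt_iff_contDiffAt.1 (hg.contMDiffAt.comp x hx)
  · filter_upwards [C.mem_range_iff T, Filter.eventually_all.2 hvG] with x h1 h2 h3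
    have h4 : G x ∉ X.hyp := fun h => h3 (h1.1 h)
    refine (hgθ _ h4).trans ?_
    have h5 : (fun l => v l (G x)) = fun l => x.2 ^ m l •
        (mfderiv 𝓘(ℝ, E' × ℝ) 𝓘(ℝ, E) G x (e l) : E) := funext h2
    rw [h5]
    exact ContinuousMultilinearMap.map_smul_univ (θ (G x)).toContinuousMultilinearMap _ _

theorem contDiffAt_comp_fst {p : ℕ} {A : E' × ℝ → E' [⋀^Fin p]→L[ℝ] ℝ} {x : E' × ℝ}
    (hA : ContDiffAt ℝ ∞ A x) : ContDiffAt ℝ ∞ (fun x => (A x).compContinuousLinearMap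
      (ContinuousLinearMap.fst ℝ E' ℝ)) x :=
  contDiffAt_compCLM hA contDiffAt_const

/-- The horizontal components of a `b^k`-form extend smoothly over `t = 0`. -/
theorem BkStructure.exists_horizontal [T2Space M] (X : BkStructure k E' Z E M)
    (T : IsTube E E' X.incl r y) (hk : 1 ≤ k) (hy : Represents y X.jet) {z₀ : Z}
    {G : E' × ℝ → M} (C : IsTubeChart E E' X.incl r y z₀ G) {p : ℕ} {θ : Form E M p}
    (hθ : θ ∈ X.bkForms p) : ∃ A : E' × ℝ → E' [⋀^Fin p]→L[ℝ] ℝ,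
      (∀ᶠ x in 𝓝 (chartAt E' z₀ z₀, (0 : ℝ)), ContDiffAt ℝ ∞ A x) ∧
      ∀ᶠ x in 𝓝 (chartAt E' z₀ z₀, (0 : ℝ)), x.2 ≠ 0 →
        (pullback (E' := E' × ℝ) G θ x).compContinuousLinearMap
          (ContinuousLinearMap.inl ℝ E' ℝ) = A x := by
  let b := Module.finBasis ℝ E'
  obtain ⟨L, hL⟩ := exists_reconstruct b p
  choose g hg hgθ using fun J : Fin p → Fin (Module.finrank ℝ E') =>
    X.exists_component T hk hy C hθ (fun j => (b (J j), 0)) (fun _ => 0) fun _ => Or.inl rfl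
  refine ⟨fun x => L fun J => g J x, ?_, ?_⟩
  · filter_upwards [Filter.eventually_all.2 hg] with x hx
    exact L.contDiff.contDiffAt.comp x (contDiffAt_pi.2 hx)
  · filter_upwards [Filter.eventually_all.2 hgθ] with x hx h0
    rw [← hL ((pullback (E' := E' × ℝ) G θ x).compContinuousLinearMap
      (ContinuousLinearMap.inl ℝ E' ℝ))]
    refine congrArg L (funext fun J => ?_)
    rw [hx J h0]
    simp only [pow_zero, Finset.prod_const_one, one_mul]
    rfl

/-- The vertical components of a `b^k`-form, multiplied by `t ^ k`, extend smoothly over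
`t = 0`. -/
theorem BkStructure.exists_vertical [T2Space M] (X : BkStructure k E' Z E M)
    (T : IsTube E E' X.incl r y) (hk : 1 ≤ k) (hy : Represents y X.jet) {z₀ : Z}
    {G : E' × ℝ → M} (C : IsTubeChart E E' X.incl r y z₀ G) {q : ℕ} {θ : Form E M (q + 1)}
    (hθ : θ ∈ X.bkForms (q + 1)) : ∃ B : E' × ℝ → E' [⋀^Fin q]→L[ℝ] ℝ,
      (∀ᶠ x in 𝓝 (chartAt E' z₀ z₀, (0 : ℝ)), ContDiffAt ℝ ∞ B x) ∧
      ∀ᶠ x in 𝓝 (chartAt E' z₀ z₀, (0 : ℝ)), x.2 ≠ 0 →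
        x.2 ^ k • ((pullback (E' := E' × ℝ) G θ x).curryLeft (0, 1)).compContinuousLinearMap
          (ContinuousLinearMap.inl ℝ E' ℝ) = B x := by
  let b := Module.finBasis ℝ E'
  obtain ⟨L, hL⟩ := exists_reconstruct b q
  choose g hg hgθ using fun J : Fin q → Fin (Module.finrank ℝ E') =>
    X.exists_component T hk hy C hθ (Matrix.vecCons (0, 1) fun j => (b (J j), 0))
      (Matrix.vecCons k fun _ => 0) (by
        intro j
        refine Fin.cases ?_ (fun j => ?_) j
        · exact Or.inr le_rfl
        · exact Or.inl rfl)
  refine ⟨fun x => L fun J => g J x, ?_, ?_⟩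
  · filter_upwards [Filter.eventually_all.2 hg] with x hx
    exact L.contDiff.contDiffAt.comp x (contDiffAt_pi.2 hx)
  · filter_upwards [Filter.eventually_all.2 hgθ] with x hx h0
    rw [← hL (x.2 ^ k • ((pullback (E' := E' × ℝ) G θ x).curryLeft
      (0, 1)).compContinuousLinearMap (ContinuousLinearMap.inl ℝ E' ℝ))]
    refine congrArg L (funext fun J => ?_)
    rw [hx J h0, Fin.prod_univ_succ]
    simp only [Matrix.cons_val_zero, Matrix.cons_val_succ, pow_zero, Finset.prod_const_one,
      mul_one]
    rfl

/-- For a `b^k`-form `θ`, the form `y ^ k θ` extends smoothly over `Z`. -/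
theorem BkStructure.exists_extension_fsmul [T2Space M] (X : BkStructure k E' Z E M)
    (T : IsTube E E' X.incl r y) (hk : 1 ≤ k) (hy : Represents y X.jet) {p : ℕ} {θ : Form E M p}
    (hθ : θ ∈ X.bkForms p) : ∃ W : Form E M p,
      (∀ᶠ x in 𝓝ˢ (Set.range X.incl), SmoothFormAt W x) ∧
      ∀ x ∉ Set.range X.incl, W x = y x ^ k • θ x := by
  refine T.exists_extension_of_pullback (fsmul (fun x => y x ^ k) θ) fun z G C => ?_
  obtain ⟨A, hA, hAθ⟩ := X.exists_horizontal T hk hy C hθ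
  have hG : ∀ x, pullback (E' := E' × ℝ) G (fsmul (fun x => y x ^ k) θ) x =
    y (G x) ^ k • pullback (E' := E' × ℝ) G θ x := fun x => rfl
  rcases p with _ | q
  · refine ⟨fun x => x.2 ^ k • (A x).compContinuousLinearMap (ContinuousLinearMap.fst ℝ E' ℝ),
      hA.mono fun x hx => (contDiffAt_snd.pow k).smul (contDiffAt_comp_fst hx), ?_⟩
    filter_upwards [hAθ, C.y_eq] with x h1 h2 h3
    rw [hG, h2, ← h1 h3]
    congr 1
    ext v
    exact congrArg _ (Subsingleton.elim _ _)
  · obtain ⟨B, hB, hBθ⟩ := X.exists_vertical T hk hy C hθ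
    refine ⟨fun x => x.2 ^ k • (A x).compContinuousLinearMap (ContinuousLinearMap.fst ℝ E' ℝ) +
      wedge (ContinuousLinearMap.snd ℝ E' ℝ)
        ((B x).compContinuousLinearMap (ContinuousLinearMap.fst ℝ E' ℝ)), ?_, ?_⟩
    · filter_upwards [hA, hB] with x h1 h2
      exact ((contDiffAt_snd.pow k).smul (contDiffAt_comp_fst h1)).add
        (contDiffAt_wedge contDiffAt_const (contDiffAt_comp_fst h2))
    · filter_upwards [hAθ, hBθ, C.y_eq] with x h1 h2 h3 h4
      rw [hG, h3, ← h1 h4, ← h2 h4, smul_compCLM, wedge_smul, ← smul_add]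
      exact congrArg (x.2 ^ k • ·) (alternating_prod_decomp _)

/-- For a `b^k`-form `θ`, the form `dy ∧ θ` extends smoothly over `Z`. -/
theorem BkStructure.exists_extension_dWedge [T2Space M] (X : BkStructure k E' Z E M)
    (T : IsTube E E' X.incl r y) (hk : 1 ≤ k) (hy : Represents y X.jet) {p : ℕ} {θ : Form E M p}
    (hθ : θ ∈ X.bkForms p) : ∃ W : Form E M (p + 1),
      (∀ᶠ x in 𝓝ˢ (Set.range X.incl), SmoothFormAt W x) ∧
      ∀ x ∉ Set.range X.incl, W x = dWedge y θ x := by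
  refine T.exists_extension_of_pullback (dWedge y θ) fun z G C => ?_
  obtain ⟨A, hA, hAθ⟩ := X.exists_horizontal T hk hy C hθ
  refine ⟨fun x => wedge (ContinuousLinearMap.snd ℝ E' ℝ)
    ((A x).compContinuousLinearMap (ContinuousLinearMap.fst ℝ E' ℝ)),
    hA.mono fun x hx => contDiffAt_wedge contDiffAt_const (contDiffAt_comp_fst hx), ?_⟩
  filter_upwards [hAθ, C.pullback_dWedge_fun T] with x h1 h2 h3
  rw [h2, ← h1 h3]
  generalize (pullback (E' := E' × ℝ) G θ x : (E' × ℝ) [⋀^Fin p]→L[ℝ] ℝ) = a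
  rcases p with _ | q
  · congr 1
    ext v
    exact congrArg _ (Subsingleton.elim _ _)
  · conv_lhs => rw [alternating_prod_decomp a]
    rw [wedge_add, wedge_wedge_self, add_zero]

/-- The polar part of a `b^k`-form is vertical: there are no terms `r^* b / y ^ (l + 1)`, as these
would contribute a pole to `dy ∧ θ`. -/
theorem BkStructure.exists_polar_part [T2Space M] (X : BkStructure k E' Z E M)
    (T : IsTube E E' X.incl r y) (hk : 1 ≤ k) (hy : Represents y X.jet) {p : ℕ} {θ : Form E M p}
    (hθ : θ ∈ X.bkForms p) : ∃ (κ : ℕ → Form E M p) (e : ℕ → Form E' Z p) (S : Form E M p),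
      (∀ l, IsVertical r y p (κ l) (e l)) ∧
      (∀ᶠ x in 𝓝ˢ (Set.range X.incl), SmoothFormAt S x) ∧
      ∀ᶠ x in 𝓝ˢ (Set.range X.incl), x ∉ Set.range X.incl →
        θ x = ∑ l ∈ Finset.range k, (y x ^ (l + 1))⁻¹ • κ l x + S x := by
  obtain ⟨Θ, hΘ, hΘθ⟩ := X.exists_extension_fsmul T hk hy hθ
  obtain ⟨Ψ, hΨ, hΨθ⟩ := X.exists_extension_dWedge T hk hy hθ
  obtain ⟨b, κ, e, S, hb, hκ, hS, -, hexp⟩ := T.exists_expansion k hΘ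
  have hR : ∀ᶠ x in 𝓝ˢ (Set.range X.incl), SmoothFormAt (Ψ - dWedge y S) x := by
    filter_upwards [hΨ, hS, T.eventually_smooth] with x h1 h2 h3
    exact h1.sub (SmoothFormAt.dWedge h3 h2)
  have hb0 := T.coeff_eq_zero (N := k) (fun _ => 0) b hR (by
    filter_upwards [hexp] with x h1 h2
    have h3 : dWedge y Θ x = y x ^ k • dWedge y θ x := by
      rw [← dWedge_fsmul y (fun x => y x ^ k)]
      exact dWedge_congr (hΘθ x h2)
    have h4 : Θ x = ((∑ l ∈ Finset.range k, fsmul (fun x => y x ^ l)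
        (pullback (E' := E) r (b l) + κ l)) + fsmul (fun x => y x ^ k) S) x := by
      rw [h1, add_apply, sum_apply]
      rfl
    rw [dWedge_congr h4, dWedge_add, dWedge_sum, dWedge_fsmul, ← hΨθ x h2] at h3
    rw [sub_apply, smul_sub, ← h3, add_sub_cancel_right]
    refine Finset.sum_congr rfl fun l _ => ?_
    rw [dWedge_fsmul, dWedge_add, (hκ l).dWedge_eq_zero, add_zero]
    exact congrArg (y x ^ l • ·) (zero_add _))
  refine ⟨fun l => κ (k - 1 - l), fun l => e (k - 1 - l), S, fun l => hκ _, hS, ?_⟩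
  filter_upwards [hexp, T.eventually_zero_iff] with x h1 h2 h3
  have hyx : y x ≠ 0 := fun h => h3 (h2.1 h)
  rw [hΘθ x h3] at h1
  refine smul_right_injective _ (pow_ne_zero k hyx) ?_
  refine h1.trans ?_
  simp only
  rw [smul_add, ← Finset.sum_range_reflect, Finset.smul_sum]
  refine congrArg (· + _) (Finset.sum_congr rfl fun l hl => ?_)
  have hlk := Finset.mem_range.1 hl
  have h4 : pullback (E' := E) r (b (k - 1 - l)) x = 0 := by
    rw [hb0 _ (by omega)]
    rfl
  have h5 : y x ^ k = y x ^ (k - 1 - l) * y x ^ (l + 1) := by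
    rw [← pow_add]
    congr 1
    omega
  rw [h4, zero_add, h5, smul_smul, mul_inv_cancel_right₀ (pow_ne_zero _ hyx)]

/-- The differential of the expansion of a `b^k`-form. -/
theorem IsTube.extD_polar_part {i : Z → M} (T : IsTube E E' i r y) {p : ℕ} {θ S : Form E M p}
    {κ : ℕ → Form E M p} {e : ℕ → Form E' Z p} (hκ : ∀ l, IsVertical r y p (κ l) (e l))
    (hS : ∀ᶠ x in 𝓝ˢ (Set.range i), SmoothFormAt S x)
    (h : ∀ᶠ x in 𝓝ˢ (Set.range i), x ∉ Set.range i →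
        θ x = ∑ l ∈ Finset.range k, (y x ^ (l + 1))⁻¹ • κ l x + S x) :
    ∀ᶠ x in 𝓝ˢ (Set.range i), x ∉ Set.range i →
      extD θ x = -∑ l ∈ Finset.range k,
        (y x ^ (l + 1))⁻¹ • dWedge y (pullback (E' := E) r (e l)) x + extD S x := by
  filter_upwards [h.eventually_nhdsSet, T.eventually_notMem, hS, T.eventually_smooth,
    T.eventually_zero_iff, (Finset.range k).eventually_all.2 fun l _ => (hκ l).smoothFormAt T,
    (Finset.range k).eventually_all.2 fun l _ => (hκ l).extD_eq T]
    with x h1 h2 h3 h4 h5 h6 h7 hx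
  have hyx : y x ≠ 0 := fun h => hx (h5.1 h)
  have hφ : ∀ l : ℕ, ContDiffAt ℝ ∞ (fun t : ℝ => (t ^ (l + 1))⁻¹) (y x) := fun l =>
    (contDiffAt_id.pow _).inv (pow_ne_zero _ hyx)
  have hs : ∀ l ∈ Finset.range k,
      SmoothFormAt (fsmul ((fun t : ℝ => (t ^ (l + 1))⁻¹) ∘ y) (κ l)) x := fun l hl =>
    (h6 l hl).fsmul (contMDiffAt_comp_real (hφ l) h4)
  have h8 : extD θ x = extD ((∑ l ∈ Finset.range k,
      fsmul ((fun t : ℝ => (t ^ (l + 1))⁻¹) ∘ y) (κ l)) + S) x := by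
    refine extD_congr ((h1.and (h2 hx)).mono fun x' hx' => ?_)
    rw [hx'.1 hx'.2, add_apply, sum_apply]
    rfl
  rw [h8, extD_add_at (SmoothFormAt.sum _ hs) h3, extD_sum_at _ hs, ← Finset.sum_neg_distrib]
  refine congrArg (· + _) (Finset.sum_congr rfl fun l hl => ?_)
  rw [extD_fsmul_comp ((hφ l).differentiableAt (by simp)).hasDerivAt (hφ l) h4 (h6 l hl),
    (hκ l).dWedge_eq_zero, h7 l hl]
  exact (congrArg (· + _) (smul_zero _)).trans ((zero_add _).trans (smul_neg _ _))

/-- The coefficients of a polar part are unique: multiply by `y ^ k`, which reverses their order. -/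
theorem IsTube.polar_coeff_eq_zero {i : Z → M} (T : IsTube E E' i r y) {q : ℕ}
    {c : ℕ → Form E' Z q} {S : Form E M (q + 1)}
    (hS : ∀ᶠ x in 𝓝ˢ (Set.range i), SmoothFormAt S x)
    (h : ∀ᶠ x in 𝓝ˢ (Set.range i), x ∉ Set.range i →
      ∑ l ∈ Finset.range k, (y x ^ (l + 1))⁻¹ • dWedge y (pullback (E' := E) r (c l)) x = S x) :
    ∀ l < k, c l = 0 := by
  have key := T.coeff_eq_zero (N := k) (fun _ => 0) (fun l => c (k - 1 - l)) hS (by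
    filter_upwards [h, T.eventually_zero_iff] with x h1 h2 h3
    have hyx : y x ≠ 0 := fun h => h3 (h2.1 h)
    rw [← h1 h3, Finset.smul_sum, ← Finset.sum_range_reflect]
    refine Finset.sum_congr rfl fun l hl => ?_
    have hlk := Finset.mem_range.1 hl
    have h5 : y x ^ k = y x ^ (k - 1 - l) * y x ^ (l + 1) := by
      rw [← pow_add]
      congr 1
      omega
    have h6 : k - 1 - (k - 1 - l) = l := by omega
    rw [h6, h5, smul_smul, mul_inv_cancel_right₀ (pow_ne_zero _ hyx)]
    exact congrArg (y x ^ (k - 1 - l) • ·) (zero_add _))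
  intro l hl
  have h1 := key (k - 1 - l) (by omega)
  rwa [show k - 1 - (k - 1 - l) = l by omega] at h1

end BkForms

/-! ### Laurent series -/

section Laurent

variable {E : Type*} [NormedAddCommGroup E] [NormedSpace ℝ E]
variable {M : Type*} [TopologicalSpace M] [ChartedSpace E M] [IsManifold 𝓘(ℝ, E) ∞ M]
variable {E' : Type*} [NormedAddCommGroup E'] [NormedSpace ℝ E']
variable {Z : Type*} [TopologicalSpace Z] [ChartedSpace E' Z] [IsManifold 𝓘(ℝ, E') ∞ Z]
variable {k : ℕ} {r : M → Z} {y : M → ℝ}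

/-- A local defining function and a retraction onto `Z` near `Z` form a tube. -/
theorem BkStructure.isTube (X : BkStructure k E' Z E M)
    (hdim : Module.finrank ℝ E = Module.finrank ℝ E' + 1)
    (hr : ∀ z, IsRetractionAt E E' X.incl r z) (hy : IsLocalDefiningFunction E X.hyp y) :
    IsTube E E' X.incl r y := by
  obtain ⟨U, hU⟩ := hy
  have hz : ∀ z, ∀ᶠ x in 𝓝 (X.incl z), x ∈ U := fun z => hU.isOpen.mem_nhds (hU.subset ⟨z, rfl⟩)
  exact
    { finrank_eq := hdim
      smooth_incl := X.isSmoothEmbedding.contMDiff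
      isRetraction := hr
      smooth_fun := fun z => (hz z).mono fun x hx => hU.smooth.contMDiffAt (hU.isOpen.mem_nhds hx)
      zero_iff := fun z => (hz z).mono fun x hx => hU.zero_iff x hx
      mfderiv_ne := fun z => hU.mfderiv_ne _ ⟨z, rfl⟩ }

variable [FiniteDimensional ℝ E] [FiniteDimensional ℝ E']

/-- Closed `b^k`-forms have Laurent series whose coefficients are pulled back from `Z` under the
retraction; the coefficients are closed by uniqueness of the polar part of `dw = 0`. -/
theorem BkStructure.exists_isLaurentSeries_of_isTube [T2Space M] (X : BkStructure k E' Z E M)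
    (T : IsTube E E' X.incl r y) (hk : 1 ≤ k) (hyd : IsLocalDefiningFunction E X.hyp y)
    (hy : Represents y X.jet) {q : ℕ} {w : Form E M (q + 1)} (hw : w ∈ X.bkClosed (q + 1)) :
    ∃ α β, X.IsLaurentSeries w y α β := by
  obtain ⟨κ, e, S, hκ, hS, hexp⟩ := X.exists_polar_part T hk hy hw.1
  have hdexp := T.extD_polar_part hκ hS hexp
  choose c hc hκc hec using hκ
  have he : ∀ l < k, e l = 0 := T.polar_coeff_eq_zero
    (hS.eventually_nhdsSet.mono fun x hx => SmoothFormAt.extD hx) (by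
      filter_upwards [hdexp] with x h1 h2
      have h3 := h1 h2
      rw [hw.2 x h2, eq_comm, neg_add_eq_zero] at h3
      exact h3)
  obtain ⟨U, hU⟩ := hyd
  have hm : ∀ᶠ x in 𝓝ˢ (Set.range X.incl), x ∈ U := hU.isOpen.mem_nhdsSet.2 hU.subset
  obtain ⟨V, hV, hZV, hVp⟩ := eventually_nhdsSet_iff_exists.1
    (hm.and (hS.and (hexp.and T.eventually_smooth_retraction)))
  refine ⟨fun j => pullback (E' := E) r (c j), S, hy, V,
    ⟨hV, hZV, hU.smooth.mono fun x hx => (hVp x hx).1, fun x hx => hU.zero_iff x (hVp x hx).1,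
      hU.mfderiv_ne⟩, fun j => ?_, fun j x hx => ?_, ?_, ?_⟩
  · exact smoothFormOn_of_smoothFormAt fun x hx =>
      SmoothFormAt.pullback (hVp x hx).2.2.2 (hc j _)
  · rw [extD_pullback (hVp x hx).2.2.2 (hc j _), ← hec j, he j j.2]
    rfl
  · exact smoothFormOn_of_smoothFormAt fun x hx => (hVp x hx).2.1
  · rintro x ⟨hx, hxZ⟩
    rw [(hVp x hx).2.2.1 hxZ, Finset.sum_range]
    refine congrArg (· + _) (Finset.sum_congr rfl fun j _ => ?_)
    rw [hκc j]

theorem BkStructure.IsLaurentSeries.eventually {X : BkStructure k E' Z E M} {q : ℕ}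
    {w : Form E M (q + 1)} {α : Fin k → Form E M q} {β : Form E M (q + 1)}
    (h : X.IsLaurentSeries w y α β) : IsLocalDefiningFunction E X.hyp y ∧
      (∀ j, ∀ᶠ x in 𝓝ˢ (Set.range X.incl), SmoothFormAt (α j) x) ∧
      (∀ j, ∀ᶠ x in 𝓝ˢ (Set.range X.incl), extD (α j) x = 0) ∧
      (∀ᶠ x in 𝓝ˢ (Set.range X.incl), SmoothFormAt β x) ∧
      ∀ᶠ x in 𝓝ˢ (Set.range X.incl), x ∉ Set.range X.incl →
        w x = ∑ j : Fin k, (y x ^ ((j : ℕ) + 1))⁻¹ • dWedge y (α j) x + β x := by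
  obtain ⟨U, hU, h1, h2, h3, h4⟩ := h.exists_nhds
  have hm : ∀ᶠ x in 𝓝ˢ (Set.range X.incl), x ∈ U := hU.isOpen.mem_nhdsSet.2 hU.subset
  exact ⟨⟨U, hU⟩, fun j => hm.mono fun x hx => (h1 j).smoothFormAt hU.isOpen hx,
    fun j => hm.mono fun x hx => h2 j x hx, hm.mono fun x hx => h3.smoothFormAt hU.isOpen hx,
    hm.mono fun x hx hxZ => h4 x ⟨hx, hxZ⟩⟩

theorem BkStructure.pullback_mem_closedForms (X : BkStructure k E' Z E M) {q : ℕ}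
    {a : Form E M q} (ha : ∀ᶠ x in 𝓝ˢ (Set.range X.incl), SmoothFormAt a x)
    (ha' : ∀ᶠ x in 𝓝ˢ (Set.range X.incl), extD a x = 0) :
    pullback (E' := E') X.incl a ∈ closedForms E' Z q := by
  have hi : ContMDiff 𝓘(ℝ, E') 𝓘(ℝ, E) ∞ X.incl := X.isSmoothEmbedding.contMDiff
  refine ⟨smoothFormOn_of_smoothFormAt fun z _ => SmoothFormAt.pullback (hi z)
    (ha.self_of_nhdsSet _ ⟨z, rfl⟩), fun z => ?_⟩
  rw [extD_pullback (hi z) (ha.self_of_nhdsSet _ ⟨z, rfl⟩)]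
  exact (pullback_congr (η := 0) (ha'.self_of_nhdsSet _ ⟨z, rfl⟩)).trans rfl

/-- The residues of a Laurent series change by exact forms on `Z` if the form changes by the
differential of a `b^k`-form and the defining function changes within the jet. -/
theorem BkStructure.pullback_sub_mem_exactForms [T2Space M] (X : BkStructure k E' Z E M)
    (hdim : Module.finrank ℝ E = Module.finrank ℝ E' + 1)
    (hr : ∀ z, IsRetractionAt E E' X.incl r z) (hk : 1 ≤ k) {q : ℕ} {w w' : Form E M (q + 1)}
    {η : Form E M q} (hη : η ∈ X.bkForms q) (hwη : ∀ x ∉ X.hyp, extD η x = w x - w' x)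
    {α α' : Fin k → Form E M q} {y' : M → ℝ} {β β' : Form E M (q + 1)}
    (h : X.IsLaurentSeries w y α β) (h' : X.IsLaurentSeries w' y' α' β') (j : Fin k) :
    pullback (E' := E') X.incl (α j) - pullback (E' := E') X.incl (α' j) ∈
      exactForms E' Z q := by
  obtain ⟨hyd, hα, hdα, hβ, hw⟩ := h.eventually
  obtain ⟨hyd', hα', hdα', hβ', hw'⟩ := h'.eventually
  have T := X.isTube hdim hr hyd
  have T' := X.isTube hdim hr hyd'
  obtain ⟨κ, e, S, hκ, hS, hexp⟩ := X.exists_polar_part T hk h.represents hη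
  have hdexp := T.extD_polar_part hκ hS hexp
  obtain ⟨g, hg, hgy⟩ := T.exists_eq_add_of_represents hk h.represents h'.represents
  choose f hf hfy using fun l : Fin k => T.exists_dWedge_eq T' l.2 hg hgy
  -- The polar part of `dη` enters with a minus sign, hence `+ r^* (e l)` in the coefficients of
  -- `w - w' - dη = 0`.
  let δ : ℕ → Form E M q := fun l =>
    if hl : l < k then α ⟨l, hl⟩ - α' ⟨l, hl⟩ + pullback (E' := E) r (e l) else 0
  have hδ : ∀ l : Fin k, δ l = α l - α' l + pullback (E' := E) r (e l) := fun l => dif_pos l.2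
  have hδs : ∀ l, ∀ᶠ x in 𝓝ˢ (Set.range X.incl), SmoothFormAt (δ l) x ∧ extD (δ l) x = 0 := by
    intro l
    by_cases hl : l < k
    · simp only [δ, dif_pos hl]
      filter_upwards [hα ⟨l, hl⟩, hα' ⟨l, hl⟩, hdα ⟨l, hl⟩, hdα' ⟨l, hl⟩,
        T.eventually_smooth_retraction] with x h1 h2 h3 h4 h5
      have h6 := SmoothFormAt.pullback h5 ((hκ l).smoothFormAt_right (r x))
      refine ⟨(h1.sub h2).add h6, ?_⟩
      rw [extD_add_at (h1.sub h2) h6, extD_sub_at h1 h2, h3, h4,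
        extD_pullback h5 ((hκ l).smoothFormAt_right (r x)), sub_zero, zero_add]
      exact (pullback_congr (η := 0) ((hκ l).extD_right (r x))).trans rfl
    · simp only [δ, dif_neg hl]
      exact Filter.Eventually.of_forall fun x => ⟨smoothFormAt_zero x, extD_zero x⟩
  have hR : ∀ᶠ x in 𝓝ˢ (Set.range X.incl),
      SmoothFormAt (extD S - β + β' + ∑ l : Fin k, dWedge (f l) (α' l)) x := by
    filter_upwards [hS.eventually_nhdsSet, hβ, hβ', Filter.eventually_all.2 hf,
      Filter.eventually_all.2 hα'] with x h1 h2 h3 h4 h5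
    exact (((SmoothFormAt.extD h1).sub h2).add h3).add
      (SmoothFormAt.sum _ fun l _ => SmoothFormAt.dWedge (h4 l) (h5 l))
  have key := T.pullback_mem_exactForms (k := k) (fun l => (hδs l).mono fun x hx => hx.1)
    (fun l => (hδs l).mono fun x hx => hx.2) hR (by
      filter_upwards [hw, hw', hdexp, Filter.eventually_all.2 hfy] with x h1 h2 h3 h4 hx
      have h5 := hwη x hx
      rw [h1 hx, h2 hx, h3 hx, Finset.sum_range] at h5
      rw [Finset.sum_range]
      have h6 : ∀ l : Fin k, (y x ^ ((l : ℕ) + 1))⁻¹ • dWedge y (δ l) x =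
          (y x ^ ((l : ℕ) + 1))⁻¹ • dWedge y (α l) x -
          ((y' x ^ ((l : ℕ) + 1))⁻¹ • dWedge y' (α' l) x - dWedge (f l) (α' l) x) +
          (y x ^ ((l : ℕ) + 1))⁻¹ • dWedge y (pullback (E' := E) r (e l)) x := by
        intro l
        rw [hδ, dWedge_add, dWedge_sub, h4 l hx, add_sub_cancel_right]
        exact (smul_add _ _ _).trans (congrArg (· + _) (smul_sub _ _ _))
      rw [Finset.sum_congr rfl fun l _ => h6 l, Finset.sum_add_distrib, Finset.sum_sub_distrib,
        Finset.sum_sub_distrib, add_apply, add_apply, sub_apply, sum_apply]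
      generalize (∑ l : Fin k, (y x ^ ((l : ℕ) + 1))⁻¹ • dWedge y (α l) x) = a1 at *
      generalize (∑ l : Fin k, (y' x ^ ((l : ℕ) + 1))⁻¹ • dWedge y' (α' l) x) = a2 at *
      generalize (∑ l : Fin k, (y x ^ ((l : ℕ) + 1))⁻¹ •
        dWedge y (pullback (E' := E) r (e l)) x) = a3 at *
      rw [neg_add_eq_iff_eq_add] at h5
      rw [h5]
      abel)
  have h1 := key j j.2
  rw [hδ j, pullback_add, pullback_sub] at h1
  have h2 : pullback (E' := E') X.incl (pullback (E' := E) r (e j)) = e j := by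
    funext z
    have h3 := pullback_comp (e j) (f := r) (g := X.incl) (x := z)
      ((hr z).1.self_of_nhds.mdifferentiableAt (by simp))
      ((T.smooth_incl z).mdifferentiableAt (by simp))
    rw [← h3]
    exact (pullback_congr_map (g' := id)
      (Filter.Eventually.of_forall fun z' => T.r_incl z')).trans (pullback_id _ _)
  rw [h2] at h1
  exact (Submodule.add_mem_iff_left _ (hκ j).mem_exactForms).1 h1

end Laurent

/-! ### The residue map on cohomology -/

section Cohomology

variable {E : Type*} [NormedAddCommGroup E] [NormedSpace ℝ E]
variable {M : Type*} [TopologicalSpace M] [ChartedSpace E M] [IsManifold 𝓘(ℝ, E) ∞ M]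
variable {E' : Type*} [NormedAddCommGroup E'] [NormedSpace ℝ E']
variable {Z : Type*} [TopologicalSpace Z] [ChartedSpace E' Z] [IsManifold 𝓘(ℝ, E') ∞ Z]
variable {k : ℕ} [FiniteDimensional ℝ E] [FiniteDimensional ℝ E']

/-- Every closed `b^k`-form has a Laurent series in every defining function in the jet. If `Z` is
empty, there may be no retraction, and any Laurent series on the empty neighbourhood will do. -/
theorem BkStructure.exists_isLaurentSeries [T2Space M] [SecondCountableTopology M]
    (X : BkStructure k E' Z E M) (hdim : Module.finrank ℝ E = Module.finrank ℝ E' + 1)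
    (hk : 1 ≤ k) {q : ℕ} (w : X.bkClosed (q + 1)) (y : M → ℝ)
    (hyd : IsLocalDefiningFunction E X.hyp y) (hy : Represents y X.jet) :
    ∃ α β, X.IsLaurentSeries w.1 y α β := by
  rcases isEmpty_or_nonempty Z with hZ | hZ
  · have h0 : X.hyp = ∅ := Set.range_eq_empty X.incl
    refine ⟨0, 0, hy, ∅, ⟨isOpen_empty, by rw [h0], fun x hx => hx.elim, fun x hx => hx.elim, ?_⟩,
      fun _ => smoothFormOn_zero _, fun _ x hx => hx.elim, smoothFormOn_zero _,
      fun x hx => hx.1.elim⟩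
    rw [h0]
    exact fun x hx => hx.elim
  · obtain ⟨r, hr⟩ := exists_retraction X.isSmoothEmbedding X.isClosed_range
    exact X.exists_isLaurentSeries_of_isTube (X.isTube hdim hr hyd) hk hyd hy w.2

/-- The classes of the residues depend only on the class of the form. -/
theorem BkStructure.exists_isClassOf [T2Space M] [SecondCountableTopology M]
    (X : BkStructure k E' Z E M) (hdim : Module.finrank ℝ E = Module.finrank ℝ E' + 1)
    (hk : 1 ≤ k) {q : ℕ} (w w' : X.bkClosed (q + 1))
    (h : (Submodule.Quotient.mk w : X.BkCohomology (q + 1)) = Submodule.Quotient.mk w')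
    {y : M → ℝ} {α : Fin k → Form E M q} {β : Form E M (q + 1)}
    (hα : X.IsLaurentSeries w.1 y α β) {y' : M → ℝ} {α' : Fin k → Form E M q}
    {β' : Form E M (q + 1)} (hα' : X.IsLaurentSeries w'.1 y' α' β') (j : Fin k) :
    ∃ c : DeRham E' Z q, IsClassOf c (pullback X.incl (α j)) ∧
      IsClassOf c (pullback X.incl (α' j)) := by
  obtain ⟨-, hs, hd, -, -⟩ := hα.eventually
  obtain ⟨-, hs', hd', -, -⟩ := hα'.eventually
  have hc := X.pullback_mem_closedForms (hs j) (hd j)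
  have hc' := X.pullback_mem_closedForms (hs' j) (hd' j)
  refine ⟨Submodule.Quotient.mk ⟨_, hc⟩, ⟨hc, rfl⟩, hc', ?_⟩
  rw [Submodule.Quotient.eq]
  change pullback (E' := E') X.incl (α j) - pullback (E' := E') X.incl (α' j) ∈
    exactForms E' Z q
  rcases isEmpty_or_nonempty Z with hZ | hZ
  · have h0 : pullback (E' := E') X.incl (α j) - pullback (E' := E') X.incl (α' j) = 0 :=
      funext fun z => hZ.elim z
    rw [h0]
    exact Submodule.zero_mem _
  · obtain ⟨r, hr⟩ := exists_retraction X.isSmoothEmbedding X.isClosed_range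
    obtain ⟨-, η, hη, hwη⟩ := (Submodule.Quotient.eq _).1 h
    exact X.pullback_sub_mem_exactForms hdim hr hk hη hwη hα hα' j

theorem IsClassOf.unique {q : ℕ} {c c' : DeRham E' Z q} {a : Form E' Z q} (h : IsClassOf c a)
    (h' : IsClassOf c' a) : c = c' := by
  obtain ⟨_, rfl⟩ := h
  obtain ⟨_, rfl⟩ := h'
  rfl

theorem IsClassOf.add {q : ℕ} {c c' : DeRham E' Z q} {a a' : Form E' Z q} (h : IsClassOf c a)
    (h' : IsClassOf c' a') : IsClassOf (c + c') (a + a') := by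
  obtain ⟨ha, rfl⟩ := h
  obtain ⟨ha', rfl⟩ := h'
  exact ⟨Submodule.add_mem _ ha ha', rfl⟩

theorem IsClassOf.smul {q : ℕ} {c : DeRham E' Z q} {a : Form E' Z q} (t : ℝ)
    (h : IsClassOf c a) : IsClassOf (t • c) (t • a) := by
  obtain ⟨ha, rfl⟩ := h
  exact ⟨Submodule.smul_mem _ t ha, rfl⟩

theorem BkStructure.IsLaurentSeries.add {X : BkStructure k E' Z E M} {q : ℕ}
    {w w' : Form E M (q + 1)} {y : M → ℝ} {α α' : Fin k → Form E M q} {β β' : Form E M (q + 1)}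
    (h : X.IsLaurentSeries w y α β) (h' : X.IsLaurentSeries w' y α' β') :
    X.IsLaurentSeries (w + w') y (α + α') (β + β') := by
  obtain ⟨U, hU, h1, h2, h3, h4⟩ := h.exists_nhds
  obtain ⟨U', hU', h1', h2', h3', h4'⟩ := h'.exists_nhds
  have hs : ∀ j, ∀ x ∈ U ∩ U', SmoothFormAt (α j) x ∧ SmoothFormAt (α' j) x := fun j x hx =>
    ⟨(h1 j).smoothFormAt hU.isOpen hx.1, (h1' j).smoothFormAt hU'.isOpen hx.2⟩
  refine ⟨h.represents, U ∩ U', ⟨hU.isOpen.inter hU'.isOpen,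
    Set.subset_inter hU.subset hU'.subset, hU.smooth.mono Set.inter_subset_left,
    fun x hx => hU.zero_iff x hx.1, hU.mfderiv_ne⟩, fun j => ?_, fun j x hx => ?_, ?_, ?_⟩
  · exact smoothFormOn_of_smoothFormAt fun x hx => (hs j x hx).1.add (hs j x hx).2
  · exact (extD_add_at (hs j x hx).1 (hs j x hx).2).trans (by
      rw [h2 j x hx.1, h2' j x hx.2, add_zero])
  · exact smoothFormOn_of_smoothFormAt fun x hx =>
      (h3.smoothFormAt hU.isOpen hx.1).add (h3'.smoothFormAt hU'.isOpen hx.2)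
  · rintro x ⟨⟨hx, hx'⟩, hxZ⟩
    rw [add_apply, add_apply, h4 x ⟨hx, hxZ⟩, h4' x ⟨hx', hxZ⟩]
    have h5 : ∀ j : Fin k, (y x ^ ((j : ℕ) + 1))⁻¹ • dWedge y ((α + α') j) x =
        (y x ^ ((j : ℕ) + 1))⁻¹ • dWedge y (α j) x +
        (y x ^ ((j : ℕ) + 1))⁻¹ • dWedge y (α' j) x := fun j => by
      rw [Pi.add_apply, dWedge_add]
      exact smul_add _ _ _
    rw [Finset.sum_congr rfl fun j _ => h5 j, Finset.sum_add_distrib]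
    abel

theorem BkStructure.IsLaurentSeries.smul {X : BkStructure k E' Z E M} {q : ℕ}
    {w : Form E M (q + 1)} {y : M → ℝ} {α : Fin k → Form E M q} {β : Form E M (q + 1)} (t : ℝ)
    (h : X.IsLaurentSeries w y α β) : X.IsLaurentSeries (t • w) y (t • α) (t • β) := by
  obtain ⟨U, hU, h1, h2, h3, h4⟩ := h.exists_nhds
  refine ⟨h.represents, U, hU, fun j => (h1 j).smul t, fun j x hx => ?_, h3.smul t,
    fun x hx => ?_⟩
  · exact (extD_smul t (α j) x).trans (by rw [h2 j x hx, smul_zero])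
  · rw [smul_apply, smul_apply, h4 x hx]
    have h5 : ∀ j : Fin k, (y x ^ ((j : ℕ) + 1))⁻¹ • dWedge y ((t • α) j) x =
        t • ((y x ^ ((j : ℕ) + 1))⁻¹ • dWedge y (α j) x) := fun j => by
      rw [Pi.smul_apply, dWedge_smul]
      exact smul_comm _ _ _
    rw [Finset.sum_congr rfl fun j _ => h5 j, ← Finset.smul_sum]
    exact smul_add _ _ _

/-- The map of residues, defined through a chosen Laurent series of a chosen representative. -/
theorem BkStructure.exists_unique_laurentMap [T2Space M] [SecondCountableTopology M]
    (X : BkStructure k E' Z E M) (hdim : Module.finrank ℝ E = Module.finrank ℝ E' + 1)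
    (hk : 1 ≤ k) (q : ℕ) :
    ∃ L : X.BkCohomology (q + 1) →ₗ[ℝ] (Fin k → DeRham E' Z q), X.IsLaurentMap L ∧
      ∀ L' : X.BkCohomology (q + 1) → (Fin k → DeRham E' Z q), X.IsLaurentMap L' → L' = L := by
  obtain ⟨y, hyd, hy⟩ := X.exists_represents
  choose α β hαβ using fun w : X.bkClosed (q + 1) => X.exists_isLaurentSeries hdim hk w y hyd hy
  have hcl : ∀ w j, pullback (E' := E') X.incl (α w j) ∈ closedForms E' Z q := fun w j =>
    X.pullback_mem_closedForms ((hαβ w).eventually.2.1 j) ((hαβ w).eventually.2.2.1 j)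
  let R : X.bkClosed (q + 1) → Fin k → DeRham E' Z q := fun w j =>
    Submodule.Quotient.mk ⟨_, hcl w j⟩
  have hR : ∀ (w w' : X.bkClosed (q + 1)),
      (Submodule.Quotient.mk w : X.BkCohomology (q + 1)) = Submodule.Quotient.mk w' →
      ∀ y α' β', X.IsLaurentSeries w'.1 y α' β' → ∀ j,
        IsClassOf (R w j) (pullback X.incl (α' j)) := by
    intro w w' hww' y' α' β' h j
    obtain ⟨c, hc, hc'⟩ := X.exists_isClassOf hdim hk w w' hww' (hαβ w) h j
    have h1 : R w j = c := IsClassOf.unique ⟨hcl w j, rfl⟩ hc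
    rwa [h1]
  have hRα : ∀ w j, IsClassOf (R w j) (pullback X.incl (α w j)) := fun w j => ⟨hcl w j, rfl⟩
  let F : X.bkClosed (q + 1) →ₗ[ℝ] (Fin k → DeRham E' Z q) :=
    { toFun := R
      map_add' := fun w w' => funext fun j =>
        (hR (w + w') (w + w') rfl y _ _ ((hαβ w).add (hαβ w')) j).unique
          ((hRα w j).add (hRα w' j))
      map_smul' := fun t w => funext fun j =>
        (hR (t • w) (t • w) rfl y _ _ ((hαβ w).smul t) j).unique ((hRα w j).smul t) }
  have hF : (X.bkExact (q + 1)).submoduleOf (X.bkClosed (q + 1)) ≤ LinearMap.ker F := by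
    intro w hw
    rw [LinearMap.mem_ker, ← map_zero F]
    refine funext fun j => (hR w 0 ?_ y _ _ (hαβ 0) j).unique (hRα 0 j)
    exact (Submodule.Quotient.mk_eq_zero _).2 hw
  refine ⟨Submodule.liftQ _ F hF, ?_, ?_⟩
  · intro w y' α' β' h j
    exact hR w w rfl y' α' β' h j
  · intro L' hL'
    funext c
    obtain ⟨w, rfl⟩ := Submodule.Quotient.mk_surjective _ c
    exact funext fun j => (hL' w y _ _ (hαβ w) j).unique (hRα w j)

end Cohomology

end BkGeometry

end

theorem mainTheorem2 (n : ℕ)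
    {M : Type*} [TopologicalSpace M] [T2Space M] [SecondCountableTopology M]
    [ChartedSpace (EuclideanSpace ℝ (Fin (n + 1))) M]
    [IsManifold 𝓘(ℝ, EuclideanSpace ℝ (Fin (n + 1))) ∞ M]
    {Z : Type*} [TopologicalSpace Z] [ChartedSpace (EuclideanSpace ℝ (Fin n)) Z]
    [IsManifold 𝓘(ℝ, EuclideanSpace ℝ (Fin n)) ∞ Z]
    (k : ℕ) (hk : 1 ≤ k)
    (X : BkGeometry.BkStructure k (EuclideanSpace ℝ (Fin n)) Z
      (EuclideanSpace ℝ (Fin (n + 1))) M)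
    (q : ℕ) :
    -- every closed form has a Laurent series, in every defining function in the jet
    (∀ (w : X.bkClosed (q + 1)) (y : M → ℝ),
      BkGeometry.IsLocalDefiningFunction (EuclideanSpace ℝ (Fin (n + 1))) X.hyp y →
      BkGeometry.Represents y X.jet → ∃ α β, X.IsLaurentSeries w.1 y α β) ∧
    -- the classes of the pulled back coefficients depend only on the class of the form
    (∀ (w w' : X.bkClosed (q + 1)),
      (Submodule.Quotient.mk w : X.BkCohomology (q + 1)) = Submodule.Quotient.mk w' →
      ∀ y α β, X.IsLaurentSeries w.1 y α β → ∀ y' α' β', X.IsLaurentSeries w'.1 y' α' β' →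
      ∀ i, ∃ c : BkGeometry.DeRham (EuclideanSpace ℝ (Fin n)) Z q,
        BkGeometry.IsClassOf c (BkGeometry.pullback X.incl (α i)) ∧
        BkGeometry.IsClassOf c (BkGeometry.pullback X.incl (α' i))) ∧
    -- the resulting map on cohomology exists, is unique, and is linear
    (∃ L : X.BkCohomology (q + 1) →ₗ[ℝ]
        (Fin k → BkGeometry.DeRham (EuclideanSpace ℝ (Fin n)) Z q),
      X.IsLaurentMap L ∧
      ∀ L' : X.BkCohomology (q + 1) →
          (Fin k → BkGeometry.DeRham (EuclideanSpace ℝ (Fin n)) Z q),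
        X.IsLaurentMap L' → L' = L) := by
  have hdim : Module.finrank ℝ (EuclideanSpace ℝ (Fin (n + 1))) =
      Module.finrank ℝ (EuclideanSpace ℝ (Fin n)) + 1 := by simp
  exact ⟨fun w y hyd hy => X.exists_isLaurentSeries hdim hk w y hyd hy,
    fun w w' h y α β hα y' α' β' hα' j => X.exists_isClassOf hdim hk w w' h hα hα' j,
    X.exists_unique_laurentMap hdim hk q⟩
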